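/- Let $\Omega\subset\mathbb{R}^n$ be open, $T>0$, $\Omega_T=\Omega\times(0,T)$; sums over repeated indices are understood. Let $V(\Omega_T;\mathbb{R}^N)$ be the closure of the functions in $C^1(\Omega_T;\mathbb{R}^N)$ of finite norm under $$\|v\|_{V(\Omega_T)}^2=\sup_{0<t<T}\int_\Omega |v(x,t)|^2\,dx+\iint_{\Omega_T}|\nabla v|^2\,dx\,dt ,$$ where $\nabla$ is the gradient in $x$, and the supremum is understood as an essential supremum. Put $V(\Omega_T)=V(\Omega_T;\mathbb{R})$. Let $H\in C^2(\mathbb{R}^N)$, let $\lambda>0$, and let $a_{\alpha\beta}$, $c^i_{\alpha\beta}$ ($1\le\alpha,\beta\le n$, $1\le i\le N$) be real coefficients, which may depend on $(x,t)$ and on $\mathbf u$. Consider the strongly coupled system $$u^i_t-\big(a_{\alpha\beta}u^i_{x_\beta}+c^i_{\alpha\beta}H(\mathbf u)_{x_\beta}\big)_{x_\alpha}=0,\qquad i=1,\dots,N. \qquad (*)$$ Let $\mathbf u\in V(\Omega_T;\mathbb{R}^N)$ be an (essentially) bounded weak solution of $(*)$, i.e. $$\iint_{\Omega_T}-u^iw^i_t+\big(a_{\alpha\beta}u^i_{x_\beta}+c^i_{\alpha\beta}H_{z_j}(\mathbf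 u)u^j_{x_\beta}\big)w^i_{x_\alpha}\,dx\,dt=0\quad\text{for all } \mathbf w\in H^1_0(\Omega_T;\mathbb{R}^N).$$ Assume that the coefficients, evaluated along $\mathbf u$, are measurable and bounded, that for a.e. $(x,t)\in\Omega_T$ $$\lambda|\zeta|^2\le a_{\alpha\beta}\zeta_\alpha\zeta_\beta\ \ (\zeta\in\mathbb{R}^n),\qquad \lambda|\xi|^2\le\big(a_{\alpha\beta}\delta^{ij}+c^i_{\alpha\beta}H_{z_j}(\mathbf u)\big)\xi^i_\alpha\xi^j_\beta\ \ (\xi\in\mathbb{R}^{nN}),$$ and that $\lambda|\zeta|^2\le H_{z_iz_j}(z)\zeta^i\zeta^j$ for all $z,\zeta\in\mathbb{R}^N$. Set $A_{\alpha\beta}:=a_{\alpha\beta}+c^i_{\alpha\beta}H_{z_i}(\mathbf u)$. Then the $A_{\alpha\beta}$ are measurable, bounded and strictly elliptic: $\lambda|\zeta|^2\le A_{\alpha\beta}\zeta_\alpha\zeta_\beta$ for a.e. $(x,t)\in\Omega_T$ and all $\zeta\in\mathbb{R}^n$. Moreover there is $s_0>0$ such that for every $s\ge s_0$ there is a constant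 $c>0$ for which $v:=e^{sH(\mathbf u)}$ is an entropy: $v$ has a weak spatial gradient in $L^2(\Omega_T)$, $v\in V(\Omega_T)$ if $|\Omega|<\infty$, and $v$ weakly satisfies $$v_t-(A_{\alpha\beta}v_{x_\beta})_{x_\alpha}+c|\nabla\mathbf u|^2\le 0\quad\text{in }\Omega_T ,$$ i.e. for every $\varphi\in H^1_0(\Omega_T)$ with $\varphi\ge0$ a.e. and $v\varphi_t\in L^1(\Omega_T)$ (the last condition is automatic if $|\Omega|<\infty$), the following integrand is integrable and $$\iint_{\Omega_T}-v\varphi_t+A_{\alpha\beta}v_{x_\beta}\varphi_{x_\alpha}+c|\nabla\mathbf u|^2\varphi\,dx\,dt\le0 .$$ -/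

import Mathlib

open MeasureTheory Filter Topology Set
open scoped ENNReal ContDiff

/-- Points `(x, t)` of space-time. -/
abbrev SpaceTime (n : ℕ) : Type := EuclideanSpace ℝ (Fin n) × ℝ

/-- The cylinder `Ω_T = Ω × (0, T)`. -/
def cylinder {n : ℕ} (Ω : Set (EuclideanSpace ℝ (Fin n))) (T : ℝ) : Set (SpaceTime n) :=
  Ω ×ˢ Ioo 0 T

/-- Lebesgue measure on `Ω_T`. -/
noncomputable def cylMeasure {n : ℕ} (Ω : Set (EuclideanSpace ℝ (Fin n))) (T : ℝ) :
    Measure (SpaceTime n) :=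
  (volume : Measure (SpaceTime n)).restrict (cylinder Ω T)

/-- The classical partial derivative `∂φ/∂x_α`. -/
noncomputable def spaceDeriv {n : ℕ} {F : Type*} [NormedAddCommGroup F] [NormedSpace ℝ F]
    (α : Fin n) (φ : SpaceTime n → F) (p : SpaceTime n) : F :=
  fderiv ℝ φ p (EuclideanSpace.single α 1, 0)

/-- The classical partial derivative `∂φ/∂t`. -/
noncomputable def timeDeriv {n : ℕ} {F : Type*} [NormedAddCommGroup F] [NormedSpace ℝ F]
    (φ : SpaceTime n → F) (p : SpaceTime n) : F :=
  fderiv ℝ φ p (0, 1)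

/-- `|∇u|²`, the gradient `Du` being given by its columns `Du α = u_{x_α}`. -/
noncomputable def gradNormSq {n : ℕ} {F : Type*} [NormedAddCommGroup F]
    (Du : Fin n → SpaceTime n → F) (p : SpaceTime n) : ℝ :=
  ∑ α, ‖Du α p‖ ^ 2

/-- `sup_t ∫_Ω |v(x,t)|² dx + ∬_{Ω_T} |∇v|² dx dt`. For a function that is `C¹` in `Ω_T` the
essential supremum over `t` is the supremum; the essential supremum makes the norm independent
of the representative for general `v`. -/
noncomputable def vNormSq {n : ℕ} {F : Type*} [NormedAddCommGroup F]
    (Ω : Set (EuclideanSpace ℝ (Fin n))) (T : ℝ)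
    (v : SpaceTime n → F) (Dv : Fin n → SpaceTime n → F) : ℝ≥0∞ :=
  essSup (fun t : ℝ => ∫⁻ x in Ω, ‖v (x, t)‖ₑ ^ 2) ((volume : Measure ℝ).restrict (Ioo 0 T))
    + ∫⁻ p, ∑ α, ‖Dv α p‖ₑ ^ 2 ∂(cylMeasure Ω T)

/-- `u ∈ V(Ω_T; F)` with spatial gradient `Du`: the pair `(u, Du)` is a limit, in the norm of `V`,
of functions that are `C¹` in `Ω_T` and have finite norm, together with their gradients. -/
def MemV {n : ℕ} {F : Type*} [NormedAddCommGroup F] [NormedSpace ℝ F]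
    (Ω : Set (EuclideanSpace ℝ (Fin n))) (T : ℝ)
    (u : SpaceTime n → F) (Du : Fin n → SpaceTime n → F) : Prop :=
  AEStronglyMeasurable u (cylMeasure Ω T) ∧
  (∀ α, AEStronglyMeasurable (Du α) (cylMeasure Ω T)) ∧
  ∃ φ : ℕ → SpaceTime n → F,
    (∀ k, ContDiffOn ℝ 1 (φ k) (cylinder Ω T) ∧
      vNormSq Ω T (φ k) (fun α => spaceDeriv α (φ k)) < ⊤) ∧
    Tendsto (fun k => vNormSq Ω T (fun p => φ k p - u p)
      (fun α p => spaceDeriv α (φ k) p - Du α p)) atTop (𝓝 0)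

/-- `φ ∈ C_c^∞(Ω_T; F)`. -/
def IsTestFunction {n : ℕ} {F : Type*} [NormedAddCommGroup F] [NormedSpace ℝ F]
    (Ω : Set (EuclideanSpace ℝ (Fin n))) (T : ℝ) (φ : SpaceTime n → F) : Prop :=
  ContDiff ℝ ∞ φ ∧ HasCompactSupport φ ∧ tsupport φ ⊆ cylinder Ω T

/-- `w ∈ H¹₀(Ω_T; F)` with weak derivatives `w_t = wt` and `w_{x_α} = Dw α`: the `H¹(Ω_T)`-closure
of `C_c^∞(Ω_T; F)`. -/
def MemH10 {n : ℕ} {F : Type*} [NormedAddCommGroup F] [NormedSpace ℝ F]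
    (Ω : Set (EuclideanSpace ℝ (Fin n))) (T : ℝ)
    (w wt : SpaceTime n → F) (Dw : Fin n → SpaceTime n → F) : Prop :=
  AEStronglyMeasurable w (cylMeasure Ω T) ∧
  AEStronglyMeasurable wt (cylMeasure Ω T) ∧
  (∀ α, AEStronglyMeasurable (Dw α) (cylMeasure Ω T)) ∧
  ∃ φ : ℕ → SpaceTime n → F,
    (∀ k, IsTestFunction Ω T (φ k)) ∧
    Tendsto (fun k => ∫⁻ p, (‖φ k p - w p‖ₑ ^ 2 + ‖timeDeriv (φ k) p - wt p‖ₑ ^ 2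
      + ∑ α, ‖spaceDeriv α (φ k) p - Dw α p‖ₑ ^ 2) ∂(cylMeasure Ω T)) atTop (𝓝 0)

/-- `Dv` is the weak spatial gradient of the scalar function `v` in `Ω_T`. -/
def HasWeakSpatialGradient {n : ℕ} (Ω : Set (EuclideanSpace ℝ (Fin n))) (T : ℝ)
    (v : SpaceTime n → ℝ) (Dv : Fin n → SpaceTime n → ℝ) : Prop :=
  LocallyIntegrableOn v (cylinder Ω T) ∧
  (∀ α, LocallyIntegrableOn (Dv α) (cylinder Ω T)) ∧
  ∀ α, ∀ φ : SpaceTime n → ℝ, IsTestFunction Ω T φ →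
    ∫ p, v p * spaceDeriv α φ p ∂(cylMeasure Ω T) = - ∫ p, Dv α p * φ p ∂(cylMeasure Ω T)

/-- `H_{z_j}(z)`. -/
noncomputable def partialH {N : ℕ} (H : EuclideanSpace ℝ (Fin N) → ℝ) (j : Fin N)
    (z : EuclideanSpace ℝ (Fin N)) : ℝ :=
  fderiv ℝ H z (EuclideanSpace.single j 1)

/-- `A^{ij}_{αβ} = a_{αβ} δ^{ij} + c^i_{αβ} H_{z_j}` at the point `p = (x, t)` and the value `z`. -/
noncomputable def systemCoeff {n N : ℕ}
    (a : Fin n → Fin n → SpaceTime n → EuclideanSpace ℝ (Fin N) → ℝ)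
    (c : Fin N → Fin n → Fin n → SpaceTime n → EuclideanSpace ℝ (Fin N) → ℝ)
    (H : EuclideanSpace ℝ (Fin N) → ℝ)
    (i j : Fin N) (α β : Fin n) (p : SpaceTime n) (z : EuclideanSpace ℝ (Fin N)) : ℝ :=
  (if i = j then a α β p z else 0) + c i α β p z * partialH H j z

/-- `A_{αβ} = a_{αβ} + c^i_{αβ} H_{z_i}` (sum over `i`) along the function `u`. -/
noncomputable def entropyCoeff {n N : ℕ}
    (a : Fin n → Fin n → SpaceTime n → EuclideanSpace ℝ (Fin N) → ℝ)
    (c : Fin N → Fin n → Fin n → SpaceTime n → EuclideanSpace ℝ (Fin N) → ℝ)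
    (H : EuclideanSpace ℝ (Fin N) → ℝ) (u : SpaceTime n → EuclideanSpace ℝ (Fin N))
    (α β : Fin n) (p : SpaceTime n) : ℝ :=
  a α β p (u p) + ∑ i, c i α β p (u p) * partialH H i (u p)

/-- `u ∈ V(Ω_T; ℝ^N)`, with spatial gradient `Du`, is a weak solution of
`u^i_t - (a_{αβ} u^i_{x_β} + c^i_{αβ} H(u)_{x_β})_{x_α} = 0`, where
`H(u)_{x_β} = H_{z_j}(u) u^j_{x_β}`. -/
def IsWeakSolution {n N : ℕ} (Ω : Set (EuclideanSpace ℝ (Fin n))) (T : ℝ)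
    (a : Fin n → Fin n → SpaceTime n → EuclideanSpace ℝ (Fin N) → ℝ)
    (c : Fin N → Fin n → Fin n → SpaceTime n → EuclideanSpace ℝ (Fin N) → ℝ)
    (H : EuclideanSpace ℝ (Fin N) → ℝ)
    (u : SpaceTime n → EuclideanSpace ℝ (Fin N))
    (Du : Fin n → SpaceTime n → EuclideanSpace ℝ (Fin N)) : Prop :=
  MemV Ω T u Du ∧
  ∀ (w wt : SpaceTime n → EuclideanSpace ℝ (Fin N))
    (Dw : Fin n → SpaceTime n → EuclideanSpace ℝ (Fin N)),
    MemH10 Ω T w wt Dw →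
    ∫ p, (- (∑ i, u p i * wt p i)
      + ∑ i, ∑ α, ∑ β, (a α β p (u p) * Du β p i
          + c i α β p (u p) * ∑ j, partialH H j (u p) * Du β p j) * Dw α p i)
      ∂(cylMeasure Ω T) = 0

/-- The scalar function `v`, with spatial gradient `Dv`, weakly satisfies
`v_t - (A_{αβ} v_{x_β})_{x_α} + f ≤ 0` in `Ω_T`: the inequality is tested with all nonnegative
`φ ∈ H¹₀(Ω_T)` for which `v φ_t` is integrable. For `v ∈ L²(Ω_T)`, in particular for `v ∈ V(Ω_T)`,
these are all nonnegative `φ ∈ H¹₀(Ω_T)`. -/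
def IsWeakSubsolution {n : ℕ} (Ω : Set (EuclideanSpace ℝ (Fin n))) (T : ℝ)
    (A : Fin n → Fin n → SpaceTime n → ℝ) (f : SpaceTime n → ℝ)
    (v : SpaceTime n → ℝ) (Dv : Fin n → SpaceTime n → ℝ) : Prop :=
  ∀ (φ φt : SpaceTime n → ℝ) (Dφ : Fin n → SpaceTime n → ℝ),
    MemH10 Ω T φ φt Dφ →
    (∀ᵐ p ∂(cylMeasure Ω T), 0 ≤ φ p) →
    Integrable (fun p => v p * φt p) (cylMeasure Ω T) →
    Integrable (fun p => - (v p * φt p) + (∑ α, ∑ β, A α β p * Dv β p * Dφ α p) + f p * φ p)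
      (cylMeasure Ω T) ∧
    ∫ p, (- (v p * φt p) + (∑ α, ∑ β, A α β p * Dv β p * Dφ α p) + f p * φ p)
      ∂(cylMeasure Ω T) ≤ 0

/-! Write F = e^{sH}, v = F(u), and let J_α be the flux of the system. Formally, multiplying the
system by F_{z_i}(u) gives v_t = (DF(u)J_α)_{x_α} - D²F(u)(u_{x_α}, J_α), and two algebraic facts
make this a scalar inequality.

The flux closes: DF is a multiple of DH, and DH applied to a_{αβ}u_{x_β} + c_{αβ}H(u)_{x_β} is
(a_{αβ} + c_{αβ}·∇H)H(u)_{x_β}. Hence DF(u)J_α = A_{αβ}v_{x_β} (`fderiv_expEntropy_fluxVec`).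
Testing the ellipticity of the system with the rank-one ξ = ∇H ⊗ ζ shows that A is elliptic
(`entropyCoeff_elliptic`).

The remaining term is coercive: with h = ∇(H(u)) it equals sv times the sum of a_{αβ}D²H(u_{x_α},
u_{x_β}), a mixed term of order |h||∇u|, and s A_{αβ}h_αh_β. The first is at least λ²|∇u|² and the
last at least sλ|h|², so for large s Young's inequality absorbs the mixed term (`dissipation_ge`).
Since u is bounded, v is bounded below by a positive constant, which gives c.

The formal computation needs justification, since u need not have a time derivative as a function.
Mollifying in space-time turns the weak equation into a pointwise balance law for smooth functions;
the classical chain rule applies there, and after integration by parts every term is a bounded, a.e.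
convergent coefficient acting on L²-convergent factors (`integral_fderiv_mul_comp_of_balance`,
`tendsto_integral_bilin_apply`).

This settles smooth nonnegative test functions. For φ in H¹₀ the approximating test functions may
change sign, and v may fail to be in L² when |Ω| is infinite. They are therefore replaced by a
smoothed absolute value times a cutoff in x, and the limit uses that derivatives of φ vanish a.e. on
{φ = 0} (`ae_eq_zero_of_approx`, `integral_le_of_memH10`). Membership in V follows by composing the
C¹ approximations of u with a truncation of F (`MemV.comp_of_bounded`). -/

set_option maxSynthPendingDepth 3
set_option linter.unusedSectionVars false

/-! ### Passage to the limit in integrals of bilinear expressions. -/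

section BilinearLimits

variable {α E G W : Type*} [MeasurableSpace α] {μ : Measure α}
  [NormedAddCommGroup E] [NormedSpace ℝ E] [NormedAddCommGroup G] [NormedSpace ℝ G]
  [NormedAddCommGroup W] [NormedSpace ℝ W]

theorem aestronglyMeasurable_bilin_apply {b : α → E →L[ℝ] G →L[ℝ] W} {f : α → E} {g : α → G}
    (hb : AEStronglyMeasurable b μ) (hf : AEStronglyMeasurable f μ)
    (hg : AEStronglyMeasurable g μ) : AEStronglyMeasurable (fun x => b x (f x) (g x)) μ := by
  have hc : Continuous fun q : (E →L[ℝ] G →L[ℝ] W) × E × G => q.1 q.2.1 q.2.2 := by fun_prop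
  exact hc.comp_aestronglyMeasurable (hb.prodMk (hf.prodMk hg))

theorem lintegral_enorm_bilin_apply_le {b : α → E →L[ℝ] G →L[ℝ] W} {f : α → E} {g : α → G}
    {C : ℝ} (hbC : ∀ᵐ x ∂μ, ‖b x‖ ≤ C) (hf : AEStronglyMeasurable f μ)
    (hg : AEStronglyMeasurable g μ) :
    ∫⁻ x, ‖b x (f x) (g x)‖ₑ ∂μ ≤ ENNReal.ofReal C * eLpNorm f 2 μ * eLpNorm g 2 μ := by
  have h1 : ∫⁻ x, ‖f x‖ₑ * ‖g x‖ₑ ∂μ ≤ eLpNorm f 2 μ * eLpNorm g 2 μ := by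
    have := eLpNorm_le_eLpNorm_mul_eLpNorm'_of_norm (p := 2) (q := 2) (r := 1) (μ := μ) hf.norm
      hg.norm (fun s t : ℝ => s * t) 1 (by simp)
    simpa [eLpNorm_one_eq_lintegral_enorm, enorm_mul] using this
  calc ∫⁻ x, ‖b x (f x) (g x)‖ₑ ∂μ
      ≤ ∫⁻ x, ENNReal.ofReal C * (‖f x‖ₑ * ‖g x‖ₑ) ∂μ := by
        refine lintegral_mono_ae (hbC.mono fun x hx => ?_)
        calc ‖b x (f x) (g x)‖ₑ ≤ ‖b x‖ₑ * ‖f x‖ₑ * ‖g x‖ₑ := by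
              rw [← ofReal_norm, ← ofReal_norm, ← ofReal_norm, ← ofReal_norm,
                ← ENNReal.ofReal_mul (norm_nonneg _), ← ENNReal.ofReal_mul (by positivity)]
              exact ENNReal.ofReal_le_ofReal ((b x).le_opNorm₂ _ _)
          _ ≤ ENNReal.ofReal C * (‖f x‖ₑ * ‖g x‖ₑ) := by
              rw [mul_assoc]
              gcongr
              rw [← ofReal_norm]
              exact ENNReal.ofReal_le_ofReal hx
    _ = ENNReal.ofReal C * ∫⁻ x, ‖f x‖ₑ * ‖g x‖ₑ ∂μ :=
        lintegral_const_mul' _ _ ENNReal.ofReal_ne_top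
    _ ≤ _ := by rw [mul_assoc]; gcongr

theorem integrable_bilin_apply {b : α → E →L[ℝ] G →L[ℝ] W} {f : α → E} {g : α → G} {C : ℝ}
    (hb : AEStronglyMeasurable b μ) (hbC : ∀ᵐ x ∂μ, ‖b x‖ ≤ C) (hf : MemLp f 2 μ)
    (hg : MemLp g 2 μ) : Integrable (fun x => b x (f x) (g x)) μ :=
  ⟨aestronglyMeasurable_bilin_apply hb hf.1 hg.1,
    (lintegral_enorm_bilin_apply_le hbC hf.1 hg.1).trans_lt
      (ENNReal.mul_lt_top (ENNReal.mul_lt_top ENNReal.ofReal_lt_top hf.2) hg.2)⟩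

/-- Bounded a.e. convergent bilinear forms evaluated at two sequences that converge in `L²`. -/
theorem tendsto_integral_bilin_apply {b : ℕ → α → E →L[ℝ] G →L[ℝ] W}
    {b₀ : α → E →L[ℝ] G →L[ℝ] W} {f : ℕ → α → E} {f₀ : α → E} {g : ℕ → α → G} {g₀ : α → G} {C : ℝ}
    (hb : ∀ k, AEStronglyMeasurable (b k) μ) (hbC : ∀ k, ∀ᵐ x ∂μ, ‖b k x‖ ≤ C)
    (hb₀ : ∀ᵐ x ∂μ, Tendsto (fun k => b k x) atTop (𝓝 (b₀ x)))
    (hf : ∀ k, MemLp (f k) 2 μ) (hf₀ : MemLp f₀ 2 μ)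
    (hft : Tendsto (fun k => eLpNorm (f k - f₀) 2 μ) atTop (𝓝 0))
    (hg : ∀ k, MemLp (g k) 2 μ) (hg₀ : MemLp g₀ 2 μ)
    (hgt : Tendsto (fun k => eLpNorm (g k - g₀) 2 μ) atTop (𝓝 0)) :
    Tendsto (fun k => ∫ x, b k x (f k x) (g k x) ∂μ) atTop (𝓝 (∫ x, b₀ x (f₀ x) (g₀ x) ∂μ)) := by
  have hb₀m : AEStronglyMeasurable b₀ μ := aestronglyMeasurable_of_tendsto_ae atTop hb hb₀
  have hb₀C : ∀ᵐ x ∂μ, ‖b₀ x‖ ≤ C := by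
    filter_upwards [hb₀, ae_all_iff.2 hbC] with x hx hx'
    exact le_of_tendsto hx.norm (Eventually.of_forall hx')
  refine tendsto_integral_of_L1 _ (integrable_bilin_apply hb₀m hb₀C hf₀ hg₀).1
    (Eventually.of_forall fun k => integrable_bilin_apply (hb k) (hbC k) (hf k) (hg k)) ?_
  -- The arguments are exchanged one at a time. Replacing f_k and then g_k by the limits costs a
  -- Cauchy–Schwarz bound with the uniform C. Only the last term, with f₀ and g₀ fixed, uses the
  -- a.e. convergence of b_k; it is dominated by 2C‖f₀‖‖g₀‖.
  have hle : ∀ k, ∫⁻ x, ‖b k x (f k x) (g k x) - b₀ x (f₀ x) (g₀ x)‖ₑ ∂μ ≤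
      ENNReal.ofReal C * eLpNorm (f k - f₀) 2 μ * (eLpNorm (g k - g₀) 2 μ + eLpNorm g₀ 2 μ) +
      ENNReal.ofReal C * eLpNorm f₀ 2 μ * eLpNorm (g k - g₀) 2 μ +
      ∫⁻ x, ‖(b k x - b₀ x) (f₀ x) (g₀ x)‖ₑ ∂μ := by
    intro k
    have e1 := lintegral_enorm_bilin_apply_le (hbC k) ((hf k).1.sub hf₀.1) (hg k).1
    have e2 := lintegral_enorm_bilin_apply_le (hbC k) hf₀.1 ((hg k).1.sub hg₀.1)
    have e3 : eLpNorm (g k) 2 μ ≤ eLpNorm (g k - g₀) 2 μ + eLpNorm g₀ 2 μ := by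
      simpa using eLpNorm_add_le ((hg k).1.sub hg₀.1) hg₀.1 (one_le_two)
    have m1 := aestronglyMeasurable_bilin_apply (hb k) ((hf k).1.sub hf₀.1) (hg k).1
    have m2 := aestronglyMeasurable_bilin_apply (hb k) hf₀.1 ((hg k).1.sub hg₀.1)
    calc ∫⁻ x, ‖b k x (f k x) (g k x) - b₀ x (f₀ x) (g₀ x)‖ₑ ∂μ
        ≤ ∫⁻ x, (‖b k x ((f k - f₀) x) (g k x)‖ₑ + ‖b k x (f₀ x) ((g k - g₀) x)‖ₑ) +
            ‖(b k x - b₀ x) (f₀ x) (g₀ x)‖ₑ ∂μ := by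
          refine lintegral_mono fun x => ?_
          have : b k x (f k x) (g k x) - b₀ x (f₀ x) (g₀ x) =
            (b k x ((f k - f₀) x) (g k x) + b k x (f₀ x) ((g k - g₀) x)) +
              (b k x - b₀ x) (f₀ x) (g₀ x) := by simp
          rw [this]
          exact (enorm_add_le _ _).trans (add_le_add_left (enorm_add_le _ _) _)
      _ = ∫⁻ x, ‖b k x ((f k - f₀) x) (g k x)‖ₑ ∂μ + ∫⁻ x, ‖b k x (f₀ x) ((g k - g₀) x)‖ₑ ∂μ +
            ∫⁻ x, ‖(b k x - b₀ x) (f₀ x) (g₀ x)‖ₑ ∂μ := by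
          have m12 : AEMeasurable (fun x => ‖b k x ((f k - f₀) x) (g k x)‖ₑ +
            ‖b k x (f₀ x) ((g k - g₀) x)‖ₑ) μ := m1.enorm.add m2.enorm
          rw [lintegral_add_left' m12, lintegral_add_left' m1.enorm]
      _ ≤ _ := by
          gcongr
          exact e1.trans (by gcongr)
  refine tendsto_of_tendsto_of_tendsto_of_le_of_le tendsto_const_nhds ?_ (fun _ => zero_le) hle
  have h3 : Tendsto (fun k => ∫⁻ x, ‖(b k x - b₀ x) (f₀ x) (g₀ x)‖ₑ ∂μ) atTop (𝓝 0) := by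
    have := tendsto_lintegral_of_dominated_convergence' (μ := μ)
      (F := fun k x => ‖(b k x - b₀ x) (f₀ x) (g₀ x)‖ₑ) (f := fun _ => 0)
      (fun x => ENNReal.ofReal (2 * C) * (‖f₀ x‖ₑ * ‖g₀ x‖ₑ))
      (fun k => (aestronglyMeasurable_bilin_apply ((hb k).sub hb₀m) hf₀.1 hg₀.1).enorm)
      (fun k => by
        filter_upwards [hbC k, hb₀C] with x h1 h2
        calc ‖(b k x - b₀ x) (f₀ x) (g₀ x)‖ₑ ≤ ‖b k x - b₀ x‖ₑ * ‖f₀ x‖ₑ * ‖g₀ x‖ₑ := by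
              rw [← ofReal_norm, ← ofReal_norm, ← ofReal_norm, ← ofReal_norm,
                ← ENNReal.ofReal_mul (norm_nonneg _), ← ENNReal.ofReal_mul (by positivity)]
              exact ENNReal.ofReal_le_ofReal ((b k x - b₀ x).le_opNorm₂ _ _)
          _ ≤ _ := by
              rw [mul_assoc]
              gcongr
              rw [← ofReal_norm]
              exact ENNReal.ofReal_le_ofReal ((norm_sub_le (b k x) (b₀ x)).trans (by linarith)))
      (by
        rw [lintegral_const_mul' _ _ ENNReal.ofReal_ne_top]
        refine ENNReal.mul_ne_top ENNReal.ofReal_ne_top ?_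
        have := eLpNorm_le_eLpNorm_mul_eLpNorm'_of_norm (p := 2) (q := 2) (r := 1) (μ := μ)
          hf₀.1.norm hg₀.1.norm (fun s t : ℝ => s * t) 1 (by simp)
        simp only [eLpNorm_one_eq_lintegral_enorm, enorm_mul, enorm_norm, eLpNorm_norm] at this
        exact (this.trans_lt (by simpa using ENNReal.mul_lt_top hf₀.2 hg₀.2)).ne)
      (by
        filter_upwards [hb₀] with x hx
        have hc : Continuous fun q : (E →L[ℝ] G →L[ℝ] W) => ‖(q - b₀ x) (f₀ x) (g₀ x)‖ₑ := by
          fun_prop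
        have := (hc.tendsto (b₀ x)).comp hx
        simp only [sub_self, _root_.zero_apply, enorm_zero] at this
        exact this)
    simpa using this
  have h1 : Tendsto (fun k => ENNReal.ofReal C * eLpNorm (f k - f₀) 2 μ *
      (eLpNorm (g k - g₀) 2 μ + eLpNorm g₀ 2 μ)) atTop (𝓝 0) := by
    have a1 : Tendsto (fun k => ENNReal.ofReal C * eLpNorm (f k - f₀) 2 μ) atTop (𝓝 0) := by
      simpa using ENNReal.Tendsto.const_mul hft (Or.inr ENNReal.ofReal_ne_top)
    have a2 : Tendsto (fun k => eLpNorm (g k - g₀) 2 μ + eLpNorm g₀ 2 μ) atTop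
        (𝓝 (eLpNorm g₀ 2 μ)) := by simpa using hgt.add_const (eLpNorm g₀ 2 μ)
    simpa using ENNReal.Tendsto.mul a1 (Or.inr hg₀.2.ne) a2 (Or.inr ENNReal.zero_ne_top)
  have h2 : Tendsto (fun k => ENNReal.ofReal C * eLpNorm f₀ 2 μ * eLpNorm (g k - g₀) 2 μ)
      atTop (𝓝 0) := by
    simpa using ENNReal.Tendsto.const_mul hgt
      (Or.inr (ENNReal.mul_ne_top ENNReal.ofReal_ne_top hf₀.2.ne))
  simpa using (h1.add h2).add h3

end BilinearLimits

/-! ### Mollification: contraction and convergence in L². -/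

section Mollification

open ContinuousLinearMap Metric
open scoped Convolution

variable {X E : Type*} [NormedAddCommGroup X] [NormedSpace ℝ X] [FiniteDimensional ℝ X]
  [MeasureSpace X] [BorelSpace X] [(volume : Measure X).IsAddHaarMeasure]
  [NormedAddCommGroup E] [NormedSpace ℝ E]

theorem eLpNorm_two_sq {α : Type*} [MeasurableSpace α] {μ : Measure α} (f : α → E) :
    eLpNorm f 2 μ ^ 2 = ∫⁻ x, ‖f x‖ₑ ^ 2 ∂μ := by
  have h := eLpNorm_nnreal_pow_eq_lintegral (f := f) (μ := μ) (p := 2) two_ne_zero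
  simpa only [ENNReal.coe_ofNat, NNReal.coe_ofNat, ENNReal.rpow_ofNat] using h

theorem tendsto_eLpNorm_two_iff {α : Type*} [MeasurableSpace α] {μ : Measure α}
    (f : ℕ → α → E) : Tendsto (fun k => eLpNorm (f k) 2 μ) atTop (𝓝 0) ↔
      Tendsto (fun k => ∫⁻ x, ‖f k x‖ₑ ^ 2 ∂μ) atTop (𝓝 0) := by
  simp_rw [← eLpNorm_two_sq]
  constructor
  · intro h
    simpa using ENNReal.Tendsto.pow (n := 2) h
  · intro h
    have := (ENNReal.continuous_rpow_const (y := 1 / 2)).tendsto 0 |>.comp h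
    simpa [Function.comp_def, ← ENNReal.rpow_natCast_mul] using this

theorem lintegral_sq_le_of_isProbabilityMeasure {α : Type*} [MeasurableSpace α] {ν : Measure α}
    [IsProbabilityMeasure ν] {f : α → E} (hf : AEStronglyMeasurable f ν) :
    (∫⁻ x, ‖f x‖ₑ ∂ν) ^ 2 ≤ ∫⁻ x, ‖f x‖ₑ ^ 2 ∂ν := by
  rw [← eLpNorm_two_sq, ← eLpNorm_one_eq_lintegral_enorm]
  gcongr
  exact eLpNorm_le_eLpNorm_of_exponent_le one_le_two hf

variable (X) in
/-- A standard sequence of bump functions shrinking to the origin. -/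
noncomputable def bumpSeq (k : ℕ) : ContDiffBump (0 : X) :=
  ⟨1 / (k + 1), 2 / (k + 1), by positivity, by gcongr; norm_num⟩

theorem tendsto_bumpSeq_rOut : Tendsto (fun k => (bumpSeq X k).rOut) atTop (𝓝 0) := by
  have := (tendsto_one_div_add_atTop_nhds_zero_nat (𝕜 := ℝ)).const_mul 2
  simpa [bumpSeq, div_eq_mul_inv] using this

/-- The standard smooth mollification of a function. -/
noncomputable def mollify (k : ℕ) (f : X → E) : X → E :=
  (bumpSeq X k).normed volume ⋆[lsmul ℝ ℝ, volume] f

theorem mollify_eq_integral (k : ℕ) (f : X → E) (x : X) :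
    mollify k f x = ∫ t, (bumpSeq X k).normed volume t • f (x - t) := rfl

theorem lintegral_enorm_bumpSeq (k : ℕ) : ∫⁻ t, ‖(bumpSeq X k).normed volume t‖ₑ = 1 := by
  have h := (bumpSeq X k).integral_normed (μ := volume)
  rw [integral_eq_lintegral_of_nonneg_ae
    (Eventually.of_forall fun t => (bumpSeq X k).nonneg_normed t)
    (bumpSeq X k).continuous_normed.aestronglyMeasurable] at h
  rw [← ENNReal.toReal_eq_one_iff, ← h]
  congr 1
  refine lintegral_congr fun t => ?_
  rw [Real.enorm_eq_ofReal ((bumpSeq X k).nonneg_normed t)]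

theorem aestronglyMeasurable_comp_sub_left {f : X → E} (hf : AEStronglyMeasurable f volume)
    (x : X) : AEStronglyMeasurable (fun t => f (x - t)) volume :=
  hf.comp_quasiMeasurePreserving (quasiMeasurePreserving_sub_left volume x)

/-- Jensen's inequality for the probability measure whose density is the bump function. -/
theorem enorm_mollify_sq_le {f : X → E} (hf : AEStronglyMeasurable f volume) (k : ℕ) (x : X) :
    ‖mollify k f x‖ₑ ^ 2 ≤ ∫⁻ t, ‖(bumpSeq X k).normed volume t‖ₑ * ‖f (x - t)‖ₑ ^ 2 := by
  have hw : Measurable fun t => ‖(bumpSeq X k).normed volume t‖ₑ :=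
    (bumpSeq X k).continuous_normed.measurable.enorm
  have hfx := aestronglyMeasurable_comp_sub_left hf x
  let ν := (volume : Measure X).withDensity fun t => ‖(bumpSeq X k).normed volume t‖ₑ
  have hν : IsProbabilityMeasure ν := ⟨by simp [ν, lintegral_enorm_bumpSeq]⟩
  have hac : ν ≪ volume := withDensity_absolutelyContinuous _ _
  calc ‖mollify k f x‖ₑ ^ 2
      ≤ (∫⁻ t, ‖(bumpSeq X k).normed volume t‖ₑ * ‖f (x - t)‖ₑ) ^ 2 := by
        gcongr
        rw [mollify_eq_integral]
        refine (enorm_integral_le_lintegral_enorm _).trans (le_of_eq ?_)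
        exact lintegral_congr fun t => by rw [enorm_smul]
    _ = (∫⁻ t, ‖f (x - t)‖ₑ ∂ν) ^ 2 := by
        rw [lintegral_withDensity_eq_lintegral_mul₀' hw.aemeasurable
          (hfx.mono_ac hac).enorm]
        rfl
    _ ≤ ∫⁻ t, ‖f (x - t)‖ₑ ^ 2 ∂ν := lintegral_sq_le_of_isProbabilityMeasure (hfx.mono_ac hac)
    _ = _ := by
        rw [lintegral_withDensity_eq_lintegral_mul₀' hw.aemeasurable
          ((hfx.mono_ac hac).enorm.pow_const 2)]
        rfl

/-- After Tonelli in the pointwise Jensen bound, each translate of f has the same square integral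
and the weights have total mass one. -/
theorem eLpNorm_mollify_le {f : X → E} (hf : AEStronglyMeasurable f volume) (k : ℕ) :
    eLpNorm (mollify k f) 2 volume ≤ eLpNorm f 2 volume := by
  rw [← ENNReal.pow_le_pow_left_iff two_ne_zero, eLpNorm_two_sq, eLpNorm_two_sq]
  have hw : Measurable fun t => ‖(bumpSeq X k).normed volume t‖ₑ :=
    (bumpSeq X k).continuous_normed.measurable.enorm
  have hm : AEMeasurable (fun q : X × X => ‖f (q.1 - q.2)‖ₑ ^ 2)
      ((volume : Measure X).prod volume) :=
    (hf.comp_quasiMeasurePreserving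
      (quasiMeasurePreserving_sub_of_right_invariant volume volume)).enorm.pow_const 2
  calc ∫⁻ x, ‖mollify k f x‖ₑ ^ 2
      ≤ ∫⁻ x, ∫⁻ t, ‖(bumpSeq X k).normed volume t‖ₑ * ‖f (x - t)‖ₑ ^ 2 :=
        lintegral_mono fun x => enorm_mollify_sq_le hf k x
    _ = ∫⁻ t, ∫⁻ x, ‖(bumpSeq X k).normed volume t‖ₑ * ‖f (x - t)‖ₑ ^ 2 :=
        lintegral_lintegral_swap ((hw.comp measurable_snd).aemeasurable.mul hm)
    _ = ∫⁻ t, ‖(bumpSeq X k).normed volume t‖ₑ * ∫⁻ x, ‖f x‖ₑ ^ 2 := by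
        refine lintegral_congr fun t => ?_
        rw [lintegral_const_mul' _ _ (by simp), lintegral_sub_right_eq_self (fun x => ‖f x‖ₑ ^ 2) t]
    _ = ∫⁻ x, ‖f x‖ₑ ^ 2 := by
        rw [lintegral_mul_const _ hw, lintegral_enorm_bumpSeq, one_mul]

theorem norm_mollify_le {f : X → E} {M : ℝ} (hM : ∀ᵐ x : X, ‖f x‖ ≤ M) (k : ℕ) (x : X) :
    ‖mollify k f x‖ ≤ M := by
  have hM' : ∀ᵐ t : X, ‖f (x - t)‖ ≤ M :=
    (quasiMeasurePreserving_sub_left volume x).ae hM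
  rw [mollify_eq_integral]
  calc ‖∫ t, (bumpSeq X k).normed volume t • f (x - t)‖
      ≤ ∫ t, (bumpSeq X k).normed volume t * M := by
        refine norm_integral_le_of_norm_le ((bumpSeq X k).integrable_normed.mul_const M) ?_
        filter_upwards [hM'] with t ht
        rw [norm_smul, Real.norm_of_nonneg ((bumpSeq X k).nonneg_normed t)]
        exact mul_le_mul_of_nonneg_left ht ((bumpSeq X k).nonneg_normed t)
    _ = M := by rw [integral_mul_const, (bumpSeq X k).integral_normed, one_mul]

theorem contDiff_mollify [CompleteSpace E] {f : X → E} (hf : LocallyIntegrable f volume) (k : ℕ) :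
    ContDiff ℝ ∞ (mollify k f) :=
  (bumpSeq X k).hasCompactSupport_normed.contDiff_convolution_left _
    (bumpSeq X k).contDiff_normed hf

theorem mollify_sub {f g : X → E} (hf : LocallyIntegrable f volume)
    (hg : LocallyIntegrable g volume) (k : ℕ) : mollify k (f - g) = mollify k f - mollify k g := by
  have hc : ∀ {h : X → E}, LocallyIntegrable h volume →
      ConvolutionExists ((bumpSeq X k).normed volume) h (lsmul ℝ ℝ) volume := fun h =>
    (bumpSeq X k).hasCompactSupport_normed.convolutionExists_left _
      (bumpSeq X k).continuous_normed h
  have hs : f - g = f + (-1 : ℝ) • g := by simp [sub_eq_add_neg]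
  unfold mollify
  rw [hs, ConvolutionExists.distrib_add (hc hf) (hc (hg.smul (-1 : ℝ))), convolution_smul]
  simp [sub_eq_add_neg]

/-- Lebesgue differentiation; it applies because the outer radius of each bump is a fixed multiple
(two) of the inner one. -/
theorem ae_tendsto_mollify [CompleteSpace E] {f : X → E} (hf : LocallyIntegrable f volume) :
    ∀ᵐ x, Tendsto (fun k => mollify k f x) atTop (𝓝 (f x)) :=
  ContDiffBump.ae_convolution_tendsto_right_of_locallyIntegrable (K := 2) tendsto_bumpSeq_rOut
    (Eventually.of_forall fun k => by simp [bumpSeq, div_eq_mul_inv]) hf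

theorem tendsto_eLpNorm_mollify_sub_of_continuous [CompleteSpace E] {g : X → E}
    (hg : Continuous g) (hgc : HasCompactSupport g) :
    Tendsto (fun k => eLpNorm (mollify k g - g) 2 volume) atTop (𝓝 0) := by
  obtain ⟨M, hM⟩ := hgc.exists_bound_of_continuous hg
  have hM0 : 0 ≤ M := (norm_nonneg _).trans (hM 0)
  -- The largest outer radius, at k = 0, is 2. Hence all mollifications of g vanish outside the
  -- compact K, and a constant on K dominates.
  set K := cthickening 2 (tsupport g) with hK
  have hKc : IsCompact K := hgc.isCompact.cthickening
  have hbound : ∀ k x, ‖(mollify k g - g) x‖ₑ ^ 2 ≤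
      K.indicator (fun _ => ENNReal.ofReal (2 * M) ^ 2) x := by
    intro k x
    by_cases hx : x ∈ K
    · rw [indicator_of_mem hx, ← ofReal_norm]
      gcongr
      have h1 := norm_mollify_le (Eventually.of_forall hM) k x
      exact (norm_sub_le (mollify k g x) (g x)).trans (by linarith [hM x])
    · rw [indicator_of_notMem hx]
      have hz : ∀ y ∈ ball x 2, g y = 0 := by
        intro y hy
        by_contra hne
        refine hx (mem_cthickening_of_dist_le x y 2 _ (subset_tsupport _ hne) ?_)
        rw [dist_comm]
        exact (mem_ball.1 hy).le
      have hx0 : g x = 0 := hz x (mem_ball_self two_pos)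
      have : mollify k g x = g x := by
        refine ContDiffBump.normed_convolution_eq_right fun y hy => ?_
        rw [hx0]
        refine hz y (ball_subset_ball ?_ hy)
        simp only [bumpSeq]
        rw [div_le_iff₀ (by positivity)]
        nlinarith [(Nat.cast_nonneg k : (0 : ℝ) ≤ k)]
      simp [this]
  rw [tendsto_eLpNorm_two_iff]
  have := tendsto_lintegral_of_dominated_convergence' (μ := (volume : Measure X))
    (F := fun k x => ‖(mollify k g - g) x‖ₑ ^ 2) (f := fun _ => 0)
    (K.indicator fun _ => ENNReal.ofReal (2 * M) ^ 2)
    (fun k => by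
      have hc := (contDiff_mollify hg.locallyIntegrable k).continuous.sub hg
      exact hc.aestronglyMeasurable.enorm.pow_const 2)
    (fun k => Eventually.of_forall (hbound k))
    (by
      rw [lintegral_indicator_const hKc.measurableSet]
      exact ENNReal.mul_ne_top (ENNReal.pow_ne_top ENNReal.ofReal_ne_top) hKc.measure_lt_top.ne)
    (Eventually.of_forall fun x => by
      have h := ContDiffBump.convolution_tendsto_right_of_continuous
        (μ := (volume : Measure X)) (tendsto_bumpSeq_rOut (X := X)) hg x
      have h' : Tendsto (fun k => mollify k g x) atTop (𝓝 (g x)) := h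
      have hc : Continuous fun y : E => ‖y - g x‖ₑ ^ 2 := by fun_prop
      simpa [Function.comp_def] using (hc.tendsto (g x)).comp h')
  simpa using this

theorem MeasureTheory.MemLp.mollify [CompleteSpace E] {f : X → E} (hf : MemLp f 2 volume) (k : ℕ) :
    MemLp (mollify k f) 2 volume :=
  ⟨(contDiff_mollify (hf.locallyIntegrable one_le_two) k).continuous.aestronglyMeasurable,
    (eLpNorm_mollify_le hf.1 k).trans_lt hf.2⟩

/-- Density of compactly supported continuous functions in L²; the contraction property controls the
mollified remainder uniformly in k. -/
theorem tendsto_eLpNorm_mollify_sub [CompleteSpace E] {f : X → E} (hf : MemLp f 2 volume) :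
    Tendsto (fun k => eLpNorm (mollify k f - f) 2 volume) atTop (𝓝 0) := by
  rw [ENNReal.tendsto_nhds_zero]
  intro ε hε
  obtain ⟨g, hgc, hfg, hg, hgm⟩ := hf.exists_hasCompactSupport_eLpNorm_sub_le
    (ENNReal.ofNat_ne_top) (ε := ε / 3) (by simpa using hε.ne')
  have h3 := ENNReal.tendsto_nhds_zero.1 (tendsto_eLpNorm_mollify_sub_of_continuous hg hgc) (ε / 3)
    (ENNReal.div_pos hε.ne' (by simp))
  filter_upwards [h3] with k hk
  have hfl := hf.locallyIntegrable one_le_two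
  have hgl := hgm.locallyIntegrable one_le_two
  have hsplit : mollify k f - f = mollify k (f - g) + ((mollify k g - g) + (g - f)) := by
    rw [mollify_sub hfl hgl]
    abel
  rw [hsplit]
  have m1 := ((hf.sub hgm).mollify k).1
  have m2 := ((hgm.mollify k).sub hgm).1
  have m3 := (hgm.sub hf).1
  calc _ ≤ eLpNorm (mollify k (f - g)) 2 volume + (eLpNorm (mollify k g - g) 2 volume +
        eLpNorm (g - f) 2 volume) :=
        (eLpNorm_add_le m1 (m2.add m3) one_le_two).trans
          (by gcongr; exact eLpNorm_add_le m2 m3 one_le_two)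
    _ ≤ ε / 3 + (ε / 3 + ε / 3) := by
        gcongr
        · exact (eLpNorm_mollify_le (hf.sub hgm).1 k).trans hfg
        · rwa [← neg_sub, eLpNorm_neg]
    _ = ε := by rw [← add_assoc, ENNReal.add_thirds]

end Mollification

/-! ### Chain rules for weak derivatives and for weak balance laws. -/

section ChainRule

open ContinuousLinearMap Metric
open scoped Convolution

variable {X E : Type*} [NormedAddCommGroup X] [NormedSpace ℝ X] [FiniteDimensional ℝ X]
  [MeasureSpace X] [BorelSpace X] [(volume : Measure X).IsAddHaarMeasure]
  [NormedAddCommGroup E] [NormedSpace ℝ E] [CompleteSpace E]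

/-- Smooth compactly supported scalar functions in the open set `U`. -/
def IsTestOn (U : Set X) (φ : X → ℝ) : Prop :=
  ContDiff ℝ ∞ φ ∧ HasCompactSupport φ ∧ tsupport φ ⊆ U

/-- `g` is the weak derivative of `f` in direction `v` on `U`. -/
def HasWeakLineDeriv (U : Set X) (v : X) (f g : X → E) : Prop :=
  ∀ φ : X → ℝ, IsTestOn U φ → ∫ x, fderiv ℝ φ x v • f x = - ∫ x, φ x • g x

theorem IsTestOn.continuous_fderiv_apply {U : Set X} {φ : X → ℝ} (hφ : IsTestOn U φ) (v : X) :
    Continuous fun x => fderiv ℝ φ x v :=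
  (hφ.1.continuous_fderiv (by simp)).clm_apply continuous_const

theorem IsTestOn.hasCompactSupport_fderiv_apply {U : Set X} {φ : X → ℝ} (hφ : IsTestOn U φ)
    (v : X) : HasCompactSupport fun x => fderiv ℝ φ x v :=
  hφ.2.1.fderiv_apply (𝕜 := ℝ) v

/-- The mollifying kernel centred at x is itself an admissible test function. This is how weak
identities on U become pointwise identities for mollifications, away from the boundary of U. -/
theorem isTestOn_bumpSeq_comp_sub_left {U : Set X} {k : ℕ} {x : X}
    (hx : closedBall x (bumpSeq X k).rOut ⊆ U) :
    IsTestOn U fun q => (bumpSeq X k).normed volume (x - q) := by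
  have hs : tsupport (fun q => (bumpSeq X k).normed volume (x - q)) ⊆
      closedBall x (bumpSeq X k).rOut := by
    refine closure_minimal (fun q hq => ?_) isClosed_closedBall
    have : x - q ∈ ball (0 : X) (bumpSeq X k).rOut := by
      rw [← (bumpSeq X k).support_normed_eq (μ := volume)]
      exact hq
    rw [mem_ball_zero_iff] at this
    rw [mem_closedBall, dist_eq_norm_sub']
    exact this.le
  exact ⟨(bumpSeq X k).contDiff_normed.comp (contDiff_const.sub contDiff_id),
    (isCompact_closedBall _ _).of_isClosed_subset (isClosed_tsupport _) hs, hs.trans hx⟩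

theorem mollify_eq_integral_swap (k : ℕ) (f : X → E) (x : X) :
    mollify k f x = ∫ q, (bumpSeq X k).normed volume (x - q) • f q :=
  convolution_eq_swap _

/-- The derivative falls on the kernel; the sign comes from differentiating in q, the variable of
the test function, instead of x. -/
theorem fderiv_mollify_apply {f : X → E} (hf : LocallyIntegrable f volume) (k : ℕ) (x v : X) :
    fderiv ℝ (mollify k f) x v =
      - ∫ q, fderiv ℝ (fun q => (bumpSeq X k).normed volume (x - q)) q v • f q := by
  have hd := ((bumpSeq X k).hasCompactSupport_normed (μ := volume)).hasFDerivAt_convolution_left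
    (μ := (volume : Measure X)) (lsmul ℝ ℝ) ((bumpSeq X k).contDiff_normed (μ := volume) (n := 1)) hf x
  have hex : ConvolutionExistsAt (fderiv ℝ ((bumpSeq X k).normed volume)) f x
      ((lsmul ℝ ℝ).precompL X) (volume : Measure X) :=
    ((bumpSeq X k).hasCompactSupport_normed.fderiv ℝ).convolutionExists_left _
      (((bumpSeq X k).contDiff_normed (n := 1)).continuous_fderiv (by simp)) hf x
  have hd' : fderiv ℝ (mollify k f) x = _ := hd.fderiv
  rw [hd', convolution_eq_swap, ContinuousLinearMap.integral_apply, ← integral_neg]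
  · refine integral_congr_ae (Eventually.of_forall fun q => ?_)
    have hdiff : DifferentiableAt ℝ ((bumpSeq X k).normed volume) (x - q) :=
      ((bumpSeq X k).contDiff_normed (n := 1)).differentiable (by simp) _
    have h2 : HasFDerivAt (fun q => (bumpSeq X k).normed volume (x - q))
        ((fderiv ℝ ((bumpSeq X k).normed volume) (x - q)).comp (-ContinuousLinearMap.id ℝ X)) q :=
      hdiff.hasFDerivAt.comp q ((hasFDerivAt_id q).const_sub x)
    simp [h2.fderiv, precompL_apply]
  · exact hex.integrable_swap

theorem HasWeakLineDeriv.fderiv_mollify {U : Set X} {v : X} {f g : X → E}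
    (h : HasWeakLineDeriv U v f g) (hf : LocallyIntegrable f volume) {k : ℕ} {x : X}
    (hx : closedBall x (bumpSeq X k).rOut ⊆ U) :
    fderiv ℝ (mollify k f) x v = mollify k g x := by
  rw [fderiv_mollify_apply hf, h _ (isTestOn_bumpSeq_comp_sub_left hx), neg_neg,
    mollify_eq_integral_swap]

/-- Testing the balance law with the kernel makes it hold pointwise for the mollifications, although
u need not have a weak derivative in direction τ that is a function. -/
theorem fderiv_mollify_eq_sum {ι : Type*} [Fintype ι] {U : Set X} {τ : X} {d : ι → X} {u : X → E}
    {g : ι → X → E} (hu : LocallyIntegrable u volume) (hg : ∀ i, LocallyIntegrable (g i) volume)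
    (h : ∀ φ : X → ℝ, IsTestOn U φ →
      ∫ x, fderiv ℝ φ x τ • u x = ∑ i, ∫ x, fderiv ℝ φ x (d i) • g i x)
    {k : ℕ} {x : X} (hx : closedBall x (bumpSeq X k).rOut ⊆ U) :
    fderiv ℝ (mollify k u) x τ = ∑ i, fderiv ℝ (mollify k (g i)) x (d i) := by
  rw [fderiv_mollify_apply hu, h _ (isTestOn_bumpSeq_comp_sub_left hx), ← Finset.sum_neg_distrib]
  exact Finset.sum_congr rfl fun i _ => (fderiv_mollify_apply (hg i) k x (d i)).symm

theorem IsTestOn.eventually_closedBall_subset {U : Set X} (hU : IsOpen U) {φ : X → ℝ}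
    (hφ : IsTestOn U φ) :
    ∀ᶠ k in atTop, ∀ x ∈ tsupport φ, closedBall x (bumpSeq X k).rOut ⊆ U := by
  obtain ⟨δ, hδ, hδU⟩ := hφ.2.1.isCompact.exists_cthickening_subset_open hU hφ.2.2
  filter_upwards [(tendsto_bumpSeq_rOut (X := X)).eventually_le_const hδ] with k hk x hx
  exact ((closedBall_subset_closedBall hk).trans (closedBall_subset_cthickening hx δ)).trans hδU

variable {F : E → ℝ} {M : ℝ}

theorem IsTestOn.memLp {U : Set X} {φ : X → ℝ} (hφ : IsTestOn U φ) : MemLp φ 2 volume :=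
  hφ.1.continuous.memLp_of_hasCompactSupport hφ.2.1

theorem IsTestOn.memLp_fderiv_apply {U : Set X} {φ : X → ℝ} (hφ : IsTestOn U φ) (v : X) :
    MemLp (fun x => fderiv ℝ φ x v) 2 volume :=
  (hφ.continuous_fderiv_apply v).memLp_of_hasCompactSupport (hφ.hasCompactSupport_fderiv_apply v)

theorem exists_bound_on_closedBall [FiniteDimensional ℝ E] {W : Type*} [NormedAddCommGroup W]
    {G : E → W} (hG : Continuous G) (M : ℝ) : ∃ C, ∀ z : E, ‖z‖ ≤ M → ‖G z‖ ≤ C := by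
  obtain ⟨C, hC⟩ := (isCompact_closedBall (0 : E) M).exists_bound_of_continuousOn hG.continuousOn
  exact ⟨C, fun z hz => hC z (by simpa using hz)⟩

theorem tendsto_integral_mul_comp_mollify [FiniteDimensional ℝ E] {u : X → E} {ψ : X → ℝ}
    (hu : LocallyIntegrable u volume) (huM : ∀ᵐ x, ‖u x‖ ≤ M) (hF : Continuous F)
    (hψ : Continuous ψ) (hψc : HasCompactSupport ψ) :
    Tendsto (fun k => ∫ x, ψ x * F (mollify k u x)) atTop (𝓝 (∫ x, ψ x * F (u x))) := by
  obtain ⟨C, hC⟩ := exists_bound_on_closedBall hF M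
  refine tendsto_integral_of_dominated_convergence (fun x => ‖ψ x‖ * C)
    (fun k => (hψ.mul (hF.comp (contDiff_mollify hu k).continuous)).aestronglyMeasurable)
    ((hψ.integrable_of_hasCompactSupport hψc).norm.mul_const C)
    (fun k => Eventually.of_forall fun x => ?_) ?_
  · rw [norm_mul]
    exact mul_le_mul_of_nonneg_left (hC _ (norm_mollify_le huM k x)) (norm_nonneg _)
  · filter_upwards [ae_tendsto_mollify hu] with x hx
    exact ((hF.tendsto _).comp hx).const_mul _

theorem tendsto_integral_clm_mollify [FiniteDimensional ℝ E] {u g : X → E}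
    {G : E → E →L[ℝ] ℝ} {ψ : X → ℝ} (hu : LocallyIntegrable u volume)
    (huM : ∀ᵐ x, ‖u x‖ ≤ M) (hg : MemLp g 2 volume) (hG : Continuous G) (hψ : MemLp ψ 2 volume) :
    Tendsto (fun k => ∫ x, ψ x * G (mollify k u x) (mollify k g x)) atTop
      (𝓝 (∫ x, ψ x * G (u x) (g x))) := by
  obtain ⟨C, hC⟩ := exists_bound_on_closedBall hG M
  let L : (E →L[ℝ] ℝ) →L[ℝ] ℝ →L[ℝ] E →L[ℝ] ℝ := (lsmul ℝ ℝ).flip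
  have h := tendsto_integral_bilin_apply (μ := (volume : Measure X))
    (b := fun k x => L (G (mollify k u x))) (b₀ := fun x => L (G (u x))) (f := fun _ => ψ)
    (f₀ := ψ) (g := fun k => mollify k g) (g₀ := g) (C := ‖L‖ * C)
    (fun k => ((L.continuous.comp hG).comp
      (contDiff_mollify hu k).continuous).aestronglyMeasurable)
    (fun k => Eventually.of_forall fun x => (L.le_opNorm _).trans
      (mul_le_mul_of_nonneg_left (hC _ (norm_mollify_le huM k x)) (norm_nonneg _)))
    (by
      filter_upwards [ae_tendsto_mollify hu] with x hx
      exact ((L.continuous.comp hG).tendsto _).comp hx)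
    (fun _ => hψ) hψ (by simp) (fun k => hg.mollify k) hg (tendsto_eLpNorm_mollify_sub hg)
  simpa [L] using h

/-- Quadratic expressions in f and g pass to the limit because both mollifications converge strongly
in L². -/
theorem tendsto_integral_bilin_mollify [FiniteDimensional ℝ E] {u f g : X → E}
    {G : E → E →L[ℝ] E →L[ℝ] ℝ} {ψ : X → ℝ} (hu : LocallyIntegrable u volume)
    (huM : ∀ᵐ x, ‖u x‖ ≤ M) (hf : MemLp f 2 volume) (hg : MemLp g 2 volume) (hG : Continuous G)
    (hψ : Continuous ψ) (hψc : HasCompactSupport ψ) :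
    Tendsto (fun k => ∫ x, ψ x * G (mollify k u x) (mollify k f x) (mollify k g x)) atTop
      (𝓝 (∫ x, ψ x * G (u x) (f x) (g x))) := by
  obtain ⟨C, hC⟩ := exists_bound_on_closedBall hG M
  obtain ⟨D, hD⟩ := hψc.exists_bound_of_continuous hψ
  have h := tendsto_integral_bilin_apply (μ := (volume : Measure X))
    (b := fun k x => ψ x • G (mollify k u x)) (b₀ := fun x => ψ x • G (u x))
    (f := fun k => mollify k f) (f₀ := f) (g := fun k => mollify k g) (g₀ := g) (C := D * C)
    (fun k => (hψ.smul (hG.comp (contDiff_mollify hu k).continuous)).aestronglyMeasurable)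
    (fun k => Eventually.of_forall fun x => by
      rw [norm_smul]
      exact mul_le_mul (hD x) (hC _ (norm_mollify_le huM k x)) (norm_nonneg _)
        ((norm_nonneg _).trans (hD x)))
    (by
      filter_upwards [ae_tendsto_mollify hu] with x hx
      exact ((hG.tendsto _).comp hx).const_smul _)
    (fun k => hf.mollify k) hf (tendsto_eLpNorm_mollify_sub hf)
    (fun k => hg.mollify k) hg (tendsto_eLpNorm_mollify_sub hg)
  simpa using h

theorem integral_fderiv_mul_comp_eq {U : Set X} {φ : X → ℝ} (hφ : IsTestOn U φ) {w : X → E}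
    (hw : ContDiff ℝ ∞ w) (hF : ContDiff ℝ 1 F) (v : X) :
    ∫ x, fderiv ℝ φ x v * F (w x) = - ∫ x, φ x * fderiv ℝ F (w x) (fderiv ℝ w x v) := by
  have hFw : ContDiff ℝ 1 fun x => F (w x) := hF.comp (hw.of_le (by norm_cast))
  have hder : ∀ x, fderiv ℝ (fun x => F (w x)) x v = fderiv ℝ F (w x) (fderiv ℝ w x v) := by
    intro x
    have := ((hF.differentiable (by simp) (w x)).hasFDerivAt.comp x
      (hw.differentiable (by simp) x).hasFDerivAt).fderiv
    rw [show (fun x => F (w x)) = F ∘ w from rfl, this]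
    rfl
  have h := integral_mul_fderiv_eq_neg_fderiv_mul_of_integrable (μ := (volume : Measure X))
    (f := φ) (g := fun x => F (w x)) (v := v)
    (((hφ.continuous_fderiv_apply v).mul hFw.continuous).integrable_of_hasCompactSupport
      (hφ.hasCompactSupport_fderiv_apply v).mul_right)
    ((hφ.1.continuous.mul ((hFw.continuous_fderiv (by simp)).clm_apply
      continuous_const)).integrable_of_hasCompactSupport hφ.2.1.mul_right)
    ((hφ.1.continuous.mul hFw.continuous).integrable_of_hasCompactSupport hφ.2.1.mul_right)
    (fun x _ => hφ.1.differentiable (by simp) x) (fun x _ => hFw.differentiable (by simp) x)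
  simp_rw [hder] at h
  rw [h, neg_neg]

/-- Chain rule for the weak derivative of a bounded function. -/
theorem HasWeakLineDeriv.comp [FiniteDimensional ℝ E] {U : Set X} (hU : IsOpen U) {v : X}
    {u Du : X → E} (h : HasWeakLineDeriv U v u Du) (hu : LocallyIntegrable u volume)
    (huM : ∀ᵐ x, ‖u x‖ ≤ M) (hDu : MemLp Du 2 volume) (hF : ContDiff ℝ 1 F) :
    HasWeakLineDeriv U v (fun x => F (u x)) (fun x => fderiv ℝ F (u x) (Du x)) := by
  intro φ hφ
  simp only [smul_eq_mul]
  have h1 := tendsto_integral_mul_comp_mollify hu huM hF.continuous (hφ.continuous_fderiv_apply v)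
    (hφ.hasCompactSupport_fderiv_apply v)
  have h2 := (tendsto_integral_clm_mollify hu huM hDu (hF.continuous_fderiv (by simp))
    hφ.memLp).neg
  refine tendsto_nhds_unique h1 (h2.congr' ?_)
  filter_upwards [hφ.eventually_closedBall_subset hU] with k hk
  rw [integral_fderiv_mul_comp_eq hφ (contDiff_mollify hu k) hF v]
  congr 1
  refine integral_congr_ae (Eventually.of_forall fun x => ?_)
  by_cases hx : x ∈ tsupport φ
  · simp only [h.fderiv_mollify hu (hk x hx)]
  · simp [image_eq_zero_of_notMem_tsupport hx]

/-- Chain rule for a weak balance law `∂_τ u = ∑ ∂_{d i} (g i)`. -/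
theorem integral_fderiv_mul_comp_of_balance [FiniteDimensional ℝ E] {ι : Type*} [Fintype ι]
    {U : Set X} (hU : IsOpen U) {τ : X} {d : ι → X} {u : X → E} {Du g : ι → X → E}
    (hDu : ∀ i, HasWeakLineDeriv U (d i) u (Du i))
    (h : ∀ φ : X → ℝ, IsTestOn U φ →
      ∫ x, fderiv ℝ φ x τ • u x = ∑ i, ∫ x, fderiv ℝ φ x (d i) • g i x)
    (hu : LocallyIntegrable u volume) (huM : ∀ᵐ x, ‖u x‖ ≤ M) (hDum : ∀ i, MemLp (Du i) 2 volume)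
    (hg : ∀ i, MemLp (g i) 2 volume) (hF : ContDiff ℝ 2 F) {φ : X → ℝ} (hφ : IsTestOn U φ) :
    ∫ x, fderiv ℝ φ x τ * F (u x) =
      ∑ i, ((∫ x, fderiv ℝ φ x (d i) * fderiv ℝ F (u x) (g i x)) +
        ∫ x, φ x * fderiv ℝ (fderiv ℝ F) (u x) (Du i x) (g i x)) := by
  have hF1 : ContDiff ℝ 1 F := hF.of_le (by norm_num)
  have hF' : ContDiff ℝ 1 (fderiv ℝ F) := hF.fderiv_right (by norm_num)
  have hgl : ∀ i, LocallyIntegrable (g i) volume := fun i => (hg i).locallyIntegrable one_le_two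
  have h1 := tendsto_integral_mul_comp_mollify hu huM hF.continuous (hφ.continuous_fderiv_apply τ)
    (hφ.hasCompactSupport_fderiv_apply τ)
  -- The limit is taken in a form where no derivative falls on g. There the only derivatives are
  -- those of φ and the directional derivatives of u, and the latter mollify to L²-convergent
  -- sequences.
  have h2 := tendsto_finsetSum (Finset.univ : Finset ι) fun i _ =>
    (tendsto_integral_clm_mollify hu huM (hg i) (hF1.continuous_fderiv (by simp))
      (hφ.memLp_fderiv_apply (d i))).add
    (tendsto_integral_bilin_mollify hu huM (hDum i) (hg i) (hF'.continuous_fderiv (by simp))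
      hφ.1.continuous hφ.2.1)
  refine tendsto_nhds_unique h1 (h2.congr' ?_)
  filter_upwards [hφ.eventually_closedBall_subset hU] with k hk
  have hwk := contDiff_mollify hu k
  have hgk := fun i => contDiff_mollify (hgl i) k
  rw [integral_fderiv_mul_comp_eq hφ hwk hF1 τ]
  have hcF' : Continuous fun x => fderiv ℝ F (mollify k u x) :=
    (hF1.continuous_fderiv (by simp)).comp hwk.continuous
  have hcg : ∀ i, Continuous fun x => fderiv ℝ (mollify k (g i)) x (d i) := fun i =>
    ((hgk i).continuous_fderiv (by simp)).clm_apply continuous_const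
  have hint : ∀ i, Integrable
      (fun x => φ x * fderiv ℝ F (mollify k u x) (fderiv ℝ (mollify k (g i)) x (d i))) volume :=
    fun i => (hφ.1.continuous.mul (hcF'.clm_apply (hcg i))).integrable_of_hasCompactSupport
      hφ.2.1.mul_right
  have hsum : ∫ x, φ x * fderiv ℝ F (mollify k u x) (fderiv ℝ (mollify k u) x τ) =
      ∑ i, ∫ x, φ x * fderiv ℝ F (mollify k u x) (fderiv ℝ (mollify k (g i)) x (d i)) := by
    rw [← integral_finsetSum _ fun i _ => hint i]
    refine integral_congr_ae (Eventually.of_forall fun x => ?_)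
    by_cases hx : x ∈ tsupport φ
    · simp only [fderiv_mollify_eq_sum hu hgl h (hk x hx), map_sum, Finset.mul_sum]
    · simp [image_eq_zero_of_notMem_tsupport hx]
  rw [hsum, ← Finset.sum_neg_distrib]
  refine Finset.sum_congr rfl fun i _ => ?_
  -- Integration by parts moves the derivative from the mollified g onto the covector field φ
  -- DF(u_k). Its product rule yields the two terms of the claim: ∂φ DF(u_k), and φ D²F(u_k) applied
  -- to ∂u_k.
  let Φ : X → E →L[ℝ] ℝ := fun x => φ x • fderiv ℝ F (mollify k u x)
  have hΦ : ∀ x, HasFDerivAt Φ (φ x • ((fderiv ℝ (fderiv ℝ F) (mollify k u x)).comp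
      (fderiv ℝ (mollify k u) x)) + (fderiv ℝ φ x).smulRight (fderiv ℝ F (mollify k u x))) x := by
    intro x
    exact (hφ.1.differentiable (by simp) x).hasFDerivAt.smul
      ((hF'.differentiable (by simp) _).hasFDerivAt.comp x
        (hwk.differentiable (by simp) x).hasFDerivAt)
  have hcF'' : Continuous fun x => fderiv ℝ (fderiv ℝ F) (mollify k u x)
      (fderiv ℝ (mollify k u) x (d i)) (mollify k (g i) x) :=
    ((((hF'.continuous_fderiv (by simp)).comp hwk.continuous)).clm_apply
      ((hwk.continuous_fderiv (by simp)).clm_apply continuous_const)).clm_apply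
      (hgk i).continuous
  have i1 : Integrable (fun x => φ x * fderiv ℝ (fderiv ℝ F) (mollify k u x)
      (fderiv ℝ (mollify k u) x (d i)) (mollify k (g i) x)) volume :=
    (hφ.1.continuous.mul hcF'').integrable_of_hasCompactSupport hφ.2.1.mul_right
  have i2 : Integrable (fun x => fderiv ℝ φ x (d i) *
      fderiv ℝ F (mollify k u x) (mollify k (g i) x)) volume :=
    ((hφ.continuous_fderiv_apply (d i)).mul
      (hcF'.clm_apply (hgk i).continuous)).integrable_of_hasCompactSupport
      (hφ.hasCompactSupport_fderiv_apply (d i)).mul_right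
  have i3 : Integrable (fun x => φ x * fderiv ℝ F (mollify k u x) (mollify k (g i) x)) volume :=
    (hφ.1.continuous.mul
      (hcF'.clm_apply (hgk i).continuous)).integrable_of_hasCompactSupport hφ.2.1.mul_right
  have hibp := integral_bilinear_hasFDerivAt_right_eq_neg_left_of_integrable
    (μ := (volume : Measure X)) (f := Φ) (g := mollify k (g i)) (v := d i)
    (g' := fun x => fderiv ℝ (mollify k (g i)) x)
    (B := ContinuousLinearMap.id ℝ (E →L[ℝ] ℝ)) (by simpa [Pi.add_def] using i1.add i2)
    (by simpa [Φ] using hint i) (by simpa [Φ] using i3) (fun x _ => hΦ x)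
    (fun x _ => ((hgk i).differentiable (by simp) x).hasFDerivAt)
  simp only [ContinuousLinearMap.id_apply, Φ, _root_.add_apply, _root_.smul_apply,
    ContinuousLinearMap.comp_apply, ContinuousLinearMap.smulRight_apply, smul_eq_mul] at hibp
  rw [hibp, neg_neg, integral_add i1 i2, add_comm]
  congr 1
  refine integral_congr_ae (Eventually.of_forall fun x => ?_)
  by_cases hx : x ∈ tsupport φ
  · simp only [(hDu i).fderiv_mollify hu (hk x hx)]
  · simp [image_eq_zero_of_notMem_tsupport hx]

end ChainRule

/-! ### The space V: square integrability and weak gradients in the cylinder. -/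

section SpaceTimeLemmas

variable {n : ℕ} {Ω : Set (EuclideanSpace ℝ (Fin n))} {T : ℝ}
  {E : Type*} [NormedAddCommGroup E] [NormedSpace ℝ E]

instance isAddHaarMeasure_volume_spaceTime (n : ℕ) :
    (volume : Measure (SpaceTime n)).IsAddHaarMeasure :=
  inferInstanceAs ((volume : Measure (EuclideanSpace ℝ (Fin n))).prod
    (volume : Measure ℝ)).IsAddHaarMeasure

theorem isOpen_cylinder (hΩ : IsOpen Ω) : IsOpen (cylinder Ω T) := hΩ.prod isOpen_Ioo

theorem cylMeasure_eq_prod (Ω : Set (EuclideanSpace ℝ (Fin n))) (T : ℝ) :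
    cylMeasure Ω T = ((volume : Measure (EuclideanSpace ℝ (Fin n))).restrict Ω).prod
      ((volume : Measure ℝ).restrict (Ioo 0 T)) := by
  rw [Measure.prod_restrict]
  rfl

theorem integral_cylMeasure_eq_of_forall_notMem {f g : SpaceTime n → E} (hΩ : IsOpen Ω)
    (hfg : ∀ p ∈ cylinder Ω T, f p = g p) (hg : ∀ p ∉ cylinder Ω T, g p = 0) :
    ∫ p, f p ∂(cylMeasure Ω T) = ∫ p, g p := by
  rw [← setIntegral_eq_integral_of_forall_compl_eq_zero hg]
  exact setIntegral_congr_fun (isOpen_cylinder hΩ).measurableSet hfg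

/-- Integration by parts for `L²` limits of functions that are `C¹` in `U`. -/
theorem hasWeakLineDeriv_of_tendsto {X : Type*} [NormedAddCommGroup X] [NormedSpace ℝ X]
    [FiniteDimensional ℝ X] [MeasureSpace X] [BorelSpace X] [(volume : Measure X).IsAddHaarMeasure]
    {U : Set X} (hU : IsOpen U) {v : X} {u Du : X → E} {f : ℕ → X → E}
    (hf : ∀ k, ContDiffOn ℝ 1 (f k) U)
    (hfm : ∀ k, MemLp (f k) 2 (volume.restrict U)) (hu : MemLp u 2 (volume.restrict U))
    (hfu : Tendsto (fun k => eLpNorm (f k - u) 2 (volume.restrict U)) atTop (𝓝 0))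
    (hdm : ∀ k, MemLp (fun x => fderiv ℝ (f k) x v) 2 (volume.restrict U))
    (hDu : MemLp Du 2 (volume.restrict U))
    (hdu : Tendsto (fun k => eLpNorm ((fun x => fderiv ℝ (f k) x v) - Du) 2 (volume.restrict U))
      atTop (𝓝 0)) :
    HasWeakLineDeriv U v (U.indicator u) (U.indicator Du) := by
  intro φ hφ
  have hφ0 : ∀ x ∉ U, φ x = 0 := fun x hx =>
    image_eq_zero_of_notMem_tsupport fun h => hx (hφ.2.2 h)
  have hφ0' : ∀ x ∉ U, fderiv ℝ φ x v = 0 := fun x hx => by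
    rw [image_eq_zero_of_notMem_tsupport (f := fderiv ℝ φ) fun h =>
      hx (hφ.2.2 (tsupport_fderiv_subset ℝ h))]
    simp
  have key : ∀ {ψ : X → ℝ} {g : X → E}, (∀ x ∉ U, ψ x = 0) →
      ∫ x, ψ x • U.indicator g x = ∫ x in U, ψ x • g x := by
    intro ψ g hψ
    rw [← setIntegral_eq_integral_of_forall_compl_eq_zero (s := U)
      (fun x hx => by rw [hψ x hx, zero_smul])]
    exact setIntegral_congr_fun hU.measurableSet fun x hx => by simp [hx]
  rw [key hφ0', key hφ0]
  have hlim : ∀ {ψ : X → ℝ} {g : ℕ → X → E} {g₀ : X → E}, MemLp ψ 2 volume →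
      (∀ k, MemLp (g k) 2 (volume.restrict U)) → MemLp g₀ 2 (volume.restrict U) →
      Tendsto (fun k => eLpNorm (g k - g₀) 2 (volume.restrict U)) atTop (𝓝 0) →
      Tendsto (fun k => ∫ x in U, ψ x • g k x) atTop (𝓝 (∫ x in U, ψ x • g₀ x)) := by
    intro ψ g g₀ hψ hg hg₀ h
    have hψ' : MemLp ψ 2 (volume.restrict U) := hψ.restrict U
    have := tendsto_integral_bilin_apply (μ := volume.restrict U)
      (b := fun _ _ => ContinuousLinearMap.lsmul ℝ ℝ (E := E))
      (b₀ := fun _ => ContinuousLinearMap.lsmul ℝ ℝ) (f := fun _ => ψ) (f₀ := ψ) (g := g)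
      (g₀ := g₀) (C := ‖(ContinuousLinearMap.lsmul ℝ ℝ : ℝ →L[ℝ] E →L[ℝ] E)‖)
      (fun _ => aestronglyMeasurable_const) (fun _ => by simp) (by simp) (fun _ => hψ') hψ'
      (by simp) hg hg₀ h
    simpa using this
  have h1 := hlim (hφ.memLp_fderiv_apply v) hfm hu hfu
  have h2 := (hlim hφ.memLp hdm hDu hdu).neg
  refine tendsto_nhds_unique h1 (h2.congr fun k => ?_)
  -- Nothing is known about f k outside U or near its boundary. The compact support of φ inside U
  -- makes all products integrable on the whole space.
  have hsup : ∀ {ψ : X → ℝ} {g : X → E}, Continuous ψ → tsupport ψ ⊆ tsupport φ →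
      ContinuousOn g U → Integrable (fun x => ψ x • g x) volume := by
    intro ψ g hψ hψφ hg
    rw [← integrableOn_iff_integrable_of_support_subset (s := tsupport φ)]
    · exact (hψ.continuousOn.smul (hg.mono hφ.2.2)).integrableOn_compact hφ.2.1
    · intro x hx
      refine hψφ (subset_tsupport _ fun h0 => hx ?_)
      simp [h0]
  have hsub : tsupport (fun x => fderiv ℝ φ x v) ⊆ tsupport φ := by
    refine (closure_mono ?_).trans (tsupport_fderiv_subset ℝ (f := φ))
    exact fun x hx h0 => hx (by simp [h0])
  have hd : ∀ x ∈ tsupport φ, DifferentiableAt ℝ (f k) x := fun x hx =>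
    ((hf k).differentiableOn (by simp)).differentiableAt (hU.mem_nhds (hφ.2.2 hx))
  have hcd : ContinuousOn (fun x => fderiv ℝ (f k) x v) U :=
    ((hf k).continuousOn_fderiv_of_isOpen hU le_rfl).clm_apply continuousOn_const
  have := integral_smul_fderiv_eq_neg_fderiv_smul_of_integrable (μ := (volume : Measure X))
    (f := φ) (g := f k) (v := v)
    (hsup (hφ.continuous_fderiv_apply v) hsub (hf k).continuousOn)
    (hsup hφ.1.continuous subset_rfl hcd)
    (hsup hφ.1.continuous subset_rfl (hf k).continuousOn)
    (fun x _ => hφ.1.differentiable (by simp) x) hd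
  rw [setIntegral_eq_integral_of_forall_compl_eq_zero (fun x hx => by rw [hφ0 x hx, zero_smul]),
    setIntegral_eq_integral_of_forall_compl_eq_zero (fun x hx => by rw [hφ0' x hx, zero_smul]),
    this, neg_neg]

theorem ContDiffOn.aestronglyMeasurable_cylMeasure {f : SpaceTime n → E} (hΩ : IsOpen Ω)
    (hf : ContDiffOn ℝ 1 f (cylinder Ω T)) : AEStronglyMeasurable f (cylMeasure Ω T) :=
  hf.continuousOn.aestronglyMeasurable (isOpen_cylinder hΩ).measurableSet

theorem ContDiffOn.aestronglyMeasurable_fderiv_apply_cylMeasure {f : SpaceTime n → E}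
    (hΩ : IsOpen Ω) (hf : ContDiffOn ℝ 1 f (cylinder Ω T)) (v : SpaceTime n) :
    AEStronglyMeasurable (fun p => fderiv ℝ f p v) (cylMeasure Ω T) :=
  ((hf.continuousOn_fderiv_of_isOpen (isOpen_cylinder hΩ) le_rfl).clm_apply
    continuousOn_const).aestronglyMeasurable (isOpen_cylinder hΩ).measurableSet

/-- Tonelli with time as the outer variable; the bounded time interval contributes the factor T, so
the norm of V controls that of L²(Ω_T). -/
theorem lintegral_cylMeasure_le_essSup {f : SpaceTime n → E}
    (hf : AEStronglyMeasurable f (cylMeasure Ω T)) :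
    ∫⁻ p, ‖f p‖ₑ ^ 2 ∂(cylMeasure Ω T) ≤
      essSup (fun t : ℝ => ∫⁻ x in Ω, ‖f (x, t)‖ₑ ^ 2) ((volume : Measure ℝ).restrict (Ioo 0 T))
        * ENNReal.ofReal T := by
  rw [cylMeasure_eq_prod] at hf ⊢
  rw [lintegral_prod_symm _ (hf.enorm.pow_const 2)]
  refine (lintegral_mono_ae (ENNReal.ae_le_essSup _)).trans (le_of_eq ?_)
  rw [lintegral_const, Measure.restrict_apply_univ, Real.volume_Ioo, sub_zero]

theorem eLpNorm_sq_le_vNormSq {v : SpaceTime n → E} {Dv : Fin n → SpaceTime n → E}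
    (hv : AEStronglyMeasurable v (cylMeasure Ω T)) :
    eLpNorm v 2 (cylMeasure Ω T) ^ 2 ≤ vNormSq Ω T v Dv * ENNReal.ofReal T := by
  rw [eLpNorm_two_sq]
  refine (lintegral_cylMeasure_le_essSup hv).trans ?_
  gcongr
  exact le_self_add

theorem eLpNorm_grad_sq_le_vNormSq {v : SpaceTime n → E} {Dv : Fin n → SpaceTime n → E}
    (α : Fin n) : eLpNorm (Dv α) 2 (cylMeasure Ω T) ^ 2 ≤ vNormSq Ω T v Dv := by
  rw [eLpNorm_two_sq]
  refine le_trans ?_ (le_add_self : _ ≤ vNormSq Ω T v Dv)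
  refine lintegral_mono fun p => ?_
  exact Finset.single_le_sum (f := fun α => ‖Dv α p‖ₑ ^ 2) (fun _ _ => zero_le)
    (Finset.mem_univ α)

theorem eLpNorm_lt_top_of_sq {α : Type*} [MeasurableSpace α] {μ : Measure α} {f : α → E}
    {c : ℝ≥0∞} (hc : c < ⊤) (h : eLpNorm f 2 μ ^ 2 ≤ c) : eLpNorm f 2 μ < ⊤ := by
  by_contra h0
  rw [not_lt, top_le_iff] at h0
  simp [h0] at h
  exact hc.ne h

theorem tendsto_eLpNorm_of_sq_le {α : Type*} [MeasurableSpace α] {μ : Measure α} {f : ℕ → α → E}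
    {c : ℕ → ℝ≥0∞} (hc : Tendsto c atTop (𝓝 0)) (h : ∀ k, eLpNorm (f k) 2 μ ^ 2 ≤ c k) :
    Tendsto (fun k => eLpNorm (f k) 2 μ) atTop (𝓝 0) := by
  rw [tendsto_eLpNorm_two_iff]
  simp_rw [← eLpNorm_two_sq]
  exact tendsto_of_tendsto_of_tendsto_of_le_of_le tendsto_const_nhds hc (fun _ => zero_le) h

theorem memLp_of_tendsto_eLpNorm {α : Type*} [MeasurableSpace α] {μ : Measure α} {f : ℕ → α → E}
    {g : α → E} (hf : ∀ k, MemLp (f k) 2 μ) (hg : AEStronglyMeasurable g μ)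
    (h : Tendsto (fun k => eLpNorm (f k - g) 2 μ) atTop (𝓝 0)) : MemLp g 2 μ := by
  obtain ⟨k, hk⟩ := (h.eventually_lt_const (u := 1) one_pos).exists
  have h1 : MemLp (f k - g) 2 μ := ⟨(hf k).1.sub hg, hk.trans ENNReal.one_lt_top⟩
  simpa using (hf k).sub h1

/-- The approximating sequence of an element of `V` in terms of `L²(Ω_T)`. -/
theorem MemV.exists_approx (hΩ : IsOpen Ω) {u : SpaceTime n → E} {Du : Fin n → SpaceTime n → E}
    (hu : MemV Ω T u Du) : ∃ f : ℕ → SpaceTime n → E,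
      (∀ k, ContDiffOn ℝ 1 (f k) (cylinder Ω T)) ∧
      (∀ k, MemLp (f k) 2 (cylMeasure Ω T)) ∧
      (∀ k α, MemLp (spaceDeriv α (f k)) 2 (cylMeasure Ω T)) ∧
      Tendsto (fun k => vNormSq Ω T (fun p => f k p - u p)
        (fun α p => spaceDeriv α (f k) p - Du α p)) atTop (𝓝 0) ∧
      Tendsto (fun k => eLpNorm (f k - u) 2 (cylMeasure Ω T)) atTop (𝓝 0) ∧
      ∀ α, Tendsto (fun k => eLpNorm (spaceDeriv α (f k) - Du α) 2 (cylMeasure Ω T))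
        atTop (𝓝 0) := by
  obtain ⟨hum, hDum, f, hf, hlim⟩ := hu
  refine ⟨f, fun k => (hf k).1, fun k => ?_, fun k α => ?_, hlim, ?_, fun α => ?_⟩
  · have hm := (hf k).1.aestronglyMeasurable_cylMeasure hΩ
    exact ⟨hm, eLpNorm_lt_top_of_sq (ENNReal.mul_lt_top (hf k).2 ENNReal.ofReal_lt_top)
      (eLpNorm_sq_le_vNormSq hm)⟩
  · exact ⟨(hf k).1.aestronglyMeasurable_fderiv_apply_cylMeasure hΩ _,
      eLpNorm_lt_top_of_sq (hf k).2
        (eLpNorm_grad_sq_le_vNormSq (v := f k) (Dv := fun α => spaceDeriv α (f k)) α)⟩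
  · have hb : ∀ k, eLpNorm (f k - u) 2 (cylMeasure Ω T) ^ 2 ≤ vNormSq Ω T (fun p => f k p - u p)
        (fun α p => spaceDeriv α (f k) p - Du α p) * ENNReal.ofReal T := fun k =>
      eLpNorm_sq_le_vNormSq (v := f k - u)
        (((hf k).1.aestronglyMeasurable_cylMeasure hΩ).sub hum)
    refine tendsto_eLpNorm_of_sq_le ?_ hb
    exact (ENNReal.Tendsto.mul_const hlim (Or.inr (ENNReal.ofReal_ne_top (r := T)))).trans
      (by rw [zero_mul])
  · have hb : ∀ k, eLpNorm (spaceDeriv α (f k) - Du α) 2 (cylMeasure Ω T) ^ 2 ≤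
        vNormSq Ω T (fun p => f k p - u p) (fun α p => spaceDeriv α (f k) p - Du α p) := fun k =>
      eLpNorm_grad_sq_le_vNormSq (v := fun p => f k p - u p)
        (Dv := fun α p => spaceDeriv α (f k) p - Du α p) α
    exact tendsto_eLpNorm_of_sq_le hlim hb

theorem MemV.memLp (hΩ : IsOpen Ω) {u : SpaceTime n → E} {Du : Fin n → SpaceTime n → E}
    (hu : MemV Ω T u Du) : MemLp u 2 (cylMeasure Ω T) := by
  obtain ⟨f, -, h1, -, -, h2, -⟩ := hu.exists_approx hΩ
  exact memLp_of_tendsto_eLpNorm h1 hu.1 h2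

theorem MemV.memLp_grad (hΩ : IsOpen Ω) {u : SpaceTime n → E} {Du : Fin n → SpaceTime n → E}
    (hu : MemV Ω T u Du) (α : Fin n) : MemLp (Du α) 2 (cylMeasure Ω T) := by
  obtain ⟨f, -, -, h1, -, -, h2⟩ := hu.exists_approx hΩ
  exact memLp_of_tendsto_eLpNorm (fun k => h1 k α) (hu.2.1 α) (h2 α)

/-- Extension by zero is harmless because test functions live inside the cylinder. It allows the
mollification results on the whole space to be used. -/
theorem MemV.hasWeakLineDeriv (hΩ : IsOpen Ω) {u : SpaceTime n → E}
    {Du : Fin n → SpaceTime n → E} (hu : MemV Ω T u Du) (α : Fin n) :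
    HasWeakLineDeriv (cylinder Ω T) (EuclideanSpace.single α 1, 0) ((cylinder Ω T).indicator u)
      ((cylinder Ω T).indicator (Du α)) := by
  obtain ⟨f, h0, h1, h2, -, h3, h4⟩ := hu.exists_approx hΩ
  exact hasWeakLineDeriv_of_tendsto (isOpen_cylinder hΩ) h0 h1 (hu.memLp hΩ) h3
    (fun k => h2 k α) (hu.memLp_grad hΩ α) (h4 α)

end SpaceTimeLemmas

/-! ### The weak system in flux form and its composition with a C² function. -/

section EntropyIdentity

variable {n N : ℕ} {Ω : Set (EuclideanSpace ℝ (Fin n))} {T : ℝ}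
  {a : Fin n → Fin n → SpaceTime n → EuclideanSpace ℝ (Fin N) → ℝ}
  {c : Fin N → Fin n → Fin n → SpaceTime n → EuclideanSpace ℝ (Fin N) → ℝ}
  {H : EuclideanSpace ℝ (Fin N) → ℝ}
  {u : SpaceTime n → EuclideanSpace ℝ (Fin N)}
  {Du : Fin n → SpaceTime n → EuclideanSpace ℝ (Fin N)}

/-- The vector `(c^i_{αβ})_i` along `u`. -/
noncomputable def couplingVec
    (c : Fin N → Fin n → Fin n → SpaceTime n → EuclideanSpace ℝ (Fin N) → ℝ)
    (u : SpaceTime n → EuclideanSpace ℝ (Fin N)) (α β : Fin n) (p : SpaceTime n) :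
    EuclideanSpace ℝ (Fin N) :=
  WithLp.toLp 2 fun i => c i α β p (u p)

/-- The flux `(a_{αβ} u^i_{x_β} + c^i_{αβ} H(u)_{x_β})_i` in direction `x_α`. -/
noncomputable def fluxVec (a : Fin n → Fin n → SpaceTime n → EuclideanSpace ℝ (Fin N) → ℝ)
    (c : Fin N → Fin n → Fin n → SpaceTime n → EuclideanSpace ℝ (Fin N) → ℝ)
    (H : EuclideanSpace ℝ (Fin N) → ℝ) (u : SpaceTime n → EuclideanSpace ℝ (Fin N))
    (Du : Fin n → SpaceTime n → EuclideanSpace ℝ (Fin N)) (α : Fin n) (p : SpaceTime n) :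
    EuclideanSpace ℝ (Fin N) :=
  ∑ β, (a α β p (u p) • Du β p + fderiv ℝ H (u p) (Du β p) • couplingVec c u α β p)

theorem sum_smul_single (x : EuclideanSpace ℝ (Fin N)) :
    ∑ i, x i • EuclideanSpace.single i (1 : ℝ) = x := by
  ext j
  simp [Finset.sum_apply, Pi.single_apply]

theorem fderiv_eq_sum_partialH (z x : EuclideanSpace ℝ (Fin N)) :
    fderiv ℝ H z x = ∑ j, partialH H j z * x j := by
  conv_lhs => rw [← sum_smul_single x]
  simp [partialH, mul_comm]

theorem fluxVec_apply (α : Fin n) (p : SpaceTime n) (i : Fin N) :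
    fluxVec a c H u Du α p i = ∑ β, (a α β p (u p) * Du β p i
      + c i α β p (u p) * ∑ j, partialH H j (u p) * Du β p j) := by
  simp [fluxVec, couplingVec, ← fderiv_eq_sum_partialH, mul_comm]

theorem norm_couplingVec_le {K : ℝ} {α β : Fin n} {p : SpaceTime n}
    (h : ∀ i, |c i α β p (u p)| ≤ K) : ‖couplingVec c u α β p‖ ≤ N * K := by
  rw [← sum_smul_single (couplingVec c u α β p)]
  refine (norm_sum_le _ _).trans ?_
  refine (Finset.sum_le_sum fun i _ => ?_).trans (b := ∑ _ : Fin N, K) (by simp)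
  simpa [norm_smul, couplingVec] using h i

theorem aestronglyMeasurable_couplingVec
    (hc : ∀ i α β, AEStronglyMeasurable (fun p => c i α β p (u p)) (cylMeasure Ω T))
    (α β : Fin n) : AEStronglyMeasurable (couplingVec c u α β) (cylMeasure Ω T) :=
  (PiLp.continuous_toLp 2 _).comp_aestronglyMeasurable
    (aemeasurable_pi_lambda _ fun i => (hc i α β).aemeasurable).aestronglyMeasurable

theorem memLp_fderiv_comp_apply {F : EuclideanSpace ℝ (Fin N) → ℝ} (hF : ContDiff ℝ 1 F) {M : ℝ}
    (hu : AEStronglyMeasurable u (cylMeasure Ω T)) (huM : ∀ᵐ p ∂(cylMeasure Ω T), ‖u p‖ ≤ M)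
    {w : SpaceTime n → EuclideanSpace ℝ (Fin N)} (hw : MemLp w 2 (cylMeasure Ω T)) :
    MemLp (fun p => fderiv ℝ F (u p) (w p)) 2 (cylMeasure Ω T) := by
  obtain ⟨C, hC⟩ := exists_bound_on_closedBall (hF.continuous_fderiv (by simp)) M
  have hm : Continuous fun q : EuclideanSpace ℝ (Fin N) × EuclideanSpace ℝ (Fin N) =>
      fderiv ℝ F q.1 q.2 :=
    ((hF.continuous_fderiv (by simp)).comp continuous_fst).clm_apply continuous_snd
  refine hw.of_le_mul (c := C) (hm.comp_aestronglyMeasurable (hu.prodMk hw.1)) ?_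
  filter_upwards [huM] with p hp
  exact ((fderiv ℝ F (u p)).le_opNorm _).trans
    (mul_le_mul_of_nonneg_right (hC _ hp) (norm_nonneg _))

theorem memLp_fluxVec (hH : ContDiff ℝ 1 H)
    (ha : ∀ α β, AEStronglyMeasurable (fun p => a α β p (u p)) (cylMeasure Ω T))
    (hc : ∀ i α β, AEStronglyMeasurable (fun p => c i α β p (u p)) (cylMeasure Ω T))
    {K M : ℝ} (hbdd : ∀ᵐ p ∂(cylMeasure Ω T),
      (∀ α β, |a α β p (u p)| ≤ K) ∧ (∀ i α β, |c i α β p (u p)| ≤ K))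
    (hu : AEStronglyMeasurable u (cylMeasure Ω T)) (huM : ∀ᵐ p ∂(cylMeasure Ω T), ‖u p‖ ≤ M)
    (hDu : ∀ α, MemLp (Du α) 2 (cylMeasure Ω T)) (α : Fin n) :
    MemLp (fluxVec a c H u Du α) 2 (cylMeasure Ω T) := by
  refine memLp_finsetSum _ fun β _ => MemLp.add ?_ ?_
  · refine (hDu β).of_le_mul (c := K) ((ha α β).smul (hDu β).1) ?_
    filter_upwards [hbdd] with p hp
    rw [norm_smul]
    exact mul_le_mul_of_nonneg_right (hp.1 α β) (norm_nonneg _)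
  · have h1 := memLp_fderiv_comp_apply hH hu huM (hDu β)
    refine h1.of_le_mul (c := N * |K|)
      (h1.1.smul (aestronglyMeasurable_couplingVec hc α β)) ?_
    filter_upwards [hbdd] with p hp
    rw [norm_smul, mul_comm]
    exact mul_le_mul_of_nonneg_right (norm_couplingVec_le
      fun i => (hp.2 i α β).trans (le_abs_self K)) (norm_nonneg _)

theorem IsTestFunction.memH10 {E : Type*} [NormedAddCommGroup E] [NormedSpace ℝ E]
    {φ : SpaceTime n → E} (hφ : IsTestFunction Ω T φ) :
    MemH10 Ω T φ (timeDeriv φ) (fun α => spaceDeriv α φ) := by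
  have hd : ∀ v : SpaceTime n, AEStronglyMeasurable (fun p => fderiv ℝ φ p v) (cylMeasure Ω T) :=
    fun v => ((hφ.1.continuous_fderiv (by simp)).clm_apply continuous_const).aestronglyMeasurable
  exact ⟨hφ.1.continuous.aestronglyMeasurable, hd _, fun α => hd _, fun _ => φ, fun _ => hφ,
    by simp⟩

theorem IsTestFunction.smul_const {E : Type*} [NormedAddCommGroup E] [NormedSpace ℝ E]
    {φ : SpaceTime n → ℝ} (hφ : IsTestFunction Ω T φ) (e : E) :
    IsTestFunction Ω T fun p => φ p • e :=
  ⟨hφ.1.smul contDiff_const, hφ.2.1.smul_right,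
    (closure_mono (Function.support_smul_subset_left φ fun _ => e)).trans hφ.2.2⟩

theorem fderiv_smul_const_apply {E : Type*} [NormedAddCommGroup E] [NormedSpace ℝ E]
    {φ : SpaceTime n → ℝ} (hφ : IsTestFunction Ω T φ) (e : E) (p v : SpaceTime n) :
    fderiv ℝ (fun p => φ p • e) p v = fderiv ℝ φ p v • e := by
  have := ((hφ.1.differentiable (by simp) p).hasFDerivAt.smul_const e).fderiv
  rw [this]
  rfl

theorem IsTestFunction.notMem_cylinder {φ : SpaceTime n → ℝ} (hφ : IsTestFunction Ω T φ)
    {p : SpaceTime n} (hp : p ∉ cylinder Ω T) : φ p = 0 ∧ fderiv ℝ φ p = 0 :=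
  ⟨image_eq_zero_of_notMem_tsupport fun h => hp (hφ.2.2 h),
    image_eq_zero_of_notMem_tsupport fun h => hp (hφ.2.2 (tsupport_fderiv_subset ℝ h))⟩

/-- The weak form of the system for scalar test functions. -/
theorem IsWeakSolution.balance (hΩ : IsOpen Ω) (hu : IsWeakSolution Ω T a c H u Du)
    (hflux : ∀ α, MemLp (fluxVec a c H u Du α) 2 (cylMeasure Ω T))
    {φ : SpaceTime n → ℝ} (hφ : IsTestFunction Ω T φ) :
    ∫ p, fderiv ℝ φ p (0, 1) • (cylinder Ω T).indicator u p =
      ∑ α, ∫ p, fderiv ℝ φ p (EuclideanSpace.single α 1, 0) •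
        (cylinder Ω T).indicator (fluxVec a c H u Du α) p := by
  have hu2 := hu.1.memLp hΩ
  have hind : ∀ (v : SpaceTime n) (w : SpaceTime n → EuclideanSpace ℝ (Fin N)),
      ∫ p, fderiv ℝ φ p v • (cylinder Ω T).indicator w p =
        ∫ p, fderiv ℝ φ p v • w p ∂(cylMeasure Ω T) := by
    intro v w
    refine (integral_cylMeasure_eq_of_forall_notMem hΩ (fun p hp => ?_) fun p hp => ?_).symm
    · simp [hp]
    · simp [hp]
  have hint : ∀ (v : SpaceTime n) {w : SpaceTime n → EuclideanSpace ℝ (Fin N)},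
      MemLp w 2 (cylMeasure Ω T) → Integrable (fun p => fderiv ℝ φ p v • w p) (cylMeasure Ω T) := by
    intro v w hw
    have h1 : MemLp (fun p => fderiv ℝ φ p v) 2 (cylMeasure Ω T) :=
      (IsTestOn.memLp_fderiv_apply (U := cylinder Ω T) hφ v).restrict _
    exact memLp_one_iff_integrable.1 (hw.smul h1)
  simp_rw [hind]
  ext i
  have hproj : ∀ {f : SpaceTime n → EuclideanSpace ℝ (Fin N)}, Integrable f (cylMeasure Ω T) →
      (∫ p, f p ∂(cylMeasure Ω T)) i = ∫ p, f p i ∂(cylMeasure Ω T) := fun hf =>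
    ((EuclideanSpace.proj (𝕜 := ℝ) i).integral_comp_comm hf).symm
  have hsum : (∑ α, ∫ p, fderiv ℝ φ p (EuclideanSpace.single α 1, 0) • fluxVec a c H u Du α p
      ∂(cylMeasure Ω T)) i = ∑ α, ∫ p, fderiv ℝ φ p (EuclideanSpace.single α 1, 0) *
        fluxVec a c H u Du α p i ∂(cylMeasure Ω T) := by
    rw [WithLp.ofLp_sum, Finset.sum_apply]
    exact Finset.sum_congr rfl fun α _ => (hproj (hint _ (hflux α))).trans (by simp)
  have hinti : ∀ (v : SpaceTime n) {w : SpaceTime n → EuclideanSpace ℝ (Fin N)},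
      MemLp w 2 (cylMeasure Ω T) →
      Integrable (fun p => fderiv ℝ φ p v * w p i) (cylMeasure Ω T) := fun v w hw => by
    simpa using (EuclideanSpace.proj (𝕜 := ℝ) i).integrable_comp (hint v hw)
  rw [hproj (hint _ hu2), hsum, ← integral_finsetSum _ fun α _ => hinti _ (hflux α)]
  -- The test function φ e_i isolates the i-th equation of the system.
  have h := hu.2 _ _ _ (hφ.smul_const (EuclideanSpace.single i (1 : ℝ))).memH10
  have hpt : ∀ p, (- (∑ j, u p j * timeDeriv (fun p => φ p • EuclideanSpace.single i (1 : ℝ)) p j)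
      + ∑ j, ∑ α, ∑ β, (a α β p (u p) * Du β p j
          + c j α β p (u p) * ∑ l, partialH H l (u p) * Du β p l) *
            spaceDeriv α (fun p => φ p • EuclideanSpace.single i (1 : ℝ)) p j) =
      - (fderiv ℝ φ p (0, 1) * u p i) + ∑ α, fderiv ℝ φ p (EuclideanSpace.single α 1, 0) *
        fluxVec a c H u Du α p i := by
    intro p
    simp only [timeDeriv, spaceDeriv, fderiv_smul_const_apply hφ, ← Finset.sum_mul, fluxVec_apply]
    congr 1
    · rw [neg_inj, Finset.sum_eq_single i] <;> simp +contextual [mul_comm]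
    · rw [Finset.sum_eq_single i] <;> simp +contextual [mul_comm]
  simp_rw [hpt] at h
  have h1 : Integrable (fun p => - (fderiv ℝ φ p (0, 1) * u p i)) (cylMeasure Ω T) :=
    (hinti _ hu2).neg
  rw [integral_add h1 (integrable_finsetSum _ fun α _ => hinti _ (hflux α)), integral_neg] at h
  simp only [PiLp.smul_apply, smul_eq_mul]
  linarith

theorem ae_norm_indicator_le {M : ℝ} (hΩ : IsOpen Ω) (huM : ∀ᵐ p ∂(cylMeasure Ω T), ‖u p‖ ≤ M) :
    -- The absolute value is needed: M may be negative when the cylinder is null, whereas the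
    -- extension by zero has norm 0.
    ∀ᵐ p, ‖(cylinder Ω T).indicator u p‖ ≤ |M| := by
  have h := (ae_restrict_iff' (isOpen_cylinder hΩ).measurableSet).1 huM
  filter_upwards [h] with p hp
  by_cases hp' : p ∈ cylinder Ω T
  · simpa [hp'] using (hp hp').trans (le_abs_self M)
  · simp [hp']

theorem memLp_indicator_cylinder {E : Type*} [NormedAddCommGroup E] (hΩ : IsOpen Ω)
    {w : SpaceTime n → E} (hw : MemLp w 2 (cylMeasure Ω T)) :
    MemLp ((cylinder Ω T).indicator w) 2 volume :=
  (memLp_indicator_iff_restrict (isOpen_cylinder hΩ).measurableSet).2 hw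

/-- The identity satisfied by a `C²` function of a bounded weak solution. -/
theorem IsWeakSolution.entropy_identity (hΩ : IsOpen Ω) (hu : IsWeakSolution Ω T a c H u Du)
    (hflux : ∀ α, MemLp (fluxVec a c H u Du α) 2 (cylMeasure Ω T)) {M : ℝ}
    (huM : ∀ᵐ p ∂(cylMeasure Ω T), ‖u p‖ ≤ M) {F : EuclideanSpace ℝ (Fin N) → ℝ}
    (hF : ContDiff ℝ 2 F) {φ : SpaceTime n → ℝ} (hφ : IsTestFunction Ω T φ) :
    ∫ p, timeDeriv φ p * F (u p) ∂(cylMeasure Ω T) =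
      ∑ α, ((∫ p, spaceDeriv α φ p * fderiv ℝ F (u p) (fluxVec a c H u Du α p)
          ∂(cylMeasure Ω T)) +
        ∫ p, φ p * fderiv ℝ (fderiv ℝ F) (u p) (Du α p) (fluxVec a c H u Du α p)
          ∂(cylMeasure Ω T)) := by
  have h := integral_fderiv_mul_comp_of_balance (isOpen_cylinder hΩ) (τ := (0, 1))
    (d := fun α : Fin n => ((EuclideanSpace.single α 1, 0) : SpaceTime n))
    (fun α => hu.1.hasWeakLineDeriv hΩ α) (fun φ hφ => hu.balance hΩ hflux hφ)
    ((memLp_indicator_cylinder hΩ (hu.1.memLp hΩ)).locallyIntegrable one_le_two)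
    (ae_norm_indicator_le hΩ huM)
    (fun α => memLp_indicator_cylinder hΩ (hu.1.memLp_grad hΩ α))
    (fun α => memLp_indicator_cylinder hΩ (hflux α)) hF hφ
  have hz := fun p hp => hφ.notMem_cylinder (p := p) hp
  rw [integral_cylMeasure_eq_of_forall_notMem hΩ (f := fun p => timeDeriv φ p * F (u p))
    (g := fun p => fderiv ℝ φ p (0, 1) * F ((cylinder Ω T).indicator u p))
    (fun p hp => by simp [hp, timeDeriv]) (fun p hp => by simp [(hz p hp).2]), h]
  refine Finset.sum_congr rfl fun α _ => ?_
  congr 1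
  · exact (integral_cylMeasure_eq_of_forall_notMem hΩ (fun p hp => by simp [hp, spaceDeriv])
      (fun p hp => by simp [(hz p hp).2])).symm
  · exact (integral_cylMeasure_eq_of_forall_notMem hΩ (fun p hp => by simp [hp])
      (fun p hp => by simp [(hz p hp).1])).symm

/-- The chain rule for `F(u)`, where `u ∈ V` is bounded. -/
theorem MemV.hasWeakSpatialGradient_comp (hΩ : IsOpen Ω) (hu : MemV Ω T u Du) {M : ℝ}
    (huM : ∀ᵐ p ∂(cylMeasure Ω T), ‖u p‖ ≤ M) {F : EuclideanSpace ℝ (Fin N) → ℝ}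
    (hF : ContDiff ℝ 1 F) :
    HasWeakSpatialGradient Ω T (fun p => F (u p)) (fun α p => fderiv ℝ F (u p) (Du α p)) := by
  have hloc : ∀ {w : SpaceTime n → ℝ}, (∀ K ⊆ cylinder Ω T, IsCompact K → IntegrableOn w K) →
      LocallyIntegrableOn w (cylinder Ω T) := fun hw =>
    (locallyIntegrableOn_iff (isOpen_cylinder hΩ).isLocallyClosed).2 hw
  refine ⟨hloc fun K hK hKc => ?_, fun α => hloc fun K hK hKc => ?_, fun α φ hφ => ?_⟩
  · obtain ⟨C, hC⟩ := exists_bound_on_closedBall hF.continuous M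
    have : IsFiniteMeasure ((volume : Measure (SpaceTime n)).restrict K) :=
      isFiniteMeasure_restrict.2 hKc.measure_lt_top.ne
    refine Integrable.of_bound ((hF.continuous.comp_aestronglyMeasurable hu.1).mono_measure
      (Measure.restrict_mono hK le_rfl)) C ?_
    filter_upwards [ae_mono (Measure.restrict_mono hK le_rfl) huM] with p hp
    exact hC _ hp
  · have : IsFiniteMeasure ((volume : Measure (SpaceTime n)).restrict K) :=
      isFiniteMeasure_restrict.2 hKc.measure_lt_top.ne
    exact ((memLp_fderiv_comp_apply hF hu.1 huM (hu.memLp_grad hΩ α)).mono_measure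
      (Measure.restrict_mono hK le_rfl)).integrable one_le_two
  · have h := (hu.hasWeakLineDeriv hΩ α).comp (isOpen_cylinder hΩ)
      ((memLp_indicator_cylinder hΩ (hu.memLp hΩ)).locallyIntegrable one_le_two)
      (ae_norm_indicator_le hΩ huM) (memLp_indicator_cylinder hΩ (hu.memLp_grad hΩ α)) hF φ hφ
    have hz := fun p hp => hφ.notMem_cylinder (p := p) hp
    simp only [smul_eq_mul] at h
    rw [integral_cylMeasure_eq_of_forall_notMem hΩ (f := fun p => F (u p) * spaceDeriv α φ p)
      (g := fun p => fderiv ℝ φ p (EuclideanSpace.single α 1, 0) *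
        F ((cylinder Ω T).indicator u p))
      (fun p hp => by simp [hp, spaceDeriv, mul_comm]) (fun p hp => by simp [(hz p hp).2]), h]
    congr 1
    exact (integral_cylMeasure_eq_of_forall_notMem hΩ (fun p hp => by simp [hp, mul_comm])
      (fun p hp => by simp [(hz p hp).1])).symm

end EntropyIdentity

/-! ### Pointwise algebra: ellipticity of A and coercivity of the dissipation. -/

section EntropyAlgebra

variable {n N : ℕ}

open scoped MatrixOrder Matrix.Norms.L2Operator in
/-- A bilinear form that is bounded below by `lam ⟪·, ·⟫` is `lam ⟪·, ·⟫` plus a sum of squares. -/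
theorem exists_sum_of_squares {Q : EuclideanSpace ℝ (Fin N) →L[ℝ] EuclideanSpace ℝ (Fin N) →L[ℝ] ℝ}
    (hsymm : ∀ x y, Q x y = Q y x) {lam : ℝ} (hpos : ∀ x, lam * ‖x‖ ^ 2 ≤ Q x x) :
    ∃ B : Fin N → EuclideanSpace ℝ (Fin N) → ℝ, ∀ x y,
      Q x y = lam * ∑ i, x i * y i + ∑ m, B m x * B m y := by
  let P : Matrix (Fin N) (Fin N) ℝ := Matrix.of fun i j =>
    Q (EuclideanSpace.single i 1) (EuclideanSpace.single j 1) - if i = j then lam else 0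
  have hQ : ∀ x y, Q x y = ∑ i, ∑ j, x i * y j *
      Q (EuclideanSpace.single i 1) (EuclideanSpace.single j 1) := by
    intro x y
    conv_lhs => rw [← sum_smul_single x, ← sum_smul_single y]
    simp only [map_sum, map_smul, _root_.sum_apply, _root_.smul_apply, smul_eq_mul,
      Finset.mul_sum]
    rw [Finset.sum_comm]
    exact Finset.sum_congr rfl fun i _ => Finset.sum_congr rfl fun j _ => by ring
  have hP : ∀ x y : EuclideanSpace ℝ (Fin N), ∑ i, ∑ j, x i * y j * P i j =
      Q x y - lam * ∑ i, x i * y i := by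
    intro x y
    simp only [P, Matrix.of_apply, mul_sub, Finset.sum_sub_distrib, ← hQ, mul_ite, mul_zero, Finset.sum_ite_eq,
      Finset.mem_univ, if_true, Finset.mul_sum]
    congr 1
    exact Finset.sum_congr rfl fun i _ => by ring
  have hPS : P.PosSemidef := by
    refine Matrix.PosSemidef.of_dotProduct_mulVec_nonneg ?_ fun x => ?_
    · ext i j
      simp only [P, Matrix.conjTranspose_apply, Matrix.of_apply, star_trivial, hsymm (EuclideanSpace.single j 1),
        eq_comm (a := j)]
    · have h := hP (WithLp.toLp 2 x) (WithLp.toLp 2 x)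
      have h2 := hpos (WithLp.toLp 2 x)
      rw [EuclideanSpace.real_norm_sq_eq] at h2
      have : star x ⬝ᵥ P.mulVec x = ∑ i, ∑ j, x i * x j * P i j := by
        simp only [dotProduct, Matrix.mulVec, Finset.mul_sum, Pi.star_apply, star_trivial]
        exact Finset.sum_congr rfl fun i _ => Finset.sum_congr rfl fun j _ => by ring
      rw [this]
      refine le_of_le_of_eq ?_ h.symm
      simp only [← sq]
      linarith
  -- P represents Q minus lam times the inner product and is positive semidefinite. A positive
  -- element of the matrix C*-algebra is B*B, and the rows of B are the required linear forms.
  obtain ⟨B, hB⟩ := CStarAlgebra.nonneg_iff_eq_star_mul_self.mp hPS.nonneg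
  refine ⟨fun m x => ∑ i, B m i * x i, fun x y => ?_⟩
  have h := hP x y
  have h2 : ∑ i, ∑ j, x i * y j * P i j = ∑ m, (∑ i, B m i * x i) * ∑ j, B m j * y j := by
    calc ∑ i, ∑ j, x i * y j * P i j
        = ∑ i, ∑ j, ∑ m, (B m i * x i) * (B m j * y j) := by
          refine Finset.sum_congr rfl fun i _ => Finset.sum_congr rfl fun j _ => ?_
          rw [hB, Matrix.star_eq_conjTranspose, Matrix.mul_apply, Finset.mul_sum]
          refine Finset.sum_congr rfl fun m _ => ?_
          rw [Matrix.conjTranspose_apply, star_trivial]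
          ring
      _ = ∑ m, ∑ i, ∑ j, (B m i * x i) * (B m j * y j) := by
          rw [Finset.sum_comm (s := (Finset.univ : Finset (Fin N)))
            (f := fun m i => ∑ j, (B m i * x i) * (B m j * y j))]
          exact Finset.sum_congr rfl fun i _ => Finset.sum_comm
      _ = _ := Finset.sum_congr rfl fun m _ => by rw [Finset.sum_mul_sum]
  linarith

/-- Decompose Q as lam times the inner product plus squares of linear forms B_m. Ellipticity of a,
applied to each coordinate of y, gives one factor lam and the decomposition gives the other; applied
to the scalars B_m(y_α), it shows that the rest is nonnegative. No symmetry of a enters. -/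
theorem sum_bilin_ge {Q : EuclideanSpace ℝ (Fin N) →L[ℝ] EuclideanSpace ℝ (Fin N) →L[ℝ] ℝ}
    (hsymm : ∀ x y, Q x y = Q y x) {lam : ℝ} (hlam : 0 < lam) (hpos : ∀ x, lam * ‖x‖ ^ 2 ≤ Q x x)
    {a : Fin n → Fin n → ℝ} (ha : ∀ ζ : Fin n → ℝ, lam * ∑ α, ζ α ^ 2 ≤
      ∑ α, ∑ β, a α β * ζ α * ζ β) (y : Fin n → EuclideanSpace ℝ (Fin N)) :
    lam * lam * ∑ α, ‖y α‖ ^ 2 ≤ ∑ α, ∑ β, a α β * Q (y α) (y β) := by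
  obtain ⟨B, hB⟩ := exists_sum_of_squares hsymm hpos
  have h1 : ∑ α, ∑ β, a α β * Q (y α) (y β) =
      lam * ∑ i, ∑ α, ∑ β, a α β * y α i * y β i +
        ∑ m, ∑ α, ∑ β, a α β * B m (y α) * B m (y β) := by
    have e1 : ∑ i, ∑ α, ∑ β, a α β * y α i * y β i = ∑ α, ∑ β, ∑ i, a α β * y α i * y β i := by
      rw [Finset.sum_comm]
      exact Finset.sum_congr rfl fun α _ => Finset.sum_comm
    have e2 : ∑ m, ∑ α, ∑ β, a α β * B m (y α) * B m (y β) =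
        ∑ α, ∑ β, ∑ m, a α β * B m (y α) * B m (y β) := by
      rw [Finset.sum_comm]
      exact Finset.sum_congr rfl fun α _ => Finset.sum_comm
    rw [e1, e2, Finset.mul_sum, ← Finset.sum_add_distrib]
    refine Finset.sum_congr rfl fun α _ => ?_
    rw [Finset.mul_sum, ← Finset.sum_add_distrib]
    refine Finset.sum_congr rfl fun β _ => ?_
    rw [hB, mul_add, Finset.mul_sum, Finset.mul_sum, Finset.mul_sum, Finset.mul_sum]
    congr 1 <;> exact Finset.sum_congr rfl fun i _ => by ring
  have h2 : ∑ i, lam * ∑ α, y α i ^ 2 ≤ ∑ i, ∑ α, ∑ β, a α β * y α i * y β i :=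
    Finset.sum_le_sum fun i _ => ha fun α => y α i
  have h3 : 0 ≤ ∑ m, ∑ α, ∑ β, a α β * B m (y α) * B m (y β) :=
    Finset.sum_nonneg fun m _ => le_trans (by positivity) (ha fun α => B m (y α))
  have h4 : ∑ α, ‖y α‖ ^ 2 = ∑ i, ∑ α, y α i ^ 2 := by
    rw [Finset.sum_comm]
    exact Finset.sum_congr rfl fun α _ => EuclideanSpace.real_norm_sq_eq _
  rw [h1, h4]
  rw [← Finset.mul_sum] at h2
  nlinarith [mul_le_mul_of_nonneg_left h2 hlam.le]

variable {a : Fin n → Fin n → SpaceTime n → EuclideanSpace ℝ (Fin N) → ℝ}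
  {c : Fin N → Fin n → Fin n → SpaceTime n → EuclideanSpace ℝ (Fin N) → ℝ}
  {H : EuclideanSpace ℝ (Fin N) → ℝ}
  {u : SpaceTime n → EuclideanSpace ℝ (Fin N)}
  {Du : Fin n → SpaceTime n → EuclideanSpace ℝ (Fin N)}

theorem entropyCoeff_eq (α β : Fin n) (p : SpaceTime n) :
    entropyCoeff a c H u α β p = a α β p (u p) + fderiv ℝ H (u p) (couplingVec c u α β p) := by
  simp [entropyCoeff, fderiv_eq_sum_partialH, couplingVec, mul_comm]

/-- For the rank-one ξ = η ⊗ ζ with η = ∇H(u), the diagonal part of the system contributes |η|²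
a_{αβ}ζ_αζ_β and the coupling contributes |η|² (c_{αβ}·η)ζ_αζ_β, so the form is exactly |η|² times
that of A. Cancel |η|² if it is nonzero; if η = 0, then A = a and the ellipticity of a suffices. -/
theorem entropyCoeff_elliptic {lam : ℝ} {p : SpaceTime n}
    (ha : ∀ ζ : Fin n → ℝ, lam * ∑ α, ζ α ^ 2 ≤ ∑ α, ∑ β, a α β p (u p) * ζ α * ζ β)
    (hA : ∀ ξ : Fin N → Fin n → ℝ, lam * ∑ i, ∑ α, ξ i α ^ 2 ≤
      ∑ i, ∑ j, ∑ α, ∑ β, systemCoeff a c H i j α β p (u p) * ξ i α * ξ j β) (ζ : Fin n → ℝ) :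
    lam * ∑ α, ζ α ^ 2 ≤ ∑ α, ∑ β, entropyCoeff a c H u α β p * ζ α * ζ β := by
  set η : Fin N → ℝ := fun i => partialH H i (u p) with hη
  set S := ∑ i, η i ^ 2 with hS
  have hS0 : 0 ≤ S := Finset.sum_nonneg fun i _ => sq_nonneg _
  rcases hS0.eq_or_lt with h0 | hpos
  · have hz : ∀ i, partialH H i (u p) = 0 := by
      intro i
      have := (Finset.sum_eq_zero_iff_of_nonneg fun i _ => sq_nonneg (η i)).1 h0.symm i
        (Finset.mem_univ i)
      simpa [hη] using this
    simpa [entropyCoeff, hz] using ha ζ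
  · have h := hA fun i α => η i * ζ α
    have e1 : ∑ i, ∑ α, (η i * ζ α) ^ 2 = S * ∑ α, ζ α ^ 2 := by
      rw [hS, Finset.sum_mul_sum]
      simp only [mul_pow]
    have e2 : ∑ i, ∑ j, ∑ α, ∑ β, systemCoeff a c H i j α β p (u p) * (η i * ζ α) * (η j * ζ β) =
        S * ∑ α, ∑ β, entropyCoeff a c H u α β p * ζ α * ζ β := by
      have e3 : ∀ i, ∑ j, ∑ α, ∑ β,
          systemCoeff a c H i j α β p (u p) * (η i * ζ α) * (η j * ζ β) =
          ∑ α, ∑ β, (η i ^ 2 * a α β p (u p) + S * (c i α β p (u p) * η i)) * ζ α * ζ β := by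
        intro i
        rw [Finset.sum_comm]
        refine Finset.sum_congr rfl fun α _ => ?_
        rw [Finset.sum_comm]
        refine Finset.sum_congr rfl fun β _ => ?_
        have : ∀ j, systemCoeff a c H i j α β p (u p) * (η i * ζ α) * (η j * ζ β) =
            (if i = j then a α β p (u p) * η i * η j * ζ α * ζ β else 0) +
              η j ^ 2 * (c i α β p (u p) * η i * ζ α * ζ β) := by
          intro j
          simp only [systemCoeff, hη]
          split_ifs <;> ring
        rw [Finset.sum_congr rfl fun j _ => this j, Finset.sum_add_distrib, ← Finset.sum_mul]
        simp only [Finset.sum_ite_eq, Finset.mem_univ, if_true, ← hS]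
        ring
      rw [Finset.sum_congr rfl fun i _ => e3 i, Finset.sum_comm, Finset.mul_sum]
      refine Finset.sum_congr rfl fun α _ => ?_
      rw [Finset.sum_comm, Finset.mul_sum]
      refine Finset.sum_congr rfl fun β _ => ?_
      rw [← Finset.sum_mul, ← Finset.sum_mul, Finset.sum_add_distrib, ← Finset.sum_mul, ← hS,
        ← Finset.mul_sum]
      simp only [entropyCoeff, hη]
      ring
    rw [e1, e2, ← mul_assoc, mul_comm lam S, mul_assoc] at h
    exact le_of_mul_le_mul_left h hpos

variable (H) in
/-- The entropy `z ↦ exp (s H(z))`. -/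
noncomputable def expEntropy (s : ℝ) (z : EuclideanSpace ℝ (Fin N)) : ℝ := Real.exp (s * H z)

theorem contDiff_expEntropy (hH : ContDiff ℝ 2 H) (s : ℝ) : ContDiff ℝ 2 (expEntropy H s) :=
  Real.contDiff_exp.comp (contDiff_const.mul hH)

theorem hasFDerivAt_expEntropy (hH : ContDiff ℝ 2 H) (s : ℝ) (z : EuclideanSpace ℝ (Fin N)) :
    HasFDerivAt (expEntropy H s) ((s * expEntropy H s z) • fderiv ℝ H z) z := by
  have h := ((hH.differentiable (by simp) z).hasFDerivAt.const_mul s).exp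
  rw [smul_smul, mul_comm] at h
  exact h

theorem fderiv_expEntropy (hH : ContDiff ℝ 2 H) (s : ℝ) (z : EuclideanSpace ℝ (Fin N)) :
    fderiv ℝ (expEntropy H s) z = (s * expEntropy H s z) • fderiv ℝ H z :=
  (hasFDerivAt_expEntropy hH s z).fderiv

/-- Of the two parts of the Hessian, only DH ⊗ DH carries the additional factor s. This is the term
that dominates the mixed term for large s. -/
theorem fderiv_fderiv_expEntropy (hH : ContDiff ℝ 2 H) (s : ℝ) (z x y : EuclideanSpace ℝ (Fin N)) :
    fderiv ℝ (fderiv ℝ (expEntropy H s)) z x y = s * expEntropy H s z *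
      (fderiv ℝ (fderiv ℝ H) z x y + s * (fderiv ℝ H z x * fderiv ℝ H z y)) := by
  have hH' : ContDiff ℝ 1 (fderiv ℝ H) := hH.fderiv_right (by norm_num)
  have h := ((hasFDerivAt_expEntropy hH s z).const_mul s).smul
    (hH'.differentiable (by simp) z).hasFDerivAt
  rw [funext (fderiv_expEntropy hH s)]
  have h2 : fderiv ℝ (fun z => (s * expEntropy H s z) • fderiv ℝ H z) z = _ := h.fderiv
  rw [h2]
  simp
  ring

/-- The coupling enters the flux only through H(u)_{x_β}, and the derivative of the entropy is
proportional to DH. Contracting the two leaves an expression in the gradient of the entropy alone,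
so the equation for v is scalar. -/
theorem fderiv_expEntropy_fluxVec (hH : ContDiff ℝ 2 H) (s : ℝ) (α : Fin n) (p : SpaceTime n) :
    fderiv ℝ (expEntropy H s) (u p) (fluxVec a c H u Du α p) =
      ∑ β, entropyCoeff a c H u α β p * fderiv ℝ (expEntropy H s) (u p) (Du β p) := by
  simp only [fluxVec, fderiv_expEntropy hH, map_sum, map_add, map_smul, _root_.smul_apply,
    smul_eq_mul, entropyCoeff_eq]
  exact Finset.sum_congr rfl fun β _ => by ring

/-- Coercivity of the dissipation of the entropy `exp (s H)` for large `s`. -/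
theorem dissipation_ge (hH : ContDiff ℝ 2 H) {lam : ℝ} (hlam : 0 < lam)
    (hHconv : ∀ z ζ : EuclideanSpace ℝ (Fin N), lam * ‖ζ‖ ^ 2 ≤ fderiv ℝ (fderiv ℝ H) z ζ ζ)
    {p : SpaceTime n}
    (ha : ∀ ζ : Fin n → ℝ, lam * ∑ α, ζ α ^ 2 ≤ ∑ α, ∑ β, a α β p (u p) * ζ α * ζ β)
    (hA : ∀ ζ : Fin n → ℝ, lam * ∑ α, ζ α ^ 2 ≤ ∑ α, ∑ β, entropyCoeff a c H u α β p * ζ α * ζ β)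
    {q R s : ℝ} (hq : ‖fderiv ℝ (fderiv ℝ H) (u p)‖ ≤ q)
    (hR : ∀ α β, ‖couplingVec c u α β p‖ ≤ R) (hs : 0 < s)
    (hsB : n * (n + 1) * (q * R) ^ 2 / (2 * lam ^ 3) ≤ s) :
    s * expEntropy H s (u p) * (lam ^ 2 / 2) * gradNormSq Du p ≤
      ∑ α, fderiv ℝ (fderiv ℝ (expEntropy H s)) (u p) (Du α p) (fluxVec a c H u Du α p) := by
  set Q := fderiv ℝ (fderiv ℝ H) (u p) with hQdef
  set h : Fin n → ℝ := fun α => fderiv ℝ H (u p) (Du α p) with hh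
  have hsymm : ∀ x y, Q x y = Q y x := fun x y =>
    (hH.contDiffAt.isSymmSndFDerivAt (by simp)) x y
  have hq0 : 0 ≤ q := (norm_nonneg _).trans hq
  have t1 := sum_bilin_ge hsymm hlam (hHconv (u p)) ha (fun α => Du α p)
  have t3 := hA h
  -- Young's inequality for the mixed term. The weight on |Du_α|² is chosen so that its sum over the
  -- n values of β uses at most half of the lam² from `t1`; n + 1 in place of n avoids dividing by
  -- zero when n = 0.
  have t2 : - (∑ α, ∑ β, (lam ^ 2 / (2 * (n + 1)) * ‖Du α p‖ ^ 2 +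
      (n + 1) * (q * R) ^ 2 / (2 * lam ^ 2) * h β ^ 2)) ≤
      ∑ α, ∑ β, h β * Q (Du α p) (couplingVec c u α β p) := by
    rw [← Finset.sum_neg_distrib]
    refine Finset.sum_le_sum fun α _ => ?_
    rw [← Finset.sum_neg_distrib]
    refine Finset.sum_le_sum fun β _ => ?_
    have b1 : |h β * Q (Du α p) (couplingVec c u α β p)| ≤ |h β| * (q * ‖Du α p‖ * R) := by
      rw [abs_mul]
      refine mul_le_mul_of_nonneg_left ?_ (abs_nonneg _)
      refine (Q.le_opNorm₂ _ _).trans ?_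
      have := hR α β
      gcongr
    have b2 : |h β| * (q * ‖Du α p‖ * R) ≤ lam ^ 2 / (2 * (n + 1)) * ‖Du α p‖ ^ 2 +
        (n + 1) * (q * R) ^ 2 / (2 * lam ^ 2) * h β ^ 2 := by
      have hn : (0 : ℝ) < n + 1 := by positivity
      rw [← sq_abs (h β)]
      have e : lam ^ 2 / (2 * (n + 1)) * ‖Du α p‖ ^ 2 +
          (n + 1) * (q * R) ^ 2 / (2 * lam ^ 2) * |h β| ^ 2 - |h β| * (q * ‖Du α p‖ * R) =
          (lam ^ 2 * ‖Du α p‖ - (n + 1) * (q * R) * |h β|) ^ 2 / (2 * (n + 1) * lam ^ 2) := by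
        field_simp
        ring
      have : 0 ≤ (lam ^ 2 * ‖Du α p‖ - (n + 1) * (q * R) * |h β|) ^ 2 /
        (2 * (n + 1) * lam ^ 2) := by positivity
      linarith
    have := neg_abs_le (h β * Q (Du α p) (couplingVec c u α β p))
    linarith
  have e2 : ∑ α, ∑ β, (lam ^ 2 / (2 * (n + 1)) * ‖Du α p‖ ^ 2 +
      (n + 1) * (q * R) ^ 2 / (2 * lam ^ 2) * h β ^ 2) =
      n * (lam ^ 2 / (2 * (n + 1))) * ∑ α, ‖Du α p‖ ^ 2 +
        n * ((n + 1) * (q * R) ^ 2 / (2 * lam ^ 2)) * ∑ β, h β ^ 2 := by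
    simp only [Finset.sum_add_distrib, Finset.sum_const, Finset.card_univ, Fintype.card_fin,
      nsmul_eq_mul, ← Finset.mul_sum]
    ring
  -- Inserting the flux into the Hessian produces the three terms bounded by `t1`, `t2` and `t3`.
  -- The part a of the flux and the coupling part combine into A in the term with factor s.
  have e0 : ∑ α, fderiv ℝ (fderiv ℝ (expEntropy H s)) (u p) (Du α p) (fluxVec a c H u Du α p) =
      s * expEntropy H s (u p) * (∑ α, ∑ β, a α β p (u p) * Q (Du α p) (Du β p) +
        ∑ α, ∑ β, h β * Q (Du α p) (couplingVec c u α β p) +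
        s * ∑ α, ∑ β, entropyCoeff a c H u α β p * h α * h β) := by
    simp only [fderiv_fderiv_expEntropy hH, ← hQdef, fluxVec, map_sum, map_add, map_smul,
      smul_eq_mul, entropyCoeff_eq, Finset.mul_sum, ← Finset.sum_add_distrib]
    refine Finset.sum_congr rfl fun α _ => Finset.sum_congr rfl fun β _ => ?_
    simp only [hh]
    ring
  have hG : gradNormSq Du p = ∑ α, ‖Du α p‖ ^ 2 := rfl
  have hv : 0 < s * expEntropy H s (u p) := mul_pos hs (Real.exp_pos _)
  rw [e0, hG, mul_assoc]
  refine mul_le_mul_of_nonneg_left ?_ hv.le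
  rw [e2] at t2
  have hX : 0 ≤ ∑ α, ‖Du α p‖ ^ 2 := by positivity
  have hY : 0 ≤ ∑ β, h β ^ 2 := by positivity
  have k1 : n * (lam ^ 2 / (2 * (n + 1))) ≤ lam ^ 2 / 2 := by
    rw [mul_div_assoc', div_le_div_iff₀ (by positivity) (by positivity)]
    nlinarith [sq_nonneg lam]
  -- The lower bound on s is exactly what lets s·lam absorb the |h|² part of Young's inequality.
  have k2 : n * ((n + 1) * (q * R) ^ 2 / (2 * lam ^ 2)) ≤ s * lam := by
    calc n * ((n + 1) * (q * R) ^ 2 / (2 * lam ^ 2))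
        = n * (n + 1) * (q * R) ^ 2 / (2 * lam ^ 3) * lam := by field_simp
      _ ≤ s * lam := mul_le_mul_of_nonneg_right hsB hlam.le
  have m1 := mul_le_mul_of_nonneg_right k1 hX
  have m2 := mul_le_mul_of_nonneg_right k2 hY
  have m3 := mul_le_mul_of_nonneg_left t3 hs.le
  nlinarith

end EntropyAlgebra

/-! ### Strong L² limits of bounded, a.e. convergent operators. -/

section L2Limits

variable {α E W : Type*} [MeasurableSpace α] {μ : Measure α}
  [NormedAddCommGroup E] [NormedSpace ℝ E] [NormedAddCommGroup W] [NormedSpace ℝ W]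

theorem aestronglyMeasurable_clm_apply {b : α → E →L[ℝ] W} {f : α → E}
    (hb : AEStronglyMeasurable b μ) (hf : AEStronglyMeasurable f μ) :
    AEStronglyMeasurable (fun x => b x (f x)) μ := by
  have hc : Continuous fun q : (E →L[ℝ] W) × E => q.1 q.2 := by fun_prop
  exact hc.comp_aestronglyMeasurable (hb.prodMk hf)

theorem memLp_clm_apply {b : α → E →L[ℝ] W} {f : α → E} {C : ℝ} (hb : AEStronglyMeasurable b μ)
    (hbC : ∀ᵐ x ∂μ, ‖b x‖ ≤ C) (hf : MemLp f 2 μ) : MemLp (fun x => b x (f x)) 2 μ := by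
  refine hf.of_le_mul (c := C) (aestronglyMeasurable_clm_apply hb hf.1) ?_
  filter_upwards [hbC] with x hx
  exact ((b x).le_opNorm _).trans (mul_le_mul_of_nonneg_right hx (norm_nonneg _))

/-- Bounded a.e. convergent operators applied to a sequence that converges in `L²`. -/
theorem tendsto_eLpNorm_clm_apply_sub {b : ℕ → α → E →L[ℝ] W} {b₀ : α → E →L[ℝ] W}
    {f : ℕ → α → E} {f₀ : α → E} {C : ℝ} (hb : ∀ k, AEStronglyMeasurable (b k) μ)
    (hbC : ∀ k, ∀ᵐ x ∂μ, ‖b k x‖ ≤ C)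
    (hb₀ : ∀ᵐ x ∂μ, Tendsto (fun k => b k x) atTop (𝓝 (b₀ x)))
    (hf : ∀ k, MemLp (f k) 2 μ) (hf₀ : MemLp f₀ 2 μ)
    (hft : Tendsto (fun k => eLpNorm (f k - f₀) 2 μ) atTop (𝓝 0)) :
    Tendsto (fun k => eLpNorm ((fun x => b k x (f k x)) - fun x => b₀ x (f₀ x)) 2 μ)
      atTop (𝓝 0) := by
  have hb₀m : AEStronglyMeasurable b₀ μ := aestronglyMeasurable_of_tendsto_ae atTop hb hb₀
  have hb₀C : ∀ᵐ x ∂μ, ‖b₀ x‖ ≤ C := by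
    filter_upwards [hb₀, ae_all_iff.2 hbC] with x hx hx'
    exact le_of_tendsto hx.norm (Eventually.of_forall hx')
  have h2 : Tendsto (fun k => eLpNorm (fun x => (b k x - b₀ x) (f₀ x)) 2 μ) atTop (𝓝 0) := by
    rw [tendsto_eLpNorm_two_iff]
    have := tendsto_lintegral_of_dominated_convergence' (μ := μ)
      (F := fun k x => ‖(b k x - b₀ x) (f₀ x)‖ₑ ^ 2) (f := fun _ => 0)
      (fun x => ENNReal.ofReal (2 * C) ^ 2 * ‖f₀ x‖ₑ ^ 2)
      (fun k => (aestronglyMeasurable_clm_apply ((hb k).sub hb₀m) hf₀.1).enorm.pow_const 2)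
      (fun k => by
        filter_upwards [hbC k, hb₀C] with x h1 h2
        rw [← mul_pow]
        gcongr
        refine ((b k x - b₀ x).le_opENorm _).trans ?_
        gcongr
        rw [← ofReal_norm]
        exact ENNReal.ofReal_le_ofReal ((norm_sub_le (b k x) (b₀ x)).trans (by linarith)))
      (by
        rw [lintegral_const_mul' _ _ (ENNReal.pow_ne_top ENNReal.ofReal_ne_top),
          ← eLpNorm_two_sq]
        exact ENNReal.mul_ne_top (ENNReal.pow_ne_top ENNReal.ofReal_ne_top)
          (ENNReal.pow_ne_top hf₀.2.ne))
      (by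
        filter_upwards [hb₀] with x hx
        have hc : Continuous fun q : E →L[ℝ] W => ‖(q - b₀ x) (f₀ x)‖ₑ ^ 2 := by fun_prop
        have := (hc.tendsto (b₀ x)).comp hx
        simp only [sub_self, _root_.zero_apply, enorm_zero] at this
        simpa [Function.comp_def] using this)
    simpa using this
  have h1 : Tendsto (fun k => ENNReal.ofReal C * eLpNorm (f k - f₀) 2 μ) atTop (𝓝 0) := by
    simpa using ENNReal.Tendsto.const_mul hft (Or.inr ENNReal.ofReal_ne_top)
  have h12 : Tendsto (fun k => ENNReal.ofReal C * eLpNorm (f k - f₀) 2 μ +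
      eLpNorm (fun x => (b k x - b₀ x) (f₀ x)) 2 μ) atTop (𝓝 0) := by simpa using h1.add h2
  refine tendsto_of_tendsto_of_tendsto_of_le_of_le tendsto_const_nhds h12 (fun _ => zero_le)
    fun k => ?_
  have hsplit : ((fun x => b k x (f k x)) - fun x => b₀ x (f₀ x)) =
      (fun x => b k x ((f k - f₀) x)) + fun x => (b k x - b₀ x) (f₀ x) := by
    ext x
    simp
  rw [hsplit]
  have hm2 : AEStronglyMeasurable (fun x => (b k x - b₀ x) (f₀ x)) μ :=
    aestronglyMeasurable_clm_apply ((hb k).sub hb₀m) hf₀.1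
  refine (eLpNorm_add_le (aestronglyMeasurable_clm_apply (hb k) ((hf k).1.sub hf₀.1))
    hm2 one_le_two).trans ?_
  gcongr
  refine eLpNorm_le_mul_eLpNorm_of_ae_le_mul ?_ 2
  filter_upwards [hbC k] with x hx
  exact ((b k x).le_opNorm _).trans (mul_le_mul_of_nonneg_right hx (norm_nonneg _))

end L2Limits

/-! ### A smooth absolute value, used to make test functions nonnegative. -/

section SmoothAbs

/-- A smooth approximation of the absolute value that vanishes at the origin. -/
noncomputable def smoothAbs (ε r : ℝ) : ℝ := √(r ^ 2 + ε ^ 2) - ε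

variable {ε : ℝ}

theorem smoothAbs_arg_pos (hε : 0 < ε) (r : ℝ) : 0 < r ^ 2 + ε ^ 2 :=
  add_pos_of_nonneg_of_pos (sq_nonneg r) (pow_pos hε 2)

theorem contDiff_smoothAbs (hε : 0 < ε) : ContDiff ℝ ∞ (smoothAbs ε) :=
  (ContDiff.sqrt ((contDiff_id.pow 2).add contDiff_const)
    fun r => (smoothAbs_arg_pos hε r).ne').sub contDiff_const

theorem smoothAbs_zero (hε : 0 < ε) : smoothAbs ε 0 = 0 := by
  simp [smoothAbs, Real.sqrt_sq hε.le]

theorem smoothAbs_nonneg (ε r : ℝ) : 0 ≤ smoothAbs ε r :=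
  sub_nonneg.2 (Real.le_sqrt_of_sq_le (by nlinarith [sq_nonneg r]))

theorem smoothAbs_le_abs (hε : 0 < ε) (r : ℝ) : smoothAbs ε r ≤ |r| := by
  rw [smoothAbs, sub_le_iff_le_add]
  refine Real.sqrt_le_iff.2 ⟨by positivity, ?_⟩
  nlinarith [sq_abs r, abs_nonneg r]

theorem abs_sub_le_smoothAbs (r : ℝ) : |r| - ε ≤ smoothAbs ε r := by
  refine sub_le_sub_right (Real.le_sqrt_of_sq_le ?_) ε
  nlinarith [sq_abs r, sq_nonneg ε]

theorem deriv_smoothAbs (hε : 0 < ε) (r : ℝ) : deriv (smoothAbs ε) r = r / √(r ^ 2 + ε ^ 2) := by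
  have h := (((hasDerivAt_id r).pow 2).add_const (ε ^ 2)).sqrt (smoothAbs_arg_pos hε r).ne'
  have h2 : HasDerivAt (smoothAbs ε) _ r := h.sub_const ε
  rw [h2.deriv]
  simp
  field_simp

theorem abs_deriv_smoothAbs_le (hε : 0 < ε) (r : ℝ) : |deriv (smoothAbs ε) r| ≤ 1 := by
  rw [deriv_smoothAbs hε, abs_div, abs_of_pos (Real.sqrt_pos.2 (smoothAbs_arg_pos hε r))]
  refine div_le_one_of_le₀ (Real.le_sqrt_of_sq_le ?_) (Real.sqrt_nonneg _)
  nlinarith [sq_abs r, sq_nonneg ε]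

theorem continuous_deriv_smoothAbs (hε : 0 < ε) : Continuous (deriv (smoothAbs ε)) :=
  (contDiff_smoothAbs hε).continuous_deriv (by simp)

theorem abs_smoothAbs_sub_le (hε : 0 < ε) (r s : ℝ) :
    |smoothAbs ε r - smoothAbs ε s| ≤ |r - s| := by
  have := convex_univ.norm_image_sub_le_of_norm_deriv_le (f := smoothAbs ε) (C := 1)
    (fun x _ => (contDiff_smoothAbs hε).differentiable (by simp) x)
    (fun x _ => abs_deriv_smoothAbs_le hε x) (mem_univ s) (mem_univ r)
  simpa using this

theorem tendsto_smoothAbs {e : ℕ → ℝ} (he : ∀ k, 0 < e k) (h : Tendsto e atTop (𝓝 0)) (r : ℝ) :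
    Tendsto (fun k => smoothAbs (e k) r) atTop (𝓝 |r|) :=
  tendsto_of_tendsto_of_tendsto_of_le_of_le (by simpa using h.const_sub |r|) tendsto_const_nhds
    (fun _ => abs_sub_le_smoothAbs r) fun k => smoothAbs_le_abs (he k) r

theorem tendsto_deriv_smoothAbs {e : ℕ → ℝ} (he : ∀ k, 0 < e k) (h : Tendsto e atTop (𝓝 0))
    {r : ℝ} (hr : 0 < r) : Tendsto (fun k => deriv (smoothAbs (e k)) r) atTop (𝓝 1) := by
  simp_rw [fun k => deriv_smoothAbs (he k) r]
  have h1 : Tendsto (fun k => r / √(r ^ 2 + e k ^ 2)) atTop (𝓝 (r / √(r ^ 2 + 0 ^ 2))) := by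
    refine tendsto_const_nhds.div ((h.pow 2).const_add (r ^ 2)).sqrt ?_
    exact (Real.sqrt_pos.2 (by positivity)).ne'
  simpa [Real.sqrt_sq hr.le, hr.ne'] using h1

end SmoothAbs

/-! ### Smoothed absolute values of H¹₀ functions and derivatives on the zero set. -/

section SobolevZero

variable {n : ℕ} {Ω : Set (EuclideanSpace ℝ (Fin n))} {T : ℝ}

theorem IsTestFunction.memLp {φ : SpaceTime n → ℝ} (hφ : IsTestFunction Ω T φ) :
    MemLp φ 2 (cylMeasure Ω T) := (IsTestOn.memLp (U := cylinder Ω T) hφ).restrict _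

theorem IsTestFunction.memLp_fderiv_apply {φ : SpaceTime n → ℝ} (hφ : IsTestFunction Ω T φ)
    (v : SpaceTime n) : MemLp (fun p => fderiv ℝ φ p v) 2 (cylMeasure Ω T) :=
  (IsTestOn.memLp_fderiv_apply (U := cylinder Ω T) hφ v).restrict _

/-- Test functions that approximate an element of `H¹₀` in `H¹` and almost everywhere. -/
theorem MemH10.exists_approx {φ φt : SpaceTime n → ℝ} {Dφ : Fin n → SpaceTime n → ℝ}
    (hφ : MemH10 Ω T φ φt Dφ) : ∃ f : ℕ → SpaceTime n → ℝ,
      (∀ k, IsTestFunction Ω T (f k)) ∧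
      (∀ᵐ p ∂(cylMeasure Ω T), Tendsto (fun k => f k p) atTop (𝓝 (φ p))) ∧
      Tendsto (fun k => eLpNorm (f k - φ) 2 (cylMeasure Ω T)) atTop (𝓝 0) ∧
      Tendsto (fun k => eLpNorm (timeDeriv (f k) - φt) 2 (cylMeasure Ω T)) atTop (𝓝 0) ∧
      ∀ α, Tendsto (fun k => eLpNorm (spaceDeriv α (f k) - Dφ α) 2 (cylMeasure Ω T))
        atTop (𝓝 0) := by
  obtain ⟨hm, hmt, hmD, f, hf, hlim⟩ := hφ
  have h1 : Tendsto (fun k => eLpNorm (f k - φ) 2 (cylMeasure Ω T)) atTop (𝓝 0) := by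
    refine tendsto_eLpNorm_of_sq_le hlim fun k => ?_
    rw [eLpNorm_two_sq]
    exact lintegral_mono fun p => le_add_right le_self_add
  have h2 : Tendsto (fun k => eLpNorm (timeDeriv (f k) - φt) 2 (cylMeasure Ω T)) atTop (𝓝 0) := by
    refine tendsto_eLpNorm_of_sq_le hlim fun k => ?_
    rw [eLpNorm_two_sq]
    exact lintegral_mono fun p => le_add_right le_add_self
  have h3 : ∀ α, Tendsto (fun k => eLpNorm (spaceDeriv α (f k) - Dφ α) 2 (cylMeasure Ω T))
      atTop (𝓝 0) := by
    intro α
    refine tendsto_eLpNorm_of_sq_le hlim fun k => ?_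
    rw [eLpNorm_two_sq]
    refine lintegral_mono fun p => le_trans ?_ le_add_self
    exact Finset.single_le_sum (f := fun α => ‖spaceDeriv α (f k) p - Dφ α p‖ₑ ^ 2)
      (fun _ _ => zero_le) (Finset.mem_univ α)
  obtain ⟨ns, hns, hae⟩ := (tendstoInMeasure_of_tendsto_eLpNorm two_ne_zero
    (fun k => (hf k).memLp.1) hm h1).exists_seq_tendsto_ae
  exact ⟨fun k => f (ns k), fun k => hf _, hae, h1.comp hns.tendsto_atTop,
    h2.comp hns.tendsto_atTop, fun α => (h3 α).comp hns.tendsto_atTop⟩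

theorem tendsto_eLpNorm_smoothAbs_comp_sub {α : Type*} [MeasurableSpace α] {μ : Measure α} {ε : ℝ}
    (hε : 0 < ε) {f : ℕ → α → ℝ} {φ : α → ℝ}
    (h : Tendsto (fun k => eLpNorm (f k - φ) 2 μ) atTop (𝓝 0)) :
    Tendsto (fun k => eLpNorm ((fun p => smoothAbs ε (f k p)) - fun p => smoothAbs ε (φ p)) 2 μ)
      atTop (𝓝 0) :=
  tendsto_of_tendsto_of_tendsto_of_le_of_le tendsto_const_nhds h (fun _ => zero_le) fun k =>
    eLpNorm_mono fun p => abs_smoothAbs_sub_le hε (f k p) (φ p)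

theorem fderiv_smoothAbs_comp {X : Type*} [NormedAddCommGroup X] [NormedSpace ℝ X] {ε : ℝ}
    (hε : 0 < ε) {f : X → ℝ} (hf : ContDiff ℝ ∞ f) (p v : X) :
    fderiv ℝ (fun p => smoothAbs ε (f p)) p v = deriv (smoothAbs ε) (f p) * fderiv ℝ f p v := by
  have h := (((contDiff_smoothAbs hε).differentiable (by simp) (f p)).hasDerivAt.comp_hasFDerivAt p
    (hf.differentiable (by simp) p).hasFDerivAt).fderiv
  have h2 : fderiv ℝ (fun p => smoothAbs ε (f p)) p = _ := h
  rw [h2]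
  rfl

theorem memLp_smoothAbs_comp {α : Type*} [MeasurableSpace α] {μ : Measure α} {ε : ℝ}
    (hε : 0 < ε) {φ : α → ℝ} (hφ : MemLp φ 2 μ) : MemLp (fun p => smoothAbs ε (φ p)) 2 μ :=
  hφ.mono ((contDiff_smoothAbs hε).continuous.comp_aestronglyMeasurable hφ.1)
    (Eventually.of_forall fun p => by
      rw [Real.norm_of_nonneg (smoothAbs_nonneg _ _)]
      exact smoothAbs_le_abs hε _)

theorem memLp_deriv_smoothAbs_mul {α : Type*} [MeasurableSpace α] {μ : Measure α} {ε : ℝ}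
    (hε : 0 < ε) {φ g : α → ℝ} (hφ : AEStronglyMeasurable φ μ) (hg : MemLp g 2 μ) :
    MemLp (fun p => deriv (smoothAbs ε) (φ p) * g p) 2 μ :=
  hg.mono (((continuous_deriv_smoothAbs hε).comp_aestronglyMeasurable hφ).mul hg.1)
    (Eventually.of_forall fun p => by
      rw [norm_mul]
      exact mul_le_of_le_one_left (norm_nonneg _) (abs_deriv_smoothAbs_le hε _))

/-- The multipliers are bounded by 1 and converge a.e., since the derivative of the smoothed
absolute value is continuous; together with the strong convergence of g_k this suffices. -/
theorem tendsto_eLpNorm_deriv_smoothAbs_mul_sub {α : Type*} [MeasurableSpace α] {μ : Measure α}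
    {ε : ℝ} (hε : 0 < ε) {f g : ℕ → α → ℝ} {φ g₀ : α → ℝ} (hf : ∀ k, AEStronglyMeasurable (f k) μ)
    (hae : ∀ᵐ p ∂μ, Tendsto (fun k => f k p) atTop (𝓝 (φ p))) (hg : ∀ k, MemLp (g k) 2 μ)
    (hg₀ : MemLp g₀ 2 μ) (h : Tendsto (fun k => eLpNorm (g k - g₀) 2 μ) atTop (𝓝 0)) :
    Tendsto (fun k => eLpNorm ((fun p => deriv (smoothAbs ε) (f k p) * g k p) -
      fun p => deriv (smoothAbs ε) (φ p) * g₀ p) 2 μ) atTop (𝓝 0) := by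
  have hL : Continuous fun r : ℝ => ContinuousLinearMap.lsmul ℝ ℝ (E := ℝ)
      (deriv (smoothAbs ε) r) :=
    (ContinuousLinearMap.lsmul ℝ ℝ).continuous.comp (continuous_deriv_smoothAbs hε)
  have := tendsto_eLpNorm_clm_apply_sub (μ := μ)
    (b := fun k p => ContinuousLinearMap.lsmul ℝ ℝ (E := ℝ) (deriv (smoothAbs ε) (f k p)))
    (b₀ := fun p => ContinuousLinearMap.lsmul ℝ ℝ (deriv (smoothAbs ε) (φ p)))
    (C := 1) (fun k => hL.comp_aestronglyMeasurable (hf k))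
    (fun k => Eventually.of_forall fun p => ContinuousLinearMap.opNorm_le_bound _ zero_le_one
      fun x => by
        rw [ContinuousLinearMap.lsmul_apply, norm_smul]
        exact mul_le_mul_of_nonneg_right (abs_deriv_smoothAbs_le hε _) (norm_nonneg _))
    (by
      filter_upwards [hae] with p hp
      exact (hL.tendsto _).comp hp)
    hg hg₀ h
  simpa using this

/-- The weak derivative of a nonnegative Sobolev function vanishes where the function does. -/
theorem ae_eq_zero_of_approx (hΩ : IsOpen Ω) {v : SpaceTime n} {φ g : SpaceTime n → ℝ}
    {f : ℕ → SpaceTime n → ℝ} (hf : ∀ k, IsTestFunction Ω T (f k))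
    (hae : ∀ᵐ p ∂(cylMeasure Ω T), Tendsto (fun k => f k p) atTop (𝓝 (φ p)))
    (hφ : MemLp φ 2 (cylMeasure Ω T)) (hg : MemLp g 2 (cylMeasure Ω T))
    (h : Tendsto (fun k => eLpNorm (f k - φ) 2 (cylMeasure Ω T)) atTop (𝓝 0))
    (hd : Tendsto (fun k => eLpNorm ((fun p => fderiv ℝ (f k) p v) - g) 2 (cylMeasure Ω T))
      atTop (𝓝 0)) (h0 : ∀ᵐ p ∂(cylMeasure Ω T), 0 ≤ φ p) :
    ∀ᵐ p ∂(cylMeasure Ω T), φ p = 0 → g p = 0 := by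
  have hU := isOpen_cylinder (T := T) hΩ
  have hind : ∀ {θ w : SpaceTime n → ℝ}, (∀ p ∉ cylinder Ω T, θ p = 0) →
      ∫ p, θ p • (cylinder Ω T).indicator w p = ∫ p, θ p * w p ∂(cylMeasure Ω T) := by
    intro θ w hθ
    exact (integral_cylMeasure_eq_of_forall_notMem hΩ (fun p hp => by simp [hp])
      fun p hp => by simp [hp]).symm
  have W1 := hasWeakLineDeriv_of_tendsto hU (v := v) (u := φ) (Du := g) (f := f)
    (fun k => ((hf k).1.of_le (by norm_cast)).contDiffOn) (fun k => (hf k).memLp) hφ h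
    (fun k => (hf k).memLp_fderiv_apply v) hg hd
  -- As ε → 0 the smoothed absolute value of φ tends to φ, since φ ≥ 0, and its weak derivative
  -- tends to g restricted to {φ > 0}. Comparing with `W1`, uniqueness of the weak derivative forces
  -- g to vanish a.e. on {φ = 0}.
  have W2 : ∀ {ε : ℝ}, 0 < ε → HasWeakLineDeriv (cylinder Ω T) v
      ((cylinder Ω T).indicator fun p => smoothAbs ε (φ p))
      ((cylinder Ω T).indicator fun p => deriv (smoothAbs ε) (φ p) * g p) := by
    intro ε hε
    refine hasWeakLineDeriv_of_tendsto hU (f := fun k p => smoothAbs ε (f k p))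
      (fun k => (((contDiff_smoothAbs hε).comp (hf k).1).of_le (by norm_cast)).contDiffOn)
      (fun k => memLp_smoothAbs_comp hε (hf k).memLp) (memLp_smoothAbs_comp hε hφ)
      (tendsto_eLpNorm_smoothAbs_comp_sub hε h) (fun k => ?_)
      (memLp_deriv_smoothAbs_mul hε hφ.1 hg) ?_
    · simp_rw [fderiv_smoothAbs_comp hε (hf k).1]
      exact memLp_deriv_smoothAbs_mul hε (hf k).memLp.1 ((hf k).memLp_fderiv_apply v)
    · simp_rw [fun k => fderiv_smoothAbs_comp hε (hf k).1]
      exact tendsto_eLpNorm_deriv_smoothAbs_mul_sub hε (fun k => (hf k).memLp.1) hae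
        (fun k => (hf k).memLp_fderiv_apply v) hg hd
  let e : ℕ → ℝ := fun k => 1 / (k + 1)
  have he : ∀ k, 0 < e k := fun k => by positivity
  have he0 : Tendsto e atTop (𝓝 0) := tendsto_one_div_add_atTop_nhds_zero_nat
  -- The derivative of the smoothed absolute value is 0 at the origin for every ε and tends to 1 at
  -- positive arguments, so the limit loses exactly the values of g on {φ = 0}.
  have hconv : ∀ᵐ p ∂(cylMeasure Ω T), Tendsto (fun k => deriv (smoothAbs (e k)) (φ p) * g p)
      atTop (𝓝 (if φ p = 0 then 0 else g p)) := by
    filter_upwards [h0] with p hp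
    rcases hp.eq_or_lt with hp0 | hp0
    · simp [← hp0, deriv_smoothAbs (he _)]
    · rw [if_neg hp0.ne']
      simpa using (tendsto_deriv_smoothAbs he he0 hp0).mul_const (g p)
  have hw : MemLp (fun p => if φ p = 0 then 0 else g p) 2 (cylMeasure Ω T) := by
    refine hg.mono (aestronglyMeasurable_of_tendsto_ae (u := atTop)
      (fun k => (memLp_deriv_smoothAbs_mul (he k) hφ.1 hg).1) hconv)
      (Eventually.of_forall fun p => ?_)
    split_ifs
    · rw [norm_zero]
      exact norm_nonneg _
    · exact le_rfl
  have key : ∀ θ : SpaceTime n → ℝ, IsTestFunction Ω T θ →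
      ∫ p, θ p * (if φ p = 0 then g p else 0) ∂(cylMeasure Ω T) = 0 := by
    intro θ hθ
    have hθ0 : ∀ p ∉ cylinder Ω T, θ p = 0 := fun p hp => (hθ.notMem_cylinder hp).1
    have hθ1 : ∀ p ∉ cylinder Ω T, fderiv ℝ θ p v = 0 := fun p hp => by
      simp [(hθ.notMem_cylinder hp).2]
    have i1 : Integrable (fun p => fderiv ℝ θ p v * φ p) (cylMeasure Ω T) :=
      (hθ.memLp_fderiv_apply v).integrable_mul hφ
    have i2 : Integrable (fun p => θ p * g p) (cylMeasure Ω T) := hθ.memLp.integrable_mul hg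
    have t1 : Tendsto (fun k => ∫ p, fderiv ℝ θ p v * smoothAbs (e k) (φ p) ∂(cylMeasure Ω T))
        atTop (𝓝 (∫ p, fderiv ℝ θ p v * φ p ∂(cylMeasure Ω T))) := by
      refine tendsto_integral_of_dominated_convergence (fun p => ‖fderiv ℝ θ p v * φ p‖)
        (fun k => ((hθ.memLp_fderiv_apply v).1.mul (memLp_smoothAbs_comp (he k) hφ).1))
        i1.norm (fun k => Eventually.of_forall fun p => ?_) ?_
      · rw [norm_mul, norm_mul, Real.norm_of_nonneg (smoothAbs_nonneg _ _)]
        exact mul_le_mul_of_nonneg_left (smoothAbs_le_abs (he k) _) (norm_nonneg _)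
      · filter_upwards [h0] with p hp
        have := tendsto_smoothAbs he he0 (φ p)
        rw [abs_of_nonneg hp] at this
        exact this.const_mul _
    have t2 : Tendsto (fun k => ∫ p, θ p * (deriv (smoothAbs (e k)) (φ p) * g p)
        ∂(cylMeasure Ω T)) atTop
        (𝓝 (∫ p, θ p * (if φ p = 0 then 0 else g p) ∂(cylMeasure Ω T))) := by
      refine tendsto_integral_of_dominated_convergence (fun p => ‖θ p * g p‖)
        (fun k => hθ.memLp.1.mul (memLp_deriv_smoothAbs_mul (he k) hφ.1 hg).1)
        i2.norm (fun k => Eventually.of_forall fun p => ?_) ?_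
      · rw [norm_mul, norm_mul, norm_mul]
        exact mul_le_mul_of_nonneg_left (mul_le_of_le_one_left (norm_nonneg _)
          (abs_deriv_smoothAbs_le (he k) _)) (norm_nonneg _)
      · filter_upwards [hconv] with p hp
        exact hp.const_mul _
    have e1 := W1 θ hθ
    rw [hind hθ1, hind hθ0] at e1
    have e2 := tendsto_nhds_unique t1 (t2.neg.congr fun k => by
      have := W2 (he k) θ hθ
      rw [hind hθ1, hind hθ0] at this
      rw [this])
    have hsub : ∀ p, θ p * (if φ p = 0 then g p else 0) =
        θ p * g p - θ p * (if φ p = 0 then 0 else g p) := by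
      intro p
      split_ifs <;> simp
    simp_rw [hsub]
    have i3 : Integrable (fun p => θ p * (if φ p = 0 then 0 else g p)) (cylMeasure Ω T) :=
      hθ.memLp.integrable_mul hw
    rw [integral_sub i2 i3]
    linarith
  have hz : MemLp (fun p => if φ p = 0 then g p else 0) 2 (cylMeasure Ω T) := by
    convert hg.sub hw using 1
    ext p
    simp only [Pi.sub_apply]
    split_ifs <;> simp
  have hz' := (memLp_indicator_cylinder hΩ hz).locallyIntegrable one_le_two
  have hfin := hU.ae_eq_zero_of_integral_contDiff_smul_eq_zero
    (hz'.locallyIntegrableOn _) fun θ h1 h2 h3 => by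
      rw [hind fun p hp => image_eq_zero_of_notMem_tsupport fun h => hp (h3 h)]
      exact key θ ⟨h1, h2, h3⟩
  rw [cylMeasure, ae_restrict_iff' hU.measurableSet]
  filter_upwards [hfin] with p hp hpU hp0
  simpa [hpU, hp0] using hp hpU

end SobolevZero

/-! ### From smooth nonnegative test functions to H¹₀. -/

section TestFunctionExtension

variable {n : ℕ} {Ω : Set (EuclideanSpace ℝ (Fin n))} {T : ℝ}

theorem tendsto_integral_mul_of_eLpNorm {α : Type*} [MeasurableSpace α] {μ : Measure α}
    {f : ℕ → α → ℝ} {f₀ w : α → ℝ} (hf : ∀ k, MemLp (f k) 2 μ) (hf₀ : MemLp f₀ 2 μ)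
    (hw : MemLp w 2 μ) (h : Tendsto (fun k => eLpNorm (f k - f₀) 2 μ) atTop (𝓝 0)) :
    Tendsto (fun k => ∫ p, f k p * w p ∂μ) atTop (𝓝 (∫ p, f₀ p * w p ∂μ)) := by
  have := tendsto_integral_bilin_apply (μ := μ) (b := fun _ _ => ContinuousLinearMap.mul ℝ ℝ)
    (b₀ := fun _ => ContinuousLinearMap.mul ℝ ℝ) (f := f) (f₀ := f₀) (g := fun _ => w) (g₀ := w)
    (C := ‖ContinuousLinearMap.mul ℝ ℝ‖) (fun _ => aestronglyMeasurable_const)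
    (fun _ => by simp) (by simp) hf hf₀ h (fun _ => hw) hw (by simp)
  simpa using this

/-- Fatou's lemma for nonnegative functions whose integrals are controlled by a convergent
sequence. -/
theorem nonneg_and_lintegral_le_of_tendsto {α : Type*} [MeasurableSpace α] {μ : Measure α}
    {F : ℕ → α → ℝ} {F₀ : α → ℝ} {l : ℕ → ℝ} {l₀ : ℝ} (hF : ∀ k, AEMeasurable (F k) μ)
    (hlim : ∀ᵐ p ∂μ, Tendsto (fun k => F k p) atTop (𝓝 (F₀ p))) (hl : Tendsto l atTop (𝓝 l₀))
    (h : ∀ k, 0 ≤ l k ∧ ∫⁻ p, ENNReal.ofReal (F k p) ∂μ ≤ ENNReal.ofReal (l k)) :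
    0 ≤ l₀ ∧ ∫⁻ p, ENNReal.ofReal (F₀ p) ∂μ ≤ ENNReal.ofReal l₀ := by
  refine ⟨ge_of_tendsto' hl fun k => (h k).1, ?_⟩
  calc ∫⁻ p, ENNReal.ofReal (F₀ p) ∂μ
      = ∫⁻ p, liminf (fun k => ENNReal.ofReal (F k p)) atTop ∂μ := by
        refine lintegral_congr_ae ?_
        filter_upwards [hlim] with p hp
        exact ((ENNReal.continuous_ofReal.tendsto _).comp hp).liminf_eq.symm
    _ ≤ liminf (fun k => ∫⁻ p, ENNReal.ofReal (F k p) ∂μ) atTop :=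
        lintegral_liminf_le' fun k => (hF k).ennreal_ofReal
    _ ≤ liminf (fun k => ENNReal.ofReal (l k)) atTop :=
        liminf_le_liminf (Eventually.of_forall fun k => (h k).2)
    _ = ENNReal.ofReal l₀ := ((ENNReal.continuous_ofReal.tendsto _).comp hl).liminf_eq

/-- Smooth cutoff functions in the space variable. -/
noncomputable def spaceCutoff (n j : ℕ) (p : SpaceTime n) : ℝ :=
  (⟨1, 2, one_pos, one_lt_two⟩ : ContDiffBump (0 : EuclideanSpace ℝ (Fin n)))
    ((1 / (j + 1 : ℝ)) • p.1)

theorem contDiff_spaceCutoff (j : ℕ) : ContDiff ℝ ∞ (spaceCutoff n j) :=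
  (ContDiffBump.contDiff _).comp (by fun_prop)

theorem spaceCutoff_nonneg (j : ℕ) (p : SpaceTime n) : 0 ≤ spaceCutoff n j p :=
  ContDiffBump.nonneg _

theorem spaceCutoff_le_one (j : ℕ) (p : SpaceTime n) : spaceCutoff n j p ≤ 1 :=
  ContDiffBump.le_one _

theorem tendsto_spaceCutoff (p : SpaceTime n) :
    Tendsto (fun j => spaceCutoff n j p) atTop (𝓝 1) := by
  let χ : ContDiffBump (0 : EuclideanSpace ℝ (Fin n)) := ⟨1, 2, one_pos, one_lt_two⟩
  have h0 : χ 0 = 1 := χ.one_of_mem_closedBall (Metric.mem_closedBall_self zero_le_one)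
  have h1 : Tendsto (fun j : ℕ => (1 / (j + 1 : ℝ)) • p.1) atTop (𝓝 0) := by
    simpa using (tendsto_one_div_add_atTop_nhds_zero_nat (𝕜 := ℝ)).smul_const p.1
  rw [← h0]
  exact (χ.continuous.tendsto 0).comp h1

theorem spaceCutoff_eq_zero {j : ℕ} {p : SpaceTime n}
    (hp : p.1 ∉ Metric.closedBall (0 : EuclideanSpace ℝ (Fin n)) (2 * (j + 1))) :
    spaceCutoff n j p = 0 := by
  refine ContDiffBump.zero_of_le_dist _ ?_
  rw [mem_closedBall_zero_iff, not_le] at hp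
  rw [dist_zero_right, norm_smul, Real.norm_of_nonneg (by positivity), one_div_mul_eq_div,
    le_div_iff₀ (by positivity)]
  exact hp.le

theorem hasFDerivAt_spaceCutoff (j : ℕ) (p v : SpaceTime n) :
    fderiv ℝ (spaceCutoff n j) p v = (1 / (j + 1 : ℝ)) * fderiv ℝ
      (⟨1, 2, one_pos, one_lt_two⟩ : ContDiffBump (0 : EuclideanSpace ℝ (Fin n)))
        ((1 / (j + 1 : ℝ)) • p.1) v.1 := by
  let χ : ContDiffBump (0 : EuclideanSpace ℝ (Fin n)) := ⟨1, 2, one_pos, one_lt_two⟩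
  have h1 : HasFDerivAt (fun p : SpaceTime n => (1 / (j + 1 : ℝ)) • p.1)
      ((1 / (j + 1 : ℝ)) • ContinuousLinearMap.fst ℝ (EuclideanSpace ℝ (Fin n)) ℝ) p :=
    ((1 / (j + 1 : ℝ)) • ContinuousLinearMap.fst ℝ (EuclideanSpace ℝ (Fin n)) ℝ).hasFDerivAt
  have h2 := ((χ.contDiff (n := 1)).differentiable (by simp)
    ((1 / (j + 1 : ℝ)) • p.1)).hasFDerivAt.comp p h1
  have h3 : fderiv ℝ (spaceCutoff n j) p = _ := h2.fderiv
  rw [h3]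
  simp [χ]

/-- A cutoff in x alone creates no term with η_t φ v, where φ is merely in L² and v merely bounded
on a possibly unbounded domain. -/
theorem timeDeriv_spaceCutoff (j : ℕ) (p : SpaceTime n) :
    fderiv ℝ (spaceCutoff n j) p (0, 1) = 0 := by
  rw [hasFDerivAt_spaceCutoff]
  simp

theorem exists_bound_spaceDeriv_spaceCutoff (n : ℕ) : ∃ C : ℝ, ∀ (j : ℕ) (p : SpaceTime n)
    (α : Fin n), |fderiv ℝ (spaceCutoff n j) p (EuclideanSpace.single α 1, 0)| ≤
      1 / (j + 1 : ℝ) * C := by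
  let χ : ContDiffBump (0 : EuclideanSpace ℝ (Fin n)) := ⟨1, 2, one_pos, one_lt_two⟩
  obtain ⟨C, hC⟩ := (χ.hasCompactSupport.fderiv ℝ).exists_bound_of_continuous
    ((χ.contDiff (n := 1)).continuous_fderiv (by simp))
  refine ⟨C, fun j p α => ?_⟩
  rw [hasFDerivAt_spaceCutoff, abs_mul, abs_of_nonneg (by positivity)]
  refine mul_le_mul_of_nonneg_left ?_ (by positivity)
  refine ((fderiv ℝ χ _).le_opNorm _).trans ?_
  simpa using hC _

/-- The time interval is bounded, so a compact support in x already gives finite measure. -/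
theorem memLp_spaceCutoff (j : ℕ) : MemLp (spaceCutoff n j) 2 (cylMeasure Ω T) := by
  set B := Metric.closedBall (0 : EuclideanSpace ℝ (Fin n)) (2 * (j + 1)) with hB
  have hS : MeasurableSet (B ×ˢ (univ : Set ℝ)) :=
    Metric.isClosed_closedBall.measurableSet.prod MeasurableSet.univ
  have hfin : cylMeasure Ω T (B ×ˢ (univ : Set ℝ)) ≠ ⊤ := by
    rw [cylMeasure_eq_prod, Measure.prod_prod]
    refine ENNReal.mul_ne_top ?_ (by simp)
    exact ((Measure.restrict_apply_le _ _).trans_lt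
      (isCompact_closedBall _ _).measure_lt_top).ne
  refine (memLp_indicator_const 2 hS (1 : ℝ) (Or.inr hfin)).mono
    (contDiff_spaceCutoff j).continuous.aestronglyMeasurable (Eventually.of_forall fun p => ?_)
  by_cases hp : p.1 ∈ B
  · rw [indicator_of_mem (by simpa using hp), Real.norm_of_nonneg (spaceCutoff_nonneg j p)]
    simpa using spaceCutoff_le_one j p
  · rw [spaceCutoff_eq_zero hp, norm_zero]
    exact norm_nonneg _

/-- The smoothed absolute value vanishes at 0, so it does not enlarge the support; this is why ε is
subtracted in `smoothAbs`. -/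
theorem IsTestFunction.smoothAbs_mul {ε : ℝ} (hε : 0 < ε) {φ η : SpaceTime n → ℝ}
    (hφ : IsTestFunction Ω T φ) (hη : ContDiff ℝ ∞ η) :
    IsTestFunction Ω T fun p => smoothAbs ε (φ p) * η p := by
  have hs : tsupport (fun p => smoothAbs ε (φ p) * η p) ⊆ tsupport φ := by
    refine closure_mono fun p hp h0 => hp ?_
    simp [h0, smoothAbs_zero hε]
  exact ⟨((contDiff_smoothAbs hε).comp hφ.1).mul hη,
    hφ.2.1.isCompact.of_isClosed_subset (isClosed_tsupport _) hs, hs.trans hφ.2.2⟩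

/-- The product rule splits the derivative into two products of L²-convergent sequences with fixed
L² weights. The factor η is attached to w because w itself may be only bounded. -/
theorem tendsto_integral_fderiv_smoothAbs_mul {ε : ℝ} (hε : 0 < ε) {d : SpaceTime n}
    {f : ℕ → SpaceTime n → ℝ} {φ g η w : SpaceTime n → ℝ} (hf : ∀ k, IsTestFunction Ω T (f k))
    (hae : ∀ᵐ p ∂(cylMeasure Ω T), Tendsto (fun k => f k p) atTop (𝓝 (φ p)))
    (hφ : MemLp φ 2 (cylMeasure Ω T)) (hg : MemLp g 2 (cylMeasure Ω T))
    (h : Tendsto (fun k => eLpNorm (f k - φ) 2 (cylMeasure Ω T)) atTop (𝓝 0))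
    (hd : Tendsto (fun k => eLpNorm ((fun p => fderiv ℝ (f k) p d) - g) 2 (cylMeasure Ω T))
      atTop (𝓝 0)) (hη : ContDiff ℝ ∞ η)
    (hηw : MemLp (fun p => η p * w p) 2 (cylMeasure Ω T))
    (hη'w : MemLp (fun p => fderiv ℝ η p d * w p) 2 (cylMeasure Ω T)) :
    Tendsto (fun k => ∫ p, fderiv ℝ (fun p => smoothAbs ε (f k p) * η p) p d * w p
        ∂(cylMeasure Ω T)) atTop
      (𝓝 (∫ p, deriv (smoothAbs ε) (φ p) * g p * (η p * w p) ∂(cylMeasure Ω T) +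
        ∫ p, smoothAbs ε (φ p) * (fderiv ℝ η p d * w p) ∂(cylMeasure Ω T))) := by
  have m1 := fun k => memLp_deriv_smoothAbs_mul hε (hf k).memLp.1 ((hf k).memLp_fderiv_apply d)
  have m2 := fun k => memLp_smoothAbs_comp hε (hf k).memLp
  have t1 := tendsto_integral_mul_of_eLpNorm m1 (memLp_deriv_smoothAbs_mul hε hφ.1 hg) hηw
    (tendsto_eLpNorm_deriv_smoothAbs_mul_sub hε (fun k => (hf k).memLp.1) hae
      (fun k => (hf k).memLp_fderiv_apply d) hg hd)
  have t2 := tendsto_integral_mul_of_eLpNorm m2 (memLp_smoothAbs_comp hε hφ) hη'w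
    (tendsto_eLpNorm_smoothAbs_comp_sub hε h)
  refine (t1.add t2).congr fun k => ?_
  have i1 : Integrable (fun p => deriv (smoothAbs ε) (f k p) * fderiv ℝ (f k) p d * (η p * w p))
    (cylMeasure Ω T) := (m1 k).integrable_mul hηw
  have i2 : Integrable (fun p => smoothAbs ε (f k p) * (fderiv ℝ η p d * w p))
    (cylMeasure Ω T) := (m2 k).integrable_mul hη'w
  rw [← integral_add i1 i2]
  refine integral_congr_ae (Eventually.of_forall fun p => ?_)
  have hG : DifferentiableAt ℝ (fun p => smoothAbs ε (f k p)) p :=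
    ((contDiff_smoothAbs hε).comp (hf k).1).differentiable (by simp) p
  have hm := (hG.hasFDerivAt.mul (hη.differentiable (by simp) p).hasFDerivAt).fderiv
  have hm' : fderiv ℝ (fun p => smoothAbs ε (f k p) * η p) p = _ := hm
  simp only [hm', _root_.add_apply, _root_.smul_apply, smul_eq_mul,
    fderiv_smoothAbs_comp hε (hf k).1]
  ring

/-- An integral inequality for nonnegative smooth test functions extends to `H¹₀`. -/
theorem integral_le_of_memH10 (hΩ : IsOpen Ω) {v f : SpaceTime n → ℝ}
    {J : Fin n → SpaceTime n → ℝ} {C : ℝ} (hv : AEStronglyMeasurable v (cylMeasure Ω T))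
    (hvC : ∀ᵐ p ∂(cylMeasure Ω T), ‖v p‖ ≤ C) (hJ : ∀ α, MemLp (J α) 2 (cylMeasure Ω T))
    (hf : AEStronglyMeasurable f (cylMeasure Ω T)) (hf0 : ∀ p, 0 ≤ f p)
    (h : ∀ ψ : SpaceTime n → ℝ, IsTestFunction Ω T ψ → (∀ p, 0 ≤ ψ p) →
      Integrable (fun p => f p * ψ p) (cylMeasure Ω T) ∧
      ∫ p, f p * ψ p ∂(cylMeasure Ω T) ≤ ∫ p, timeDeriv ψ p * v p ∂(cylMeasure Ω T) -
        ∑ α, ∫ p, spaceDeriv α ψ p * J α p ∂(cylMeasure Ω T))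
    {φ φt : SpaceTime n → ℝ} {Dφ : Fin n → SpaceTime n → ℝ} (hφ : MemH10 Ω T φ φt Dφ)
    (h0 : ∀ᵐ p ∂(cylMeasure Ω T), 0 ≤ φ p)
    (hint : Integrable (fun p => φt p * v p) (cylMeasure Ω T)) :
    MemLp φ 2 (cylMeasure Ω T) ∧ (∀ α, MemLp (Dφ α) 2 (cylMeasure Ω T)) ∧
    Integrable (fun p => f p * φ p) (cylMeasure Ω T) ∧
    ∫ p, f p * φ p ∂(cylMeasure Ω T) ≤ ∫ p, φt p * v p ∂(cylMeasure Ω T) -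
      ∑ α, ∫ p, Dφ α p * J α p ∂(cylMeasure Ω T) := by
  obtain ⟨g, hg, hae, hgφ, hgt, hgD⟩ := hφ.exists_approx
  have hφ2 : MemLp φ 2 (cylMeasure Ω T) :=
    memLp_of_tendsto_eLpNorm (fun k => (hg k).memLp) hφ.1 hgφ
  have hφt2 : MemLp φt 2 (cylMeasure Ω T) :=
    memLp_of_tendsto_eLpNorm (fun k => (hg k).memLp_fderiv_apply _) hφ.2.1 hgt
  have hDφ2 : ∀ α, MemLp (Dφ α) 2 (cylMeasure Ω T) := fun α =>
    memLp_of_tendsto_eLpNorm (fun k => (hg k).memLp_fderiv_apply _) (hφ.2.2.1 α) (hgD α)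
  have zt := ae_eq_zero_of_approx hΩ hg hae hφ2 hφt2 hgφ hgt h0
  have zD : ∀ α, ∀ᵐ p ∂(cylMeasure Ω T), φ p = 0 → Dφ α p = 0 := fun α =>
    ae_eq_zero_of_approx hΩ hg hae hφ2 (hDφ2 α) hgφ (hgD α) h0
  obtain ⟨C', hC'⟩ := exists_bound_spaceDeriv_spaceCutoff n
  let e : ℕ → ℝ := fun k => 1 / (k + 1)
  have he : ∀ k, 0 < e k := fun k => by positivity
  have he0 : Tendsto e atTop (𝓝 0) := tendsto_one_div_add_atTop_nhds_zero_nat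
  have hcm : ∀ j, AEStronglyMeasurable (spaceCutoff n j) (cylMeasure Ω T) := fun j =>
    (contDiff_spaceCutoff j).continuous.aestronglyMeasurable
  have hdm : ∀ j (d : SpaceTime n), AEStronglyMeasurable
      (fun p => fderiv ℝ (spaceCutoff n j) p d) (cylMeasure Ω T) := fun j d =>
    (((contDiff_spaceCutoff j).continuous_fderiv (by simp)).clm_apply
      continuous_const).aestronglyMeasurable
  have hηv : ∀ j, MemLp (fun p => spaceCutoff n j p * v p) 2 (cylMeasure Ω T) := by
    intro j
    refine (memLp_spaceCutoff j).of_le_mul (c := C) ((hcm j).mul hv) ?_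
    filter_upwards [hvC] with p hp
    rw [norm_mul, mul_comm]
    exact mul_le_mul_of_nonneg_right hp (norm_nonneg _)
  have hηJ : ∀ j α, MemLp (fun p => spaceCutoff n j p * J α p) 2 (cylMeasure Ω T) := by
    intro j α
    refine (hJ α).mono ((hcm j).mul (hJ α).1) (Eventually.of_forall fun p => ?_)
    rw [norm_mul, Real.norm_of_nonneg (spaceCutoff_nonneg j p)]
    exact mul_le_of_le_one_left (norm_nonneg _) (spaceCutoff_le_one j p)
  have hη'J : ∀ j α, MemLp (fun p => fderiv ℝ (spaceCutoff n j) p (EuclideanSpace.single α 1, 0) *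
      J α p) 2 (cylMeasure Ω T) := by
    intro j α
    refine (hJ α).of_le_mul (c := 1 / (j + 1 : ℝ) * C') ((hdm j _).mul (hJ α).1)
      (Eventually.of_forall fun p => ?_)
    rw [norm_mul]
    exact mul_le_mul_of_nonneg_right (hC' j p α) (norm_nonneg _)
  have hη'v : ∀ j, MemLp (fun p => fderiv ℝ (spaceCutoff n j) p (0, 1) * v p) 2
      (cylMeasure Ω T) := by
    intro j
    simp [timeDeriv_spaceCutoff]
  -- The right-hand side for the test functions `smoothAbs (e j) (g k) * spaceCutoff n j` after k →
  -- ∞, with the smoothing parameter and the cutoff radius tied to the same index j. The limit j → ∞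
  -- is taken afterwards.
  let l : ℕ → ℝ := fun j =>
    (∫ p, deriv (smoothAbs (e j)) (φ p) * φt p * (spaceCutoff n j p * v p) ∂(cylMeasure Ω T)) -
      ∑ α, ((∫ p, deriv (smoothAbs (e j)) (φ p) * Dφ α p * (spaceCutoff n j p * J α p)
          ∂(cylMeasure Ω T)) +
        ∫ p, smoothAbs (e j) (φ p) * (fderiv ℝ (spaceCutoff n j) p (EuclideanSpace.single α 1, 0) *
          J α p) ∂(cylMeasure Ω T))
  have step1 : ∀ j, 0 ≤ l j ∧ ∫⁻ p, ENNReal.ofReal (f p * (smoothAbs (e j) (φ p) *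
      spaceCutoff n j p)) ∂(cylMeasure Ω T) ≤ ENNReal.ofReal (l j) := by
    intro j
    have hψ := fun k => (hg k).smoothAbs_mul (he j) (contDiff_spaceCutoff j)
    have hψ0 : ∀ k p, 0 ≤ smoothAbs (e j) (g k p) * spaceCutoff n j p := fun k p =>
      mul_nonneg (smoothAbs_nonneg _ _) (spaceCutoff_nonneg j p)
    have tt := tendsto_integral_fderiv_smoothAbs_mul (he j) hg hae hφ2 hφt2 hgφ hgt
      (contDiff_spaceCutoff j) (hηv j) (hη'v j)
    have tD := fun α => tendsto_integral_fderiv_smoothAbs_mul (he j) hg hae hφ2 (hDφ2 α) hgφ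
      (hgD α) (contDiff_spaceCutoff j) (hηJ j α) (hη'J j α)
    have hl := tt.sub (tendsto_finsetSum (Finset.univ : Finset (Fin n)) fun α _ => tD α)
    simp only [timeDeriv_spaceCutoff, zero_mul, mul_zero, integral_zero, add_zero] at hl
    refine nonneg_and_lintegral_le_of_tendsto
      (F := fun k p => f p * (smoothAbs (e j) (g k p) * spaceCutoff n j p))
      (fun k => (h _ (hψ k) (hψ0 k)).1.aemeasurable) ?_ hl fun k => ?_
    · filter_upwards [hae] with p hp
      exact ((((contDiff_smoothAbs (he j)).continuous.tendsto _).comp hp).mul_const _).const_mul _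
    · have hk := h _ (hψ k) (hψ0 k)
      have hnn : 0 ≤ fun p => f p * (smoothAbs (e j) (g k p) * spaceCutoff n j p) := fun p =>
        mul_nonneg (hf0 p) (hψ0 k p)
      refine ⟨(integral_nonneg hnn).trans hk.2, ?_⟩
      rw [← ofReal_integral_eq_lintegral_ofReal hk.1 (Eventually.of_forall hnn)]
      exact ENNReal.ofReal_le_ofReal hk.2
  have hprod : ∀ {w W : SpaceTime n → ℝ} (j : ℕ) (p : SpaceTime n),
      ‖deriv (smoothAbs (e j)) (φ p) * w p * (spaceCutoff n j p * W p)‖ ≤ ‖w p * W p‖ := by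
    intro w W j p
    have e1 : deriv (smoothAbs (e j)) (φ p) * w p * (spaceCutoff n j p * W p) =
      (deriv (smoothAbs (e j)) (φ p) * spaceCutoff n j p) * (w p * W p) := by ring
    rw [e1, norm_mul]
    refine mul_le_of_le_one_left (norm_nonneg _) ?_
    rw [norm_mul]
    refine mul_le_one₀ (abs_deriv_smoothAbs_le (he j) _) (norm_nonneg _) ?_
    rw [Real.norm_of_nonneg (spaceCutoff_nonneg j p)]
    exact spaceCutoff_le_one j p
  -- Domination by |w W| is where the integrability of v φ_t is used. On {φ = 0} the multiplier is 0
  -- and does not tend to 1, so there w must vanish a.e.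
  have hlimG : ∀ {w W : SpaceTime n → ℝ}, (∀ᵐ p ∂(cylMeasure Ω T), φ p = 0 → w p = 0) →
      AEStronglyMeasurable w (cylMeasure Ω T) → AEStronglyMeasurable W (cylMeasure Ω T) →
      Integrable (fun p => w p * W p) (cylMeasure Ω T) →
      Tendsto (fun j => ∫ p, deriv (smoothAbs (e j)) (φ p) * w p * (spaceCutoff n j p * W p)
        ∂(cylMeasure Ω T)) atTop (𝓝 (∫ p, w p * W p ∂(cylMeasure Ω T))) := by
    intro w W hz hw hW hi
    refine tendsto_integral_of_dominated_convergence (fun p => ‖w p * W p‖)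
      (fun j => ((((continuous_deriv_smoothAbs (he j)).comp_aestronglyMeasurable hφ.1).mul
        hw).mul ((hcm j).mul hW))) hi.norm
      (fun j => Eventually.of_forall fun p => hprod j p) ?_
    filter_upwards [h0, hz] with p hp hzp
    rcases hp.eq_or_lt with hp0 | hp0
    · simp [hzp hp0.symm]
    · have := ((tendsto_deriv_smoothAbs he he0 hp0).mul_const (w p)).mul
        ((tendsto_spaceCutoff p).mul_const (W p))
      simpa using this
  -- The gradient of the cutoff is of order 1/(j + 1), and it multiplies φ J, which is integrable as
  -- a product of L² functions.
  have hlim0 : ∀ α, Tendsto (fun j => ∫ p, smoothAbs (e j) (φ p) *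
      (fderiv ℝ (spaceCutoff n j) p (EuclideanSpace.single α 1, 0) * J α p) ∂(cylMeasure Ω T))
      atTop (𝓝 0) := by
    intro α
    have hi : Integrable (fun p => φ p * J α p) (cylMeasure Ω T) := hφ2.integrable_mul (hJ α)
    have hb : ∀ j p, ‖smoothAbs (e j) (φ p) * (fderiv ℝ (spaceCutoff n j) p
        (EuclideanSpace.single α 1, 0) * J α p)‖ ≤ (e j * C') * ‖φ p * J α p‖ := by
      intro j p
      rw [norm_mul, norm_mul, norm_mul, Real.norm_of_nonneg (smoothAbs_nonneg _ _)]
      calc smoothAbs (e j) (φ p) * (‖fderiv ℝ (spaceCutoff n j) p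
            (EuclideanSpace.single α 1, 0)‖ * ‖J α p‖)
          ≤ |φ p| * ((e j * C') * ‖J α p‖) :=
            mul_le_mul (smoothAbs_le_abs (he j) _)
              (mul_le_mul_of_nonneg_right (hC' j p α) (norm_nonneg _)) (by positivity)
              (abs_nonneg _)
        _ = _ := by
            simp only [Real.norm_eq_abs]
            ring
    refine squeeze_zero_norm (a := fun j => (e j * C') * ∫ p, ‖φ p * J α p‖ ∂(cylMeasure Ω T))
      (fun j => ?_) (by simpa using (he0.mul_const C').mul_const _)
    rw [← integral_const_mul]
    exact norm_integral_le_of_norm_le (hi.norm.const_mul _) (Eventually.of_forall (hb j))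
  have hl0 : Tendsto l atTop (𝓝 (∫ p, φt p * v p ∂(cylMeasure Ω T) -
      ∑ α, ∫ p, Dφ α p * J α p ∂(cylMeasure Ω T))) := by
    have t := (hlimG zt hφ.2.1 hv hint).sub
      (tendsto_finsetSum (Finset.univ : Finset (Fin n)) fun α _ =>
        (hlimG (zD α) (hφ.2.2.1 α) (hJ α).1 ((hDφ2 α).integrable_mul (hJ α))).add (hlim0 α))
    simpa using t
  -- This second use of Fatou's lemma gives the integrability of f φ together with the bound. The
  -- sign of the limit is carried along because `ENNReal.ofReal` sends negative numbers to 0.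
  have hfin := nonneg_and_lintegral_le_of_tendsto
    (F := fun j p => f p * (smoothAbs (e j) (φ p) * spaceCutoff n j p)) (F₀ := fun p => f p * φ p)
    (fun j => (hf.mul (((contDiff_smoothAbs (he j)).continuous.comp_aestronglyMeasurable
      hφ.1).mul (hcm j))).aemeasurable)
    (by
      filter_upwards [h0] with p hp
      have := ((tendsto_smoothAbs he he0 (φ p)).mul (tendsto_spaceCutoff p)).const_mul (f p)
      simpa [abs_of_nonneg hp] using this) hl0 step1
  have hfφ0 : ∀ᵐ p ∂(cylMeasure Ω T), 0 ≤ f p * φ p := h0.mono fun p hp => mul_nonneg (hf0 p) hp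
  have hI : Integrable (fun p => f p * φ p) (cylMeasure Ω T) :=
    ⟨hf.mul hφ.1, (hasFiniteIntegral_iff_ofReal hfφ0).2 (hfin.2.trans_lt ENNReal.ofReal_lt_top)⟩
  refine ⟨hφ2, hDφ2, hI, ?_⟩
  rw [integral_eq_lintegral_of_nonneg_ae hfφ0 hI.1]
  exact ENNReal.toReal_le_of_le_ofReal hfin.1 hfin.2

end TestFunctionExtension

/-! ### Composition with a C¹ function stays in V. -/

section MemVComp

variable {n N : ℕ} {Ω : Set (EuclideanSpace ℝ (Fin n))} {T : ℝ}
  {E : Type*} [NormedAddCommGroup E] [NormedSpace ℝ E]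

theorem ae_ae_of_ae_cylMeasure {P : SpaceTime n → Prop} (h : ∀ᵐ p ∂(cylMeasure Ω T), P p) :
    ∀ᵐ t ∂((volume : Measure ℝ).restrict (Ioo 0 T)),
      ∀ᵐ x ∂((volume : Measure (EuclideanSpace ℝ (Fin n))).restrict Ω), P (x, t) := by
  rw [cylMeasure_eq_prod] at h
  exact Measure.ae_ae_of_ae_prod
    ((Measure.measurePreserving_swap (μ := (volume : Measure ℝ).restrict (Ioo 0 T))
      (ν := (volume : Measure (EuclideanSpace ℝ (Fin n))).restrict Ω)).quasiMeasurePreserving.ae h)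

theorem lintegral_sum_enorm_sq {α ι : Type*} [MeasurableSpace α] {μ : Measure α} [Fintype ι]
    {g : ι → α → E} (hg : ∀ i, AEStronglyMeasurable (g i) μ) :
    ∫⁻ p, ∑ i, ‖g i p‖ₑ ^ 2 ∂μ = ∑ i, eLpNorm (g i) 2 μ ^ 2 := by
  rw [lintegral_finsetSum' _ fun i _ => (hg i).enorm.pow_const 2]
  simp_rw [eLpNorm_two_sq]

/-- A truncation of a `C²` function outside a ball. -/
theorem exists_truncation {F : EuclideanSpace ℝ (Fin N) → ℝ} (hF : ContDiff ℝ 1 F) (M : ℝ) :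
    ∃ G : EuclideanSpace ℝ (Fin N) → ℝ, ContDiff ℝ 1 G ∧ HasCompactSupport G ∧
      ∀ z, ‖z‖ ≤ M → G z = F z ∧ fderiv ℝ G z = fderiv ℝ F z := by
  let χ : ContDiffBump (0 : EuclideanSpace ℝ (Fin N)) :=
    ⟨|M| + 1, |M| + 2, by positivity, by linarith⟩
  refine ⟨fun z => χ z * F z, χ.contDiff.mul hF, χ.hasCompactSupport.mul_right, fun z hz => ?_⟩
  have hball : z ∈ Metric.ball (0 : EuclideanSpace ℝ (Fin N)) (|M| + 1) := by
    rw [mem_ball_zero_iff]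
    linarith [le_abs_self M]
  have hev : (fun z => χ z * F z) =ᶠ[𝓝 z] F := by
    filter_upwards [Metric.isOpen_ball.mem_nhds hball] with y hy
    rw [χ.one_of_mem_closedBall (Metric.ball_subset_closedBall hy), one_mul]
  exact ⟨hev.eq_of_nhds, hev.fderiv_eq⟩

/-- The C¹ approximations of u need not be bounded, so F is replaced by a compactly supported G that
agrees with it on the range of u. The Lipschitz bound for G handles the supremum in time. The
gradients converge because DG is bounded and continuous, along a subsequence that converges a.e.
Finite volume serves only to give the functions G(f_k) finite norm. -/
theorem MemV.comp_of_bounded (hΩ : IsOpen Ω) (hvol : volume Ω < ⊤)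
    {u : SpaceTime n → EuclideanSpace ℝ (Fin N)} {Du : Fin n → SpaceTime n → EuclideanSpace ℝ (Fin N)}
    (hu : MemV Ω T u Du) {M : ℝ} (huM : ∀ᵐ p ∂(cylMeasure Ω T), ‖u p‖ ≤ M)
    {F : EuclideanSpace ℝ (Fin N) → ℝ} (hF : ContDiff ℝ 1 F) :
    MemV Ω T (fun p => F (u p)) (fun α p => fderiv ℝ F (u p) (Du α p)) := by
  obtain ⟨G, hG, hGc, hGF⟩ := exists_truncation hF M
  obtain ⟨B, hB⟩ := hGc.exists_bound_of_continuous hG.continuous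
  obtain ⟨L, hL⟩ := (hGc.fderiv ℝ).exists_bound_of_continuous (hG.continuous_fderiv (by simp))
  have hcG' : Continuous (fderiv ℝ G) := hG.continuous_fderiv (by simp)
  have hLip : ∀ x y, ‖G x - G y‖ ≤ L * ‖x - y‖ := fun x y =>
    convex_univ.norm_image_sub_le_of_norm_fderiv_le (𝕜 := ℝ)
      (fun x _ => hG.differentiable (by simp) x) (fun x _ => hL x) (mem_univ y) (mem_univ x)
  obtain ⟨f₀, c0, c1, c2, c3, c4, c5⟩ := hu.exists_approx hΩ
  obtain ⟨ns, hns, hae⟩ := (tendstoInMeasure_of_tendsto_eLpNorm two_ne_zero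
    (fun k => (c1 k).1) hu.1 c4).exists_seq_tendsto_ae
  have hns' := hns.tendsto_atTop
  set f : ℕ → SpaceTime n → EuclideanSpace ℝ (Fin N) := fun k => f₀ (ns k) with hf
  have hD : ∀ k α, ∀ᵐ p ∂(cylMeasure Ω T), spaceDeriv α (fun p => G (f k p)) p =
      fderiv ℝ G (f k p) (spaceDeriv α (f k) p) := by
    intro k α
    filter_upwards [ae_restrict_mem (isOpen_cylinder hΩ).measurableSet] with p hp
    have hd := ((c0 (ns k)).differentiableOn (by simp)).differentiableAt
      ((isOpen_cylinder hΩ).mem_nhds hp)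
    have h1 := ((hG.differentiable (by simp) (f k p)).hasFDerivAt.comp p hd.hasFDerivAt).fderiv
    have h2 : fderiv ℝ (fun p => G (f k p)) p = _ := h1
    simp only [spaceDeriv, h2]
    rfl
  have hmf : ∀ k, AEStronglyMeasurable (f k) (cylMeasure Ω T) := fun k => (c1 (ns k)).1
  have hbm : ∀ k, AEStronglyMeasurable (fun p => fderiv ℝ G (f k p)) (cylMeasure Ω T) := fun k =>
    hcG'.comp_aestronglyMeasurable (hmf k)
  have hDm : ∀ k α, MemLp (fun p => fderiv ℝ G (f k p) (spaceDeriv α (f k) p)) 2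
      (cylMeasure Ω T) := fun k α =>
    memLp_clm_apply (hbm k) (Eventually.of_forall fun p => hL _) (c2 (ns k) α)
  have hDv : ∀ α, MemLp (fun p => fderiv ℝ F (u p) (Du α p)) 2 (cylMeasure Ω T) := fun α =>
    memLp_fderiv_comp_apply hF hu.1 huM (hu.memLp_grad hΩ α)
  refine ⟨hF.continuous.comp_aestronglyMeasurable hu.1, fun α => (hDv α).1,
    fun k p => G (f k p), fun k => ⟨hG.comp_contDiffOn (c0 (ns k)), ?_⟩, ?_⟩
  · refine ENNReal.add_lt_top.2 ⟨?_, ?_⟩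
    · refine (essSup_le_of_ae_le (ENNReal.ofReal B ^ 2 * volume Ω)
        (Eventually.of_forall fun t => ?_)).trans_lt
        (ENNReal.mul_lt_top (ENNReal.pow_lt_top ENNReal.ofReal_lt_top) hvol)
      refine (lintegral_mono (g := fun _ => ENNReal.ofReal B ^ 2) fun x => ?_).trans (by simp)
      rw [← ofReal_norm]
      exact pow_le_pow_left' (ENNReal.ofReal_le_ofReal (hB _)) 2
    · have hDm' : ∀ α, MemLp (spaceDeriv α fun p => G (f k p)) 2 (cylMeasure Ω T) := fun α =>
        (hDm k α).ae_eq ((hD k α).mono fun p hp => hp.symm)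
      rw [lintegral_sum_enorm_sq fun α => (hDm' α).1]
      exact ENNReal.sum_lt_top.2 fun α _ => ENNReal.pow_lt_top (hDm' α).2
  · have hgrad : ∀ α, Tendsto (fun k => eLpNorm ((fun p => fderiv ℝ G (f k p)
        (spaceDeriv α (f k) p)) - fun p => fderiv ℝ G (u p) (Du α p)) 2 (cylMeasure Ω T))
        atTop (𝓝 0) := fun α =>
      tendsto_eLpNorm_clm_apply_sub (b := fun k p => fderiv ℝ G (f k p))
        (b₀ := fun p => fderiv ℝ G (u p)) (C := L) hbm
        (fun k => Eventually.of_forall fun p => hL _)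
        (by
          filter_upwards [hae] with p hp
          exact (hcG'.tendsto _).comp hp)
        (fun k => c2 (ns k) α) (hu.memLp_grad hΩ α) ((c5 α).comp hns')
    have hgrad' : Tendsto (fun k => ∑ α, eLpNorm ((fun p => fderiv ℝ G (f k p)
        (spaceDeriv α (f k) p)) - fun p => fderiv ℝ G (u p) (Du α p)) 2 (cylMeasure Ω T) ^ 2)
        atTop (𝓝 0) := by
      have := tendsto_finsetSum (Finset.univ : Finset (Fin n)) fun α _ =>
        ENNReal.Tendsto.pow (n := 2) (hgrad α)
      simpa using this
    have hsup : Tendsto (fun k => ENNReal.ofReal L ^ 2 * vNormSq Ω T (fun p => f k p - u p)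
        (fun α p => spaceDeriv α (f k) p - Du α p)) atTop (𝓝 0) := by
      have := ENNReal.Tendsto.const_mul (a := ENNReal.ofReal L ^ 2) (c3.comp hns')
        (Or.inr (ENNReal.pow_ne_top ENNReal.ofReal_ne_top))
      rw [mul_zero] at this
      exact this
    have hsum := hsup.add hgrad'
    rw [add_zero] at hsum
    refine tendsto_of_tendsto_of_tendsto_of_le_of_le tendsto_const_nhds hsum (fun _ => zero_le)
      fun k => ?_
    refine add_le_add ?_ (le_of_eq ?_)
    -- The bound on u holds a.e. in space-time, hence by Fubini for a.e. t at a.e. x, which suffices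
    -- for an essential supremum.
    · refine (essSup_mono_ae (g := fun t => ENNReal.ofReal L ^ 2 *
        ∫⁻ x in Ω, ‖f k (x, t) - u (x, t)‖ₑ ^ 2) ?_).trans ?_
      · filter_upwards [ae_ae_of_ae_cylMeasure huM] with t ht
        rw [← lintegral_const_mul' _ _ (ENNReal.pow_ne_top ENNReal.ofReal_ne_top)]
        refine lintegral_mono_ae ?_
        filter_upwards [ht] with x hx
        rw [← (hGF _ hx).1, ← mul_pow]
        gcongr
        rw [← ofReal_norm, ← ofReal_norm, ← ENNReal.ofReal_mul ((norm_nonneg _).trans (hL 0))]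
        exact ENNReal.ofReal_le_ofReal (hLip _ _)
      · rw [ENNReal.essSup_const_mul]
        gcongr
        exact le_self_add
    · rw [← lintegral_sum_enorm_sq fun α => (hDm k α).1.sub
        (memLp_clm_apply (hcG'.comp_aestronglyMeasurable hu.1)
          (Eventually.of_forall fun p => hL _) (hu.memLp_grad hΩ α)).1]
      refine lintegral_congr_ae ?_
      filter_upwards [huM, ae_all_iff.2 (hD k)] with p hp hDp
      simp only [hDp, (hGF _ hp).2, Pi.sub_apply]

end MemVComp

/-! ### The entropy inequality and the theorem. -/

section Entropy

variable {n N : ℕ} {Ω : Set (EuclideanSpace ℝ (Fin n))} {T : ℝ}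
  {a : Fin n → Fin n → SpaceTime n → EuclideanSpace ℝ (Fin N) → ℝ}
  {c : Fin N → Fin n → Fin n → SpaceTime n → EuclideanSpace ℝ (Fin N) → ℝ}
  {H : EuclideanSpace ℝ (Fin N) → ℝ} {u : SpaceTime n → EuclideanSpace ℝ (Fin N)}
  {Du : Fin n → SpaceTime n → EuclideanSpace ℝ (Fin N)}

theorem aestronglyMeasurable_entropyCoeff (hH : ContDiff ℝ 1 H)
    (ha : ∀ α β, AEStronglyMeasurable (fun p => a α β p (u p)) (cylMeasure Ω T))
    (hc : ∀ i α β, AEStronglyMeasurable (fun p => c i α β p (u p)) (cylMeasure Ω T))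
    (hu : AEStronglyMeasurable u (cylMeasure Ω T)) (α β : Fin n) :
    AEStronglyMeasurable (entropyCoeff a c H u α β) (cylMeasure Ω T) := by
  rw [funext (entropyCoeff_eq α β)]
  exact (ha α β).add (aestronglyMeasurable_clm_apply
    ((hH.continuous_fderiv (by simp)).comp_aestronglyMeasurable hu)
    (aestronglyMeasurable_couplingVec hc α β))

theorem abs_entropyCoeff_le {p : SpaceTime n} {K L : ℝ} (ha : ∀ α β, |a α β p (u p)| ≤ K)
    (hc : ∀ i α β, |c i α β p (u p)| ≤ K) (hL : ‖fderiv ℝ H (u p)‖ ≤ L) (α β : Fin n) :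
    |entropyCoeff a c H u α β p| ≤ K + L * (N * |K|) := by
  rw [entropyCoeff_eq]
  refine (abs_add_le _ _).trans (add_le_add (ha α β) ?_)
  exact ((fderiv ℝ H (u p)).le_opNorm _).trans (mul_le_mul hL
    (norm_couplingVec_le fun i => (hc i α β).trans (le_abs_self K)) (norm_nonneg _)
    ((norm_nonneg _).trans hL))

theorem gradNormSq_nonneg {F : Type*} [NormedAddCommGroup F] (Dw : Fin n → SpaceTime n → F)
    (p : SpaceTime n) : 0 ≤ gradNormSq Dw p :=
  Finset.sum_nonneg fun _ _ => sq_nonneg _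

theorem integrable_gradNormSq {F : Type*} [NormedAddCommGroup F] {Dw : Fin n → SpaceTime n → F}
    (h : ∀ α, MemLp (Dw α) 2 (cylMeasure Ω T)) :
    Integrable (gradNormSq Dw) (cylMeasure Ω T) :=
  integrable_finsetSum _ fun α _ => (h α).integrable_norm_pow two_ne_zero

/-- The entropy inequality for smooth nonnegative test functions. -/
theorem IsWeakSolution.entropy_inequality (hΩ : IsOpen Ω) (hu : IsWeakSolution Ω T a c H u Du)
    (hflux : ∀ α, MemLp (fluxVec a c H u Du α) 2 (cylMeasure Ω T)) {M : ℝ}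
    (huM : ∀ᵐ p ∂(cylMeasure Ω T), ‖u p‖ ≤ M) {F : EuclideanSpace ℝ (Fin N) → ℝ}
    (hF : ContDiff ℝ 2 F) {κ : ℝ} (hdis : ∀ᵐ p ∂(cylMeasure Ω T), κ * gradNormSq Du p ≤
      ∑ α, fderiv ℝ (fderiv ℝ F) (u p) (Du α p) (fluxVec a c H u Du α p))
    {ψ : SpaceTime n → ℝ} (hψ : IsTestFunction Ω T ψ) (hψ0 : ∀ p, 0 ≤ ψ p) :
    Integrable (fun p => κ * gradNormSq Du p * ψ p) (cylMeasure Ω T) ∧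
    ∫ p, κ * gradNormSq Du p * ψ p ∂(cylMeasure Ω T) ≤
      ∫ p, timeDeriv ψ p * F (u p) ∂(cylMeasure Ω T) -
        ∑ α, ∫ p, spaceDeriv α ψ p * fderiv ℝ F (u p) (fluxVec a c H u Du α p)
          ∂(cylMeasure Ω T) := by
  have hDu := hu.1.memLp_grad hΩ
  obtain ⟨B, hB⟩ := hψ.1.continuous.bounded_above_of_compact_support hψ.2.1
  have hψm : AEStronglyMeasurable ψ (cylMeasure Ω T) := hψ.1.continuous.aestronglyMeasurable
  have h1 : Integrable (fun p => κ * gradNormSq Du p * ψ p) (cylMeasure Ω T) :=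
    ((integrable_gradNormSq hDu).const_mul κ).mul_bdd hψm (Eventually.of_forall hB)
  have hF' : ContDiff ℝ 1 (fderiv ℝ F) := hF.fderiv_right (by norm_num)
  have hF'' : Continuous (fderiv ℝ (fderiv ℝ F)) := hF'.continuous_fderiv (by simp)
  obtain ⟨q, hq⟩ := exists_bound_on_closedBall hF'' M
  have h2 : ∀ α, Integrable (fun p => ψ p * fderiv ℝ (fderiv ℝ F) (u p) (Du α p)
      (fluxVec a c H u Du α p)) (cylMeasure Ω T) := fun α =>
    (integrable_bilin_apply (hF''.comp_aestronglyMeasurable hu.1.1)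
      (huM.mono fun p hp => hq _ hp) (hDu α) (hflux α)).bdd_mul hψm (Eventually.of_forall hB)
  refine ⟨h1, ?_⟩
  rw [hu.entropy_identity hΩ hflux huM hF hψ, Finset.sum_add_distrib, add_sub_cancel_left,
    ← integral_finsetSum _ fun α _ => h2 α]
  refine integral_mono_ae h1 (integrable_finsetSum _ fun α _ => h2 α) ?_
  filter_upwards [hdis] with p hp
  rw [← Finset.mul_sum, mul_comm]
  exact mul_le_mul_of_nonneg_left hp (hψ0 p)

/-- The inequality is extended to H¹₀ with J_α = DF(u) applied to the flux, which is in L². The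
structure identity `fderiv_expEntropy_fluxVec` is inserted only at the end, to replace J_α by
A_{αβ}v_{x_β}. -/
theorem IsWeakSolution.isWeakSubsolution_expEntropy (hΩ : IsOpen Ω)
    (hu : IsWeakSolution Ω T a c H u Du)
    (hflux : ∀ α, MemLp (fluxVec a c H u Du α) 2 (cylMeasure Ω T)) {M : ℝ}
    (huM : ∀ᵐ p ∂(cylMeasure Ω T), ‖u p‖ ≤ M) (hH : ContDiff ℝ 2 H) {s κ : ℝ} (hκ : 0 ≤ κ)
    (hdis : ∀ᵐ p ∂(cylMeasure Ω T), κ * gradNormSq Du p ≤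
      ∑ α, fderiv ℝ (fderiv ℝ (expEntropy H s)) (u p) (Du α p) (fluxVec a c H u Du α p)) :
    IsWeakSubsolution Ω T (entropyCoeff a c H u) (fun p => κ * gradNormSq Du p)
      (fun p => expEntropy H s (u p)) (fun α p => fderiv ℝ (expEntropy H s) (u p) (Du α p)) := by
  intro φ φt Dφ hφ hφ0 hint
  have hF := contDiff_expEntropy hH s
  have hF1 : ContDiff ℝ 1 (expEntropy H s) := hF.of_le (by norm_num)
  obtain ⟨C, hC⟩ := exists_bound_on_closedBall hF.continuous M
  have hJ : ∀ α, MemLp (fun p => fderiv ℝ (expEntropy H s) (u p) (fluxVec a c H u Du α p)) 2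
      (cylMeasure Ω T) := fun α => memLp_fderiv_comp_apply hF1 hu.1.1 huM (hflux α)
  have hint' : Integrable (fun p => φt p * expEntropy H s (u p)) (cylMeasure Ω T) := by
    simpa only [mul_comm] using hint
  obtain ⟨-, hDφ, hfφ, hle⟩ := integral_le_of_memH10 hΩ
    (hF.continuous.comp_aestronglyMeasurable hu.1.1) (huM.mono fun p hp => hC _ hp) hJ
    ((integrable_gradNormSq (hu.1.memLp_grad hΩ)).const_mul κ).1
    (fun p => mul_nonneg hκ (gradNormSq_nonneg Du p))
    (fun ψ hψ hψ0 => hu.entropy_inequality hΩ hflux huM hF hdis hψ hψ0) hφ hφ0 hint'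
  have hDJ : ∀ α, Integrable (fun p => Dφ α p *
      fderiv ℝ (expEntropy H s) (u p) (fluxVec a c H u Du α p)) (cylMeasure Ω T) := fun α =>
    (hDφ α).integrable_mul (hJ α)
  have hsum := integrable_finsetSum Finset.univ fun α _ => hDJ α
  have heq : (fun p => -(expEntropy H s (u p) * φt p) +
      (∑ α, ∑ β, entropyCoeff a c H u α β p * fderiv ℝ (expEntropy H s) (u p) (Du β p) * Dφ α p) +
      κ * gradNormSq Du p * φ p) = fun p => -(φt p * expEntropy H s (u p)) +
      (∑ α, Dφ α p * fderiv ℝ (expEntropy H s) (u p) (fluxVec a c H u Du α p)) +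
      κ * gradNormSq Du p * φ p := by
    funext p
    simp only [fderiv_expEntropy_fluxVec hH, mul_comm (φt p), ← Finset.sum_mul,
      mul_comm (Dφ _ p)]
  have hneg : Integrable (fun p => -(φt p * expEntropy H s (u p))) (cylMeasure Ω T) := hint'.neg
  have hfirst : Integrable (fun p => -(φt p * expEntropy H s (u p)) + ∑ α, Dφ α p *
      fderiv ℝ (expEntropy H s) (u p) (fluxVec a c H u Du α p)) (cylMeasure Ω T) := hneg.add hsum
  rw [heq]
  refine ⟨hfirst.add hfφ, ?_⟩
  rw [integral_add hfirst hfφ, integral_add hneg hsum, integral_neg,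
    integral_finsetSum _ fun α _ => hDJ α]
  linarith

end Entropy

theorem mainTheorem10 {n N : ℕ} (Ω : Set (EuclideanSpace ℝ (Fin n))) (hΩ : IsOpen Ω)
    (T : ℝ) (hT : 0 < T)
    (a : Fin n → Fin n → SpaceTime n → EuclideanSpace ℝ (Fin N) → ℝ)
    (c : Fin N → Fin n → Fin n → SpaceTime n → EuclideanSpace ℝ (Fin N) → ℝ)
    (H : EuclideanSpace ℝ (Fin N) → ℝ) (lam : ℝ) (hlam : 0 < lam)
    (hH : ContDiff ℝ 2 H)
    (hHconv : ∀ z ζ : EuclideanSpace ℝ (Fin N), lam * ‖ζ‖ ^ 2 ≤ fderiv ℝ (fderiv ℝ H) z ζ ζ)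
    (u : SpaceTime n → EuclideanSpace ℝ (Fin N))
    (Du : Fin n → SpaceTime n → EuclideanSpace ℝ (Fin N))
    -- the coefficients, evaluated along `u`, are measurable, bounded and strictly elliptic
    (ha_meas : ∀ α β, AEStronglyMeasurable (fun p => a α β p (u p)) (cylMeasure Ω T))
    (hc_meas : ∀ i α β, AEStronglyMeasurable (fun p => c i α β p (u p)) (cylMeasure Ω T))
    (hbdd : ∃ K : ℝ, ∀ᵐ p ∂(cylMeasure Ω T),
      (∀ α β, |a α β p (u p)| ≤ K) ∧ (∀ i α β, |c i α β p (u p)| ≤ K))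
    (ha_ell : ∀ᵐ p ∂(cylMeasure Ω T), ∀ ζ : Fin n → ℝ,
      lam * ∑ α, ζ α ^ 2 ≤ ∑ α, ∑ β, a α β p (u p) * ζ α * ζ β)
    (hA_ell : ∀ᵐ p ∂(cylMeasure Ω T), ∀ ξ : Fin N → Fin n → ℝ,
      lam * ∑ i, ∑ α, ξ i α ^ 2 ≤
        ∑ i, ∑ j, ∑ α, ∑ β, systemCoeff a c H i j α β p (u p) * ξ i α * ξ j β)
    -- `u` is a bounded weak solution
    (hu : IsWeakSolution Ω T a c H u Du)
    (hu_bdd : ∃ M : ℝ, ∀ᵐ p ∂(cylMeasure Ω T), ‖u p‖ ≤ M) :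
    -- the coefficients `A_{αβ}` of the scalar equation are measurable, bounded, strictly elliptic
    (∀ α β, AEStronglyMeasurable (entropyCoeff a c H u α β) (cylMeasure Ω T)) ∧
    (∃ K' : ℝ, ∀ᵐ p ∂(cylMeasure Ω T), ∀ α β, |entropyCoeff a c H u α β p| ≤ K') ∧
    (∀ᵐ p ∂(cylMeasure Ω T), ∀ ζ : Fin n → ℝ,
      lam * ∑ α, ζ α ^ 2 ≤ ∑ α, ∑ β, entropyCoeff a c H u α β p * ζ α * ζ β) ∧
    -- `v = exp (s H(u))` is an entropy for all sufficiently large `s`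
    ∃ s₀ : ℝ, 0 < s₀ ∧ ∀ s : ℝ, s₀ ≤ s →
      ∃ κ : ℝ, 0 < κ ∧ ∃ Dv : Fin n → SpaceTime n → ℝ,
        HasWeakSpatialGradient Ω T (fun p => Real.exp (s * H (u p))) Dv ∧
        (∀ α, MemLp (Dv α) 2 (cylMeasure Ω T)) ∧
        (volume Ω < ⊤ → MemV Ω T (fun p => Real.exp (s * H (u p))) Dv) ∧
        IsWeakSubsolution Ω T (entropyCoeff a c H u) (fun p => κ * gradNormSq Du p)
          (fun p => Real.exp (s * H (u p))) Dv := by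
  obtain ⟨K, hK⟩ := hbdd
  obtain ⟨M, hM⟩ := hu_bdd
  have hH1 : ContDiff ℝ 1 H := hH.of_le (by norm_num)
  have hH' : ContDiff ℝ 1 (fderiv ℝ H) := hH.fderiv_right (by norm_num)
  have hDu := hu.1.memLp_grad hΩ
  have hflux := memLp_fluxVec hH1 ha_meas hc_meas hK hu.1.1 hM hDu
  obtain ⟨L, hL⟩ := exists_bound_on_closedBall (hH1.continuous_fderiv (by simp)) M
  obtain ⟨q, hq⟩ := exists_bound_on_closedBall (hH'.continuous_fderiv (by simp)) M
  obtain ⟨B, hB⟩ := exists_bound_on_closedBall hH.continuous M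
  refine ⟨aestronglyMeasurable_entropyCoeff hH1 ha_meas hc_meas hu.1.1,
    ⟨K + L * (N * |K|), ?_⟩, ?_,
    -- The second entry is the threshold of `dissipation_ge`, where q bounds D²H on the ball of
    -- radius M and N|K| bounds the coupling vectors; the entry 1 makes s₀ positive.
    max 1 (n * (n + 1) * (q * (N * |K|)) ^ 2 / (2 * lam ^ 3)),
    lt_max_of_lt_left one_pos, fun s hs => ?_⟩
  · filter_upwards [hK, hM] with p hp hpM
    exact abs_entropyCoeff_le hp.1 hp.2 (hL _ hpM)
  · filter_upwards [ha_ell, hA_ell] with p hp hp'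
    exact entropyCoeff_elliptic hp hp'
  have hs0 : 0 < s := one_pos.trans_le ((le_max_left _ _).trans hs)
  have hF : ContDiff ℝ 1 (expEntropy H s) := (contDiff_expEntropy hH s).of_le (by norm_num)
  -- The dissipation constant is s v λ²/2, and v ≥ e^{-sB} a.e. because |H| ≤ B on the ball that
  -- contains the essential range of u.
  have hκ : 0 < s * Real.exp (-(s * B)) * (lam ^ 2 / 2) := by positivity
  refine ⟨s * Real.exp (-(s * B)) * (lam ^ 2 / 2), hκ,
    fun α p => fderiv ℝ (expEntropy H s) (u p) (Du α p),
    hu.1.hasWeakSpatialGradient_comp hΩ hM hF,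
    fun α => memLp_fderiv_comp_apply hF hu.1.1 hM (hDu α),
    fun hvol => hu.1.comp_of_bounded hΩ hvol hM hF,
    hu.isWeakSubsolution_expEntropy hΩ hflux hM hH hκ.le ?_⟩
  filter_upwards [hK, hM, ha_ell, hA_ell] with p hp hpM hpa hpA
  refine le_trans ?_ (dissipation_ge hH hlam hHconv hpa (entropyCoeff_elliptic hpa hpA) (hq _ hpM)
    (fun α β => norm_couplingVec_le fun i => (hp.2 i α β).trans (le_abs_self K)) hs0
    ((le_max_right _ _).trans hs))
  have hexp : Real.exp (-(s * B)) ≤ expEntropy H s (u p) := by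
    refine Real.exp_le_exp.2 ?_
    have := neg_le_of_abs_le (hB _ hpM)
    nlinarith
  have := gradNormSq_nonneg Du p
  gcongr
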